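/- There is a universal constant $C>0$ such that the following holds. Let $n\ge 2$, let $(\Omega,\mathcal F,\mathbb P)$ be a probability space with sub-$\sigma$-fields $\mathcal F_0\subset\mathcal F_1\subset\dots\subset\mathcal F_n$ of $\mathcal F$, and write $\mathbb E_j=\mathbb E(\,\cdot\mid\mathcal F_j)$. Let $d_1,\dots,d_n\in\mathbb L^4$ be real random variables such that $d_j$ is $\mathcal F_j$-measurable and $\mathbb E_{j-1}(d_j)=0$ for $1\le j\le n$, and $$\sum_{k=1}^n\mathbb E(d_k^2)=n .$$ Let $\theta=(\theta_1,\dots,\theta_n)$ be a random vector on $\Omega$, uniformly distributed on the Euclidean unit sphere $S^{n-1}$ of $\mathbb R^n$ and independent of $(d_1,\dots,d_n)$, and let $S_n(\theta)=\sum_{j=1}^n\theta_jd_j$. Put $$\alpha_n=\max_{1\le k\le n}\mathbb E(d_k^4),\qquad \beta_n=\mathbb E\Big[\Big(\frac1n\sum_{j=1}^n\big(\mathbb E_{j-1}(d_j^3)\big)^2\Big)^{1/2}\Big],$$ $$\sigma_4^2(n)=\frac1n\,\mathrm{Var}\Big(\sum_{k=1}^nd_k^2\Big),\qquad \gamma_n=\sum_{j=1}^n\mathbb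 E\big|\mathbb E_{j-1}(d_j^2)-\mathbb E(d_j^2)\big| ,$$ $$v_n=\gamma_n\log n+\beta_n(\log n)^{3/2}+\alpha_n(\log n)^2+\sigma_4^2(n)\log n .$$ Let $$\kappa_\theta=\sup_{t\in\mathbb R}\big|\mathbb P_{|\theta}(S_n(\theta)\le t)-\mathbb P_{|\theta}(N_\theta\le t)\big| ,$$ where $\mathbb P_{|\theta}$ is the conditional probability given $\theta$ and, conditionally on $\theta$, $N_\theta$ is normal with mean $0$ and variance $\sum_{i=1}^n\theta_i^2\,\mathbb E(d_i^2)$. Then $\kappa_\theta$ is integrable and $$\mathbb E(\kappa_\theta)\le C\,\frac{1+v_n}{n}.$$ -/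

import Mathlib

open MeasureTheory ProbabilityTheory

noncomputable section

namespace RandomizedMartingale

/-- The unit sphere `S^{n-1}` of `ℝⁿ` with its Euclidean norm. -/
abbrev UnitSphere (n : ℕ) : Type :=
  Metric.sphere (0 : EuclideanSpace ℝ (Fin n)) 1

/-- The uniform distribution on `S^{n-1}`: the normalized surface measure. -/
def uniformSphere (n : ℕ) : Measure (UnitSphere n) :=
  ((volume : Measure (EuclideanSpace ℝ (Fin n))).toSphere Set.univ)⁻¹ •
    (volume : Measure (EuclideanSpace ℝ (Fin n))).toSphere

/-- The Kolmogorov distance between two distributions on the real line. -/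
def kolmogorovDist (P Q : Measure ℝ) : ℝ :=
  ⨆ t : ℝ, |P.real (Set.Iic t) - Q.real (Set.Iic t)|

variable {Ω : Type*} {mΩ : MeasurableSpace Ω} {n : ℕ}

/-- `d` is a vector of martingale differences adapted to `ℱ 0 ≤ ⋯ ≤ ℱ n`. The entry `d j`, where
`j = 0, …, n - 1`, is the `(j + 1)`-st difference; it is `ℱ (j + 1)`-measurable and centered given
`ℱ j`. -/
structure IsMartingaleDifference (μ : Measure Ω) (ℱ : Filtration (Fin (n + 1)) mΩ)
    (d : Fin n → Ω → ℝ) : Prop where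
  measurable : ∀ j, Measurable[ℱ j.succ] (d j)
  integrable : ∀ j, Integrable (d j) μ
  condExp_eq_zero : ∀ j, μ[d j | ℱ j.castSucc] =ᵐ[μ] 0

/-- `α_n`, the largest fourth moment. -/
def alpha (μ : Measure Ω) (d : Fin n → Ω → ℝ) : ℝ :=
  ⨆ k, ∫ ω, d k ω ^ 4 ∂μ

/-- `β_n`, the mean of the quadratic average of the conditional third moments. -/
def beta (μ : Measure Ω) (ℱ : Filtration (Fin (n + 1)) mΩ) (d : Fin n → Ω → ℝ) : ℝ :=
  ∫ ω, √((1 / (n : ℝ)) *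
    ∑ j, (μ[fun ω' => d j ω' ^ 3 | ℱ j.castSucc]) ω ^ 2) ∂μ

/-- `σ_4²(n)`, the normalized variance of the sum of squares. -/
def sigmaFourSq (μ : Measure Ω) (d : Fin n → Ω → ℝ) : ℝ :=
  (1 / (n : ℝ)) * variance (fun ω => ∑ k, d k ω ^ 2) μ

/-- `γ_n`, the sum of the `L¹` distances from the conditional variances to the variances. -/
def gamma (μ : Measure Ω) (ℱ : Filtration (Fin (n + 1)) mΩ) (d : Fin n → Ω → ℝ) : ℝ :=
  ∑ j, ∫ ω, |(μ[fun ω' => d j ω' ^ 2 | ℱ j.castSucc]) ω - ∫ ω', d j ω' ^ 2 ∂μ| ∂μ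

/-- `v_n`. -/
def vBound (μ : Measure Ω) (ℱ : Filtration (Fin (n + 1)) mΩ) (d : Fin n → Ω → ℝ) : ℝ :=
  gamma μ ℱ d * Real.log n + beta μ ℱ d * Real.log n ^ (3 / 2 : ℝ)
    + alpha μ d * Real.log n ^ 2 + sigmaFourSq μ d * Real.log n

/-- The randomized sum `S_n(θ) = ∑ θ_j d_j`. -/
def randomizedSum (d : Fin n → Ω → ℝ) (θ : Ω → UnitSphere n) (ω : Ω) : ℝ :=
  ∑ j, (θ ω : EuclideanSpace ℝ (Fin n)) j * d j ω

/-- The conditional law of `N_θ` given `θ = x`: the centered normal law with variance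
`∑ x_i² E(d_i²)`. -/
def gaussianGiven (μ : Measure Ω) (d : Fin n → Ω → ℝ) (x : UnitSphere n) : Measure ℝ :=
  gaussianReal 0
    (Real.toNNReal (∑ i, (x : EuclideanSpace ℝ (Fin n)) i ^ 2 * ∫ ω, d i ω ^ 2 ∂μ))

/-- `κ_θ(P_{S_n(θ)}, P_{N_θ})` at `θ = x`: the Kolmogorov distance between the (regular)
conditional distributions of `S_n(θ)` and of `N_θ` given `θ = x`. -/
def kappa (μ : Measure Ω) [IsFiniteMeasure μ] (d : Fin n → Ω → ℝ) (θ : Ω → UnitSphere n)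
    (x : UnitSphere n) : ℝ :=
  kolmogorovDist (condDistrib (randomizedSum d θ) θ μ x) (gaussianGiven μ d x)

end RandomizedMartingale

end

/-!
Write `θ = x` for a point of the sphere, `P_x` for the law of `∑ x_j d_j` and `Q_x` for the centered
normal law with the same variance `v(x) = ∑ x_j² E(d_j²)`. By independence `P_x` is the conditional
law of `S_n(θ)` given `θ = x` (`kappa_ae_eq`), so the theorem is a bound on the mean over the sphere
of the Kolmogorov distance of `P_x` and `Q_x`.

Gaussian smoothing at scale `1 / n` (`ofReal_kolmogorovDist_le`) bounds this distance by
`O(1 / n)` plus an integral over `t > 0` of `exp (-t² / (2 n²)) |f_x(t) - g_x(t)| / t`, where `f_x`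
and `g_x` are the characteristic functions of `P_x` and `Q_x`. It needs a bounded density of `Q_x`,
that is `v(x) ≥ 1 / 2`, which fails with probability `O(α / n)` only
(`IsSphereUniform.measure_weighted_sum_le`). By Tonelli's theorem it remains to bound the mean over
`x` of `|f_x(t) - g_x(t)|` for each `t`.

For small `t` the differences are replaced one by one by Gaussian variables. The terms of order two
contribute `t² γ / n` and those of order four `t⁴ α / n`, because `x_j²` and `x_j⁴` have means of
orders `1 / n` and `1 / n²`. The terms of order three would only give `t³ β / √n` if their absolute
values were added, but the `j`-th one is odd in `x_j` and even in the later coordinates. The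
terms are therefore orthogonal on the sphere, and their sum is of order `t³ β / n`
(`integral_norm_vectorCharFun_sub_le`).

For large `t` both characteristic functions are small on average. With an independent copy
`(d'_j)` of `(d_j)`, the mean of `|f_x(t)|²` is the mean of the characteristic function of the
uniform law on the sphere at the vector `t (d - d')`. Up to terms of order `n^{-3}` and for
`t² ≤ √n`, the latter decays like `exp (-c t²)` as long as `|d - d'|² ≥ n / 4`
(`IsSphereUniform.norm_charFun_le`). The probability that this fails is `O(σ² / n)² + O(α / n)²`,
where `σ² = σ_4²(n)`, by Chebyshev's inequality for `∑ d_j²` and a fourth moment bound for the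
martingale `∑ d'_j d_j` (`measureReal_sum_sq_sub_lt`).

The two ranges are separated at a multiple of `√(log n)`. This produces the powers of `log n` in
`v_n`: `∫ t^k dt / t` up to this point for the low frequencies, and `∫ dt / t ≈ log n` up to the
cut-off at `n` for the high ones (`lintegral_exp_div_mul_le`).
-/

noncomputable section

/-! ### Spherical averages of characters: decay of Bessel integrals -/

namespace RandomizedMartingale

open Complex in
/-- The Taylor remainder of `u ↦ exp (i u)` is bounded by the first omitted term. -/
lemma norm_exp_mul_I_sub_sum_le (k : ℕ) (u : ℝ) :
    ‖exp (u * I) - ∑ j ∈ Finset.range (k + 1), (u * I) ^ j / (j.factorial : ℂ)‖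
      ≤ |u| ^ (k + 1) / (k + 1).factorial := by
  have key : ∀ (k : ℕ) (s : ℝ), |s| = 1 → ∀ u : ℝ, 0 ≤ u →
      ‖exp ((s * u : ℝ) * I) - ∑ j ∈ Finset.range k, ((s * u : ℝ) * I) ^ j / (j.factorial : ℂ)‖
        ≤ u ^ k / k.factorial := by
    intro k s hs
    induction k with
    | zero => intro u hu; simp [Complex.norm_exp]
    | succ k ih =>
      intro u hu
      have hd : ∀ x : ℝ, HasDerivAt (fun x : ℝ => exp ((s * x : ℝ) * I) -
          ∑ j ∈ Finset.range (k + 1), ((s * x : ℝ) * I) ^ j / (j.factorial : ℂ))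
          ((s * I) * (exp ((s * x : ℝ) * I) -
          ∑ j ∈ Finset.range k, ((s * x : ℝ) * I) ^ j / (j.factorial : ℂ))) x := by
        intro x
        have h1 : HasDerivAt (fun x : ℝ => ((s * x : ℝ) * I : ℂ)) (s * I) x := by
          have := ((hasDerivAt_id x).const_mul s).ofReal_comp.mul_const I
          simpa using this
        have h2 : HasDerivAt (fun x : ℝ => ∑ j ∈ Finset.range (k + 1),
            ((s * x : ℝ) * I) ^ j / (j.factorial : ℂ))
            ((s * I) * ∑ j ∈ Finset.range k, ((s * x : ℝ) * I) ^ j / (j.factorial : ℂ)) x := by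
          simp_rw [Finset.sum_range_succ']
          rw [Finset.mul_sum]
          have : HasDerivAt (fun x : ℝ => ∑ j ∈ Finset.range k,
              ((s * x : ℝ) * I) ^ (j + 1) / ((j + 1).factorial : ℂ))
              (∑ j ∈ Finset.range k, (s * I) * (((s * x : ℝ) * I) ^ j / (j.factorial : ℂ))) x := by
            apply HasDerivAt.fun_sum
            intro j _
            refine ((h1.pow (j + 1)).div_const ((j + 1).factorial : ℂ)).congr_deriv ?_
            have : ((j.factorial : ℕ) : ℂ) ≠ 0 := by exact_mod_cast j.factorial_ne_zero
            have h' : ((j : ℂ) + 1) ≠ 0 := by exact_mod_cast j.succ_ne_zero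
            rw [Nat.factorial_succ]
            push_cast
            field_simp
          simpa using this.add_const ((1 : ℂ))
        exact ((h1.cexp).sub h2).congr_deriv (by ring)
      have := image_norm_le_of_norm_deriv_right_le_deriv_boundary (a := 0) (b := u)
        (f := fun x : ℝ => exp ((s * x : ℝ) * I) -
          ∑ j ∈ Finset.range (k + 1), ((s * x : ℝ) * I) ^ j / (j.factorial : ℂ))
        (f' := fun x => ((s * I) * (exp ((s * x : ℝ) * I) -
          ∑ j ∈ Finset.range k, ((s * x : ℝ) * I) ^ j / (j.factorial : ℂ))))
        (fun x _ => (hd x).continuousAt.continuousWithinAt)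
        (fun x _ => (hd x).hasDerivWithinAt)
        (B := fun x => x ^ (k + 1) / (k + 1).factorial) (B' := fun x => x ^ k / k.factorial)
        (by simp [Finset.sum_range_succ'])
        (fun x => by
          refine ((hasDerivAt_pow (k + 1) x).div_const ((k + 1).factorial : ℝ)).congr_deriv ?_
          have : ((k.factorial : ℕ) : ℝ) ≠ 0 := by exact_mod_cast k.factorial_ne_zero
          have h' : ((k : ℝ) + 1) ≠ 0 := by exact_mod_cast k.succ_ne_zero
          rw [Nat.factorial_succ]
          push_cast
          field_simp)
        (fun x hx => by
          rw [norm_mul, norm_mul, norm_I, mul_one, norm_real, Real.norm_eq_abs, hs, one_mul]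
          exact ih x hx.1)
      exact this ⟨hu, le_rfl⟩
  rcases le_total 0 u with h | h
  · have := key (k + 1) 1 (by simp) u h
    rw [abs_of_nonneg h]
    simpa using this
  · have := key (k + 1) (-1) (by simp) (-u) (by linarith)
    rw [abs_of_nonpos h]
    simpa using this

/-- A quantitative form of `|sin r| ≤ r`. On `[1, 2]` it follows from the value at `1` because the
sine is `1`-Lipschitz. -/
lemma abs_sin_le_mul_one_sub {r : ℝ} (hr : 0 ≤ r) :
    |Real.sin r| ≤ r * (1 - min (r ^ 2) 1 / 20) := by
  have h1 : ∀ x : ℝ, 0 ≤ x → x ≤ 1 → Real.sin x ≤ x - x ^ 3 / 6 + x ^ 5 / 100 := by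
    intro x h0 h1
    have := Real.sin_bound (x := x) (by rwa [abs_of_nonneg h0])
    rw [abs_le, abs_of_nonneg h0] at this
    linarith [this.2]
  rcases le_total r 1 with h | h
  · rw [abs_of_nonneg (Real.sin_nonneg_of_nonneg_of_le_pi hr (by linarith [Real.pi_gt_three])),
      min_eq_left (by nlinarith)]
    have := h1 r hr h
    have h4 : r ^ 5 ≤ r ^ 3 := pow_le_pow_of_le_one hr h (by norm_num)
    nlinarith [pow_nonneg hr 3]
  · rw [min_eq_right (by nlinarith)]
    have hs := h1 1 (by norm_num) le_rfl
    rcases le_total r 2 with h2 | h2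
    · have h0 : Real.sin 1 ≥ 0 :=
        Real.sin_nonneg_of_nonneg_of_le_pi (by norm_num) (by linarith [Real.pi_gt_three])
      have hd : |Real.sin r - Real.sin 1| ≤ |r - 1| := by
        have hl : LipschitzWith 1 Real.sin := lipschitzWith_of_nnnorm_deriv_le
          Real.differentiable_sin (fun x => by
            rw [Real.deriv_sin, ← NNReal.coe_le_coe]; simpa using Real.abs_cos_le_one x)
        simpa [Real.dist_eq] using hl.dist_le_mul r 1
      rw [abs_of_nonneg (by linarith : (0 : ℝ) ≤ r - 1)] at hd
      have : |Real.sin r| ≤ |Real.sin r - Real.sin 1| + Real.sin 1 := by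
        have := abs_add_le (Real.sin r - Real.sin 1) (Real.sin 1)
        rwa [sub_add_cancel, abs_of_nonneg h0] at this
      linarith
    · linarith [Real.abs_sin_le_one r]

open Complex in
lemma integral_exp_cos_mul_sin {r : ℝ} (hr : r ≠ 0) :
    ∫ φ in (0 : ℝ)..Real.pi, exp ((r * Real.cos φ : ℝ) * I) * (Real.sin φ : ℂ)
      = ((2 * Real.sin r / r : ℝ) : ℂ) := by
  have hd : ∀ φ ∈ Set.uIcc 0 Real.pi, HasDerivAt
      (fun φ : ℝ => - (exp ((r * Real.cos φ : ℝ) * I) / (r * I)))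
      (exp ((r * Real.cos φ : ℝ) * I) * (Real.sin φ : ℂ)) φ := by
    intro φ _
    have h1 : HasDerivAt (fun φ : ℝ => ((r * Real.cos φ : ℝ) * I : ℂ))
        (((r * (-Real.sin φ) : ℝ) : ℂ) * I) φ :=
      ((Real.hasDerivAt_cos φ).const_mul r).ofReal_comp.mul_const I
    refine (h1.cexp.div_const (r * I : ℂ)).neg.congr_deriv ?_
    have : (r : ℂ) ≠ 0 := by exact_mod_cast hr
    push_cast
    field_simp
  rw [intervalIntegral.integral_eq_sub_of_hasDerivAt hd (Continuous.intervalIntegrable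
    (by fun_prop) _ _)]
  have : (r : ℂ) ≠ 0 := by exact_mod_cast hr
  rw [show ((2 * Real.sin r / r : ℝ) : ℂ) = 2 * Complex.sin r / r by push_cast; rfl]
  simp only [Real.cos_pi, Real.cos_zero, mul_neg, mul_one]
  rw [Complex.sin]
  push_cast
  field_simp
  linear_combination (cexp (↑r * I) - cexp (-(↑r * I))) * I_sq

open Complex in
/-- The radial case of the decay of `J₀`. -/
lemma norm_integral_exp_cos_le {r : ℝ} (hr : 0 ≤ r) :
    ‖∫ φ in (-Real.pi)..Real.pi, exp ((r * Real.cos φ : ℝ) * I)‖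
      ≤ 2 * Real.pi * (1 - min (r ^ 2) 1 / 40) := by
  have hpi := Real.pi_pos
  have hsymm : ∫ φ in (-Real.pi)..Real.pi, exp ((r * Real.cos φ : ℝ) * I)
      = 2 * ∫ φ in (0:ℝ)..Real.pi, exp ((r * Real.cos φ : ℝ) * I) := by
    have h1 := intervalIntegral.integral_comp_neg (a := 0) (b := Real.pi)
      (fun φ : ℝ => exp ((r * Real.cos φ : ℝ) * I))
    simp only [Real.cos_neg, neg_zero] at h1
    rw [← intervalIntegral.integral_add_adjacent_intervals (b := 0)
      (Continuous.intervalIntegrable (by fun_prop) _ _)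
      (Continuous.intervalIntegrable (by fun_prop) _ _), ← h1]
    ring
  -- Only the part with the weight `sin φ` is used for the decay; the rest has mass `π - 2`.
  have hsplit : ∫ φ in (0:ℝ)..Real.pi, exp ((r * Real.cos φ : ℝ) * I)
      = (∫ φ in (0:ℝ)..Real.pi, exp ((r * Real.cos φ : ℝ) * I) * ((1 - Real.sin φ : ℝ) : ℂ))
        + ∫ φ in (0:ℝ)..Real.pi, exp ((r * Real.cos φ : ℝ) * I) * (Real.sin φ : ℂ) := by
    rw [← intervalIntegral.integral_add
      (Continuous.intervalIntegrable (by fun_prop) _ _)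
      (Continuous.intervalIntegrable (by fun_prop) _ _)]
    congr 1; ext φ; push_cast; ring
  have hA : ‖∫ φ in (0:ℝ)..Real.pi, exp ((r * Real.cos φ : ℝ) * I) * ((1 - Real.sin φ : ℝ) : ℂ)‖
      ≤ Real.pi - 2 := by
    have : ∫ φ in (0:ℝ)..Real.pi, (1 - Real.sin φ) = Real.pi - 2 := by
      rw [intervalIntegral.integral_sub (by simp) (Real.continuous_sin.intervalIntegrable _ _)]
      simp; norm_num
    rw [← this]
    refine intervalIntegral.norm_integral_le_of_norm_le hpi.le ?_
      (Continuous.intervalIntegrable (by fun_prop) _ _)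
    refine Filter.Eventually.of_forall fun φ _ => ?_
    rw [norm_mul, norm_exp_ofReal_mul_I, one_mul, norm_real, Real.norm_eq_abs,
      abs_of_nonneg (by linarith [Real.sin_le_one φ])]
  have hB : ‖∫ φ in (0:ℝ)..Real.pi, exp ((r * Real.cos φ : ℝ) * I) * (Real.sin φ : ℂ)‖
      ≤ 2 * (1 - min (r ^ 2) 1 / 20) := by
    rcases hr.eq_or_lt with rfl | h0
    · have : ‖∫ φ in (0:ℝ)..Real.pi, exp (((0:ℝ) * Real.cos φ : ℝ) * I) * (Real.sin φ : ℂ)‖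
        ≤ ∫ φ in (0:ℝ)..Real.pi, Real.sin φ := by
        refine intervalIntegral.norm_integral_le_of_norm_le hpi.le ?_
          (Continuous.intervalIntegrable (by fun_prop) _ _)
        refine Filter.Eventually.of_forall fun φ hφ => ?_
        rw [norm_mul, norm_exp_ofReal_mul_I, one_mul, norm_real, Real.norm_eq_abs,
          abs_of_nonneg (Real.sin_nonneg_of_nonneg_of_le_pi hφ.1.le hφ.2)]
      refine this.trans ?_
      simp; norm_num
    · rw [integral_exp_cos_mul_sin h0.ne', norm_real, Real.norm_eq_abs, abs_div, abs_mul,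
        abs_of_pos h0, abs_two, div_le_iff₀ h0]
      nlinarith [abs_sin_le_mul_one_sub hr]
  rw [hsymm, hsplit, norm_mul]
  have := (norm_add_le _ _).trans (add_le_add hA hB)
  have hpi4 := Real.pi_le_four
  have hm : 0 ≤ min (r ^ 2) 1 := by positivity
  rw [Complex.norm_two]
  nlinarith

open Complex in
/-- Decay of the Bessel function `J₀`: the mean of a plane wave over a circle of radius `r` is at
most `exp (-min (r², 1) / 40)`. Part of the uniform law on the circle projects to the uniform law
on `[-1, 1]`, whose Fourier transform is `sin r / r`. -/
lemma norm_integral_exp_cos_sin_le (a b : ℝ) :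
    ‖∫ φ in (-Real.pi)..Real.pi, exp ((a * Real.cos φ + b * Real.sin φ : ℝ) * I)‖
      ≤ 2 * Real.pi * Real.exp (-(min (a ^ 2 + b ^ 2) 1 / 40)) := by
  set z : ℂ := ⟨a, b⟩ with hz
  have hr : ‖z‖ ^ 2 = a ^ 2 + b ^ 2 := by
    rw [Complex.sq_norm, Complex.normSq_apply]; simp [hz]; ring
  have ha : a = ‖z‖ * Real.cos z.arg := (Complex.norm_mul_cos_arg z).symm
  have hb : b = ‖z‖ * Real.sin z.arg := (Complex.norm_mul_sin_arg z).symm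
  have hper : Function.Periodic (fun φ : ℝ => exp ((‖z‖ * Real.cos φ : ℝ) * I)) (2 * Real.pi) := by
    intro φ; simp [Real.cos_add_two_pi]
  have heq : ∫ φ in (-Real.pi)..Real.pi, exp ((a * Real.cos φ + b * Real.sin φ : ℝ) * I)
      = ∫ φ in (-Real.pi)..Real.pi, exp ((‖z‖ * Real.cos φ : ℝ) * I) := by
    have h1 : ∀ φ : ℝ, a * Real.cos φ + b * Real.sin φ = ‖z‖ * Real.cos (φ - z.arg) := by
      intro φ
      rw [Real.cos_sub]
      conv_lhs => rw [ha, hb]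
      ring
    simp_rw [h1]
    rw [intervalIntegral.integral_comp_sub_right
      (fun φ : ℝ => exp ((‖z‖ * Real.cos φ : ℝ) * I))]
    have := hper.intervalIntegral_add_eq (-Real.pi - z.arg) (-Real.pi)
    rw [show -Real.pi - z.arg + 2 * Real.pi = Real.pi - z.arg by ring,
      show -Real.pi + 2 * Real.pi = Real.pi by ring] at this
    exact this
  rw [heq, ← hr]
  refine (norm_integral_exp_cos_le (norm_nonneg z)).trans ?_
  have := Real.add_one_le_exp (-(min (‖z‖ ^ 2) 1 / 40))
  have hpi := Real.pi_pos
  gcongr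
  linarith

end RandomizedMartingale

/-! ### The uniform distribution on the sphere: invariance and moments -/

namespace RandomizedMartingale

/-- The uniform distribution on the unit sphere, seen as a measure on the ambient Euclidean space:
a probability measure which is carried by the sphere and is invariant under linear isometries. -/
structure IsSphereUniform {n : ℕ} (ν : Measure (EuclideanSpace ℝ (Fin n))) : Prop where
  isProbabilityMeasure : IsProbabilityMeasure ν
  map_eq : ∀ U : EuclideanSpace ℝ (Fin n) ≃ₗᵢ[ℝ] EuclideanSpace ℝ (Fin n), ν.map U = ν
  norm_eq_one : ∀ᵐ x ∂ν, ‖x‖ = 1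

open scoped Pointwise in
/-- Linear isometries preserve the volume of the cones `A • s` that define the surface measure. -/
lemma measure_smul_image_isometry {n : ℕ}
    (U : EuclideanSpace ℝ (Fin n) ≃ₗᵢ[ℝ] EuclideanSpace ℝ (Fin n))
    (A : Set ℝ) (s : Set (EuclideanSpace ℝ (Fin n))) :
    volume (A • (U '' s)) = volume (A • s) := by
  have h1 : A • (U '' s) = U '' (A • s) := by
    rw [← Set.image2_smul, ← Set.image2_smul, Set.image_image2, Set.image2_image_right]
    simp
  have h2 : U '' (A • s) = U.symm ⁻¹' (A • s) := by
    ext x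
    constructor
    · rintro ⟨y, hy, rfl⟩
      simpa using hy
    · intro hx
      exact ⟨U.symm x, hx, by simp⟩
  rw [h1, h2]
  exact U.symm.measurePreserving.measure_preimage_emb
    U.symm.toHomeomorph.measurableEmbedding _

lemma isSphereUniform_uniformSphere {n : ℕ} (hn : 2 ≤ n) :
    IsSphereUniform ((uniformSphere n).map
      (Subtype.val : UnitSphere n → EuclideanSpace ℝ (Fin n))) := by
  set τ := (volume : Measure (EuclideanSpace ℝ (Fin n))).toSphere with hτ
  have : Nonempty (Fin n) := ⟨⟨0, by omega⟩⟩
  have : Nontrivial (EuclideanSpace ℝ (Fin n)) := by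
    apply Module.nontrivial_of_finrank_pos (R := ℝ); simp; omega
  have hne : τ ≠ 0 := Measure.toSphere_ne_zero _
  have h0 : τ Set.univ ≠ 0 := by simpa using hne
  have hp : IsProbabilityMeasure (uniformSphere n) := by
    constructor
    rw [uniformSphere, Measure.smul_apply, smul_eq_mul]
    exact ENNReal.inv_mul_cancel h0 (measure_ne_top _ _)
  have hm : Measurable (Subtype.val : UnitSphere n → EuclideanSpace ℝ (Fin n)) :=
    measurable_subtype_coe
  refine ⟨Measure.isProbabilityMeasure_map hm.aemeasurable, fun U => ?_, ?_⟩
  · have hinv : (τ.map (Subtype.val : UnitSphere n → EuclideanSpace ℝ (Fin n))).map U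
        = τ.map Subtype.val := by
      ext s hs
      have hU : Measurable U := U.continuous.measurable
      rw [Measure.map_apply hU hs, Measure.map_apply hm (hU hs), Measure.map_apply hm hs,
        Measure.toSphere_apply' _ (hm (hU hs)), Measure.toSphere_apply' _ (hm hs),
        ← measure_smul_image_isometry U]
      congr 3
      ext x
      simp only [Set.mem_image, Set.mem_preimage, Subtype.exists, mem_sphere_zero_iff_norm,
        exists_and_left, exists_prop]
      constructor
      · rintro ⟨y, ⟨z, h1, h2, rfl⟩, rfl⟩
        exact ⟨_, h1, by simpa using h2, rfl⟩
      · rintro ⟨y, h1, h2, rfl⟩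
        exact ⟨U.symm y, ⟨_, by simpa using h1, by simpa using h2, rfl⟩, by simp⟩
    rw [uniformSphere, Measure.map_smul, Measure.map_smul, hinv]
  · rw [ae_map_iff hm.aemeasurable (measurableSet_eq_fun (by fun_prop) (by fun_prop))]
    exact Filter.Eventually.of_forall fun x => by simp

namespace IsSphereUniform

variable {n : ℕ} {ν : Measure (EuclideanSpace ℝ (Fin n))}

lemma integrable_of_continuous (h : IsSphereUniform ν) {G : Type*} [NormedAddCommGroup G]
    {F : EuclideanSpace ℝ (Fin n) → G} (hF : Continuous F) :
    Integrable F ν := by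
  have := h.isProbabilityMeasure
  obtain ⟨C, hC⟩ := (isCompact_sphere (0 : EuclideanSpace ℝ (Fin n)) 1).exists_bound_of_continuousOn
    hF.continuousOn
  refine Integrable.of_bound hF.aestronglyMeasurable C ?_
  filter_upwards [h.norm_eq_one] with x hx
  exact hC x (by simpa using hx)

lemma integral_comp_isometry (h : IsSphereUniform ν) {G : Type*} [NormedAddCommGroup G]
    [NormedSpace ℝ G] (U : EuclideanSpace ℝ (Fin n) ≃ₗᵢ[ℝ] EuclideanSpace ℝ (Fin n))
    (F : EuclideanSpace ℝ (Fin n) → G) : ∫ x, F (U x) ∂ν = ∫ x, F x ∂ν := by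
  conv_rhs => rw [← h.map_eq U]
  exact (integral_map_equiv U.toHomeomorph.toMeasurableEquiv F).symm

/-- The law of `⟪v, θ⟫` depends on the norm of `v` only. -/
lemma integral_comp_inner (h : IsSphereUniform ν) {G : Type*} [NormedAddCommGroup G]
    [NormedSpace ℝ G] (F : ℝ → G) {v w : EuclideanSpace ℝ (Fin n)} (hvw : ‖v‖ = ‖w‖) :
    ∫ x, F (inner ℝ v x) ∂ν = ∫ x, F (inner ℝ w x) ∂ν := by
  set U := Submodule.reflection (Submodule.span ℝ {v - w})ᗮ
  have hU : U v = w := Submodule.reflection_sub hvw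
  rw [← h.integral_comp_isometry U (fun x => F (inner ℝ w x))]
  simp [← hU, LinearIsometryEquiv.inner_map_map]

/-- The coordinates are symmetric, each conditionally on all the other ones. -/
lemma integral_comp_neg_coord (h : IsSphereUniform ν) {G : Type*} [NormedAddCommGroup G]
    [NormedSpace ℝ G] (F : EuclideanSpace ℝ (Fin n) → G) (k : Fin n) :
    ∫ x, F (WithLp.toLp 2 fun j => if j = k then - x j else x j) ∂ν = ∫ x, F x ∂ν := by
  rw [← h.integral_comp_isometry (LinearIsometryEquiv.piLpCongrRight 2
    (fun j => if j = k then LinearIsometryEquiv.neg ℝ else LinearIsometryEquiv.refl ℝ ℝ)) F]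
  congr 1
  ext x
  congr 1
  ext j
  by_cases hj : j = k <;> simp [hj]

lemma integral_comp_coord (h : IsSphereUniform ν) {G : Type*} [NormedAddCommGroup G]
    [NormedSpace ℝ G] (F : ℝ → G) (c : ℝ) (j : Fin n) {w : EuclideanSpace ℝ (Fin n)}
    (hw : ‖w‖ = |c|) : ∫ x, F (c * x j) ∂ν = ∫ x, F (inner ℝ w x) ∂ν := by
  rw [← h.integral_comp_inner F (v := EuclideanSpace.single j c) (by simp [hw])]
  simp [EuclideanSpace.inner_single_left]

lemma ae_sum_sq (h : IsSphereUniform ν) : ∀ᵐ x ∂ν, ∑ j, x j ^ 2 = 1 := by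
  filter_upwards [h.norm_eq_one] with x hx
  have := EuclideanSpace.real_norm_sq_eq x
  rw [hx] at this
  simpa using this.symm

/-- The coordinate `√n θ_j` is sub-Gaussian with variance proxy `1`: it has the law of `∑ ε_i θ_i`
for every choice of signs `ε`, and averaging over the signs gives a product of hyperbolic
cosines. -/
lemma integral_exp_coord_le (h : IsSphereUniform ν) (l : ℝ) (j : Fin n) :
    ∫ x, Real.exp (l * √n * x j) ∂ν ≤ Real.exp (l ^ 2 / 2) := by
  have := h.isProbabilityMeasure
  let s : Bool → ℝ := fun b => if b then 1 else -1
  have hs : ∀ b, s b ^ 2 = 1 := by intro b; cases b <;> simp [s]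
  have h1 : ∀ ε : Fin n → Bool, ∫ x, Real.exp (l * √n * x j) ∂ν
      = ∫ x, ∏ i, Real.exp (l * s (ε i) * x i) ∂ν := by
    intro ε
    rw [h.integral_comp_coord Real.exp (l * √n) j (w := WithLp.toLp 2 fun i => l * s (ε i))]
    · congr 1; ext x
      rw [← Real.exp_sum]
      simp [PiLp.inner_apply, mul_comm]
    · rw [EuclideanSpace.norm_eq]
      simp [mul_pow, hs, abs_mul]
      rw [Real.sqrt_sq_eq_abs, abs_of_nonneg (Real.sqrt_nonneg _), mul_comm]
  have h2 : (2 : ℝ) ^ n * ∫ x, Real.exp (l * √n * x j) ∂ν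
      = ∫ x, ∏ i, (2 * Real.cosh (l * x i)) ∂ν := by
    have : (2 : ℝ) ^ n * ∫ x, Real.exp (l * √n * x j) ∂ν
        = ∑ ε : Fin n → Bool, ∫ x, Real.exp (l * √n * x j) ∂ν := by simp
    rw [this, Finset.sum_congr rfl (fun ε _ => h1 ε), ← integral_finsetSum]
    · congr 1; ext x
      have : ∀ i, 2 * Real.cosh (l * x i) = ∑ b : Bool, Real.exp (l * s b * x i) := by
        intro i; simp [s, Real.cosh_eq]; ring
      simp_rw [this]
      rw [Fintype.prod_sum]
    · intro ε _
      exact h.integrable_of_continuous (by fun_prop)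
  have h3 : ∫ x, ∏ i, (2 * Real.cosh (l * x i)) ∂ν ≤ ∫ x, 2 ^ n * Real.exp (l ^ 2 / 2) ∂ν := by
    refine integral_mono_ae (h.integrable_of_continuous ?_) (integrable_const _) ?_
    · exact continuous_finsetProd _ fun i _ =>
        continuous_const.mul (Real.continuous_cosh.comp (by fun_prop))
    filter_upwards [h.ae_sum_sq] with x hx
    rw [Finset.prod_mul_distrib]
    simp only [Finset.prod_const, Finset.card_univ, Fintype.card_fin]
    gcongr
    calc ∏ i, Real.cosh (l * x i) ≤ ∏ i, Real.exp ((l * x i) ^ 2 / 2) :=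
          Finset.prod_le_prod (fun i _ => (Real.cosh_pos _).le)
            fun i _ => Real.cosh_le_exp_half_sq _
      _ = _ := by
          rw [← Real.exp_sum, ← Finset.sum_div]
          simp_rw [mul_pow]
          rw [← Finset.mul_sum, hx, mul_one]
  rw [integral_const] at h3
  simp only [probReal_univ, smul_eq_mul, one_mul] at h3
  rw [← h2] at h3
  exact le_of_mul_le_mul_left h3 (by positivity)

/-- The moments of `√n θ_j` are bounded uniformly in `n`, by comparison with its exponential
moments. -/
lemma integral_coord_pow_le (h : IsSphereUniform ν) (p : ℕ) (j : Fin n) :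
    ∫ x, x j ^ (2 * p) ∂ν ≤ 4 * (2 * p).factorial / n ^ p := by
  have := h.isProbabilityMeasure
  have hn : (0 : ℝ) < n := by exact_mod_cast j.pos
  have hexp : Real.exp (1 / 2) ≤ 2 := by
    have h1 := Real.exp_one_lt_d9
    have h2 : Real.exp (1 / 2) ^ 2 = Real.exp 1 := by rw [← Real.exp_nat_mul]; norm_num
    nlinarith [Real.exp_pos (1 / 2)]
  have h1 := h.integral_exp_coord_le 1 j
  have h2 := h.integral_exp_coord_le (-1) j
  have h3 : ∫ x, (√n * x j) ^ (2 * p) ∂ν ≤ ∫ x, (2 * p).factorial *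
      (Real.exp (1 * √n * x j) + Real.exp (-1 * √n * x j)) ∂ν := by
    refine integral_mono (h.integrable_of_continuous (by fun_prop))
      (h.integrable_of_continuous (by fun_prop)) fun x => ?_
    have h4 := Real.pow_div_factorial_le_exp |√n * x j| (abs_nonneg _) (2 * p)
    rw [(even_two_mul p).pow_abs, div_le_iff₀ (by positivity)] at h4
    have h5 : Real.exp |√n * x j| ≤ Real.exp (1 * √n * x j) + Real.exp (-1 * √n * x j) := by
      rcases abs_cases (√n * x j) with ⟨e, _⟩ | ⟨e, _⟩ <;> rw [e]
      · rw [one_mul]; linarith [Real.exp_pos (-1 * √n * x j)]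
      · rw [neg_mul, neg_mul, one_mul]; linarith [Real.exp_pos (√n * x j)]
    calc (√n * x j) ^ (2 * p) ≤ _ := h4
      _ ≤ _ := by rw [mul_comm]; gcongr
  rw [integral_const_mul, integral_add (h.integrable_of_continuous (by fun_prop))
    (h.integrable_of_continuous (by fun_prop))] at h3
  simp_rw [mul_pow] at h3
  rw [integral_const_mul, pow_mul, Real.sq_sqrt hn.le] at h3
  rw [le_div_iff₀ (by positivity), mul_comm]
  refine h3.trans ?_
  rw [mul_comm (4 : ℝ)]
  gcongr
  norm_num at h1 h2 hexp ⊢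
  linarith

lemma integral_coord_sq (h : IsSphereUniform ν) (j : Fin n) :
    ∫ x, x j ^ 2 ∂ν = 1 / n := by
  have := h.isProbabilityMeasure
  have hn : (0 : ℝ) < n := by exact_mod_cast j.pos
  have h1 : ∀ i, ∫ x, x i ^ 2 ∂ν = ∫ x, x j ^ 2 ∂ν := by
    intro i
    have e1 := h.integral_comp_coord (fun y => y ^ 2) 1 i (w := EuclideanSpace.single j 1)
      (by simp)
    simpa [EuclideanSpace.inner_single_left] using e1
  have h2 : ∑ i, ∫ x, x i ^ 2 ∂ν = 1 := by
    rw [← integral_finsetSum _ fun i _ => h.integrable_of_continuous (by fun_prop),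
      integral_congr_ae h.ae_sum_sq]
    simp
  simp_rw [h1] at h2
  simp at h2
  field_simp
  linarith

lemma integral_coord_pow_four_eq (h : IsSphereUniform ν) (i j : Fin n) :
    ∫ x, x i ^ 4 ∂ν = ∫ x, x j ^ 4 ∂ν := by
  have e1 := h.integral_comp_coord (fun y => y ^ 4) 1 i (w := EuclideanSpace.single j 1)
    (by simp)
  simpa [EuclideanSpace.inner_single_left] using e1

/-- Rotating by `45` degrees in a coordinate plane compares mixed and pure fourth moments. -/
lemma integral_coord_sq_mul_sq (h : IsSphereUniform ν) {i j : Fin n} (hij : i ≠ j) :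
    ∫ x, x i ^ 2 * x j ^ 2 ∂ν = (∫ x, x j ^ 4 ∂ν) / 3 := by
  have key : ∀ s : ℝ, s ^ 2 = 1 →
      ∫ x, (x i + s * x j) ^ 4 ∂ν = 4 * ∫ x, x j ^ 4 ∂ν := by
    intro s hs
    have e1 := h.integral_comp_coord (fun y => y ^ 4) √2 j
      (w := EuclideanSpace.single i 1 + EuclideanSpace.single j s) (by
        rw [EuclideanSpace.norm_eq]
        rw [abs_of_nonneg (by positivity)]
        congr 1
        rw [← Finset.sum_subset (Finset.subset_univ {i, j})]
        · rw [Finset.sum_pair hij]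
          simp [hij, hij.symm, hs]; norm_num
        · intro k _ hk
          simp only [Finset.mem_insert, Finset.mem_singleton, not_or] at hk
          simp [hk.1, hk.2])
    simp only [inner_add_left, EuclideanSpace.inner_single_left, map_one, one_mul,
      Real.ringHom_apply, mul_pow] at e1
    rw [← e1, integral_const_mul]
    have : √2 ^ 4 = 4 := by
      rw [show (4 : ℕ) = 2 * 2 by norm_num, pow_mul, Real.sq_sqrt (by norm_num)]; norm_num
    rw [this]
  have k1 := key 1 (by norm_num)
  have k2 := key (-1) (by norm_num)
  have k3 : ∫ x, (x i + 1 * x j) ^ 4 ∂ν + ∫ x, (x i + (-1) * x j) ^ 4 ∂ν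
      = 2 * ∫ x, x i ^ 4 ∂ν + 2 * ∫ x, x j ^ 4 ∂ν + 12 * ∫ x, x i ^ 2 * x j ^ 2 ∂ν := by
    rw [← integral_add (h.integrable_of_continuous (by fun_prop))
      (h.integrable_of_continuous (by fun_prop)), ← integral_const_mul, ← integral_const_mul,
      ← integral_const_mul, ← integral_add (h.integrable_of_continuous (by fun_prop))
      (h.integrable_of_continuous (by fun_prop)), ← integral_add
      (h.integrable_of_continuous (by fun_prop)) (h.integrable_of_continuous (by fun_prop))]
    congr 1; ext x; ring
  rw [h.integral_coord_pow_four_eq i j] at k3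
  linarith

/-- The fourth moment follows from `θ_j² = ∑ θ_i² θ_j²` and the ratio of mixed and pure moments. -/
lemma integral_coord_pow_four (h : IsSphereUniform ν) (j : Fin n) :
    ∫ x, x j ^ 4 ∂ν = 3 / (n * (n + 2)) := by
  have := h.isProbabilityMeasure
  have hn : (0 : ℝ) < n := by exact_mod_cast j.pos
  set M := ∫ x, x j ^ 4 ∂ν with hM
  have h1 : ∑ i, ∫ x, x i ^ 2 * x j ^ 2 ∂ν = 1 / n := by
    rw [← integral_finsetSum _ fun i _ => h.integrable_of_continuous (by fun_prop),
      ← h.integral_coord_sq j]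
    refine integral_congr_ae ?_
    filter_upwards [h.ae_sum_sq] with x hx
    rw [← Finset.sum_mul, hx, one_mul]
  have h2 : ∀ i, ∫ x, x i ^ 2 * x j ^ 2 ∂ν = M / 3 + if i = j then 2 * M / 3 else 0 := by
    intro i
    by_cases hij : i = j
    · subst hij
      simp only [← pow_add, if_true, hM]
      ring
    · simp [hij, h.integral_coord_sq_mul_sq hij, hM]
  simp_rw [h2] at h1
  rw [Finset.sum_add_distrib] at h1
  simp at h1
  field_simp at h1 ⊢
  linarith

/-- A weighted sum `∑ s_i θ_i²` with mean one is unlikely to be below `1 / 2`: its variance is at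
most `2 A / n`. -/
lemma measure_weighted_sum_le (h : IsSphereUniform ν) {s : Fin n → ℝ} {A : ℝ}
    (hs : ∑ i, s i = n) (hA : ∀ i, s i ^ 2 ≤ A) (hn : 0 < n) :
    ν.real {x | ∑ i, s i * x i ^ 2 ≤ 1 / 2} ≤ 8 * A / n := by
  have := h.isProbabilityMeasure
  have hn' : (0 : ℝ) < n := by exact_mod_cast hn
  have e1 : ∫ x, ∑ i, s i * x i ^ 2 ∂ν = 1 := by
    rw [integral_finsetSum _ fun i _ => h.integrable_of_continuous (by fun_prop)]
    simp_rw [integral_const_mul, h.integral_coord_sq]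
    rw [← Finset.sum_mul, hs]; field_simp
  have e2 : ∫ x, (∑ i, s i * x i ^ 2) ^ 2 ∂ν ≤ 1 + 2 * A / n := by
    have : ∀ x : EuclideanSpace ℝ (Fin n), (∑ i, s i * x i ^ 2) ^ 2
        = ∑ i, ∑ j, s i * s j * (x i ^ 2 * x j ^ 2) := by
      intro x
      rw [sq, Finset.sum_mul_sum]
      exact Finset.sum_congr rfl fun i _ => Finset.sum_congr rfl fun j _ => by ring
    simp_rw [this]
    rw [integral_finsetSum _ fun i _ => h.integrable_of_continuous (by fun_prop)]
    have h2 : ∀ i j, ∫ x, x i ^ 2 * x j ^ 2 ∂ν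
        = 1 / (n * (n + 2)) * (1 + if i = j then 2 else 0) := by
      intro i j
      by_cases hij : i = j
      · subst hij
        simp only [← pow_add, if_true]
        rw [h.integral_coord_pow_four]; ring
      · rw [h.integral_coord_sq_mul_sq hij, h.integral_coord_pow_four]
        simp only [hij, if_false]; field_simp; norm_num
    have h3 : ∀ i, ∫ x, ∑ j, s i * s j * (x i ^ 2 * x j ^ 2) ∂ν
        = 1 / (n * (n + 2)) * (s i * n + 2 * s i ^ 2) := by
      intro i
      rw [integral_finsetSum _ fun i _ => h.integrable_of_continuous (by fun_prop)]
      simp_rw [integral_const_mul, h2, mul_add, Finset.sum_add_distrib]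
      simp only [mul_ite, mul_zero, Finset.sum_ite_eq, Finset.mem_univ, if_true, mul_one]
      rw [← Finset.sum_mul, ← Finset.mul_sum, hs]
      ring
    simp_rw [h3]
    rw [← Finset.mul_sum, Finset.sum_add_distrib, ← Finset.sum_mul, ← Finset.mul_sum, hs]
    have h4 : ∑ i, s i ^ 2 ≤ n * A := by
      simpa using Finset.sum_le_sum (s := Finset.univ) fun i _ => hA i
    have hA0 : 0 ≤ A := (sq_nonneg _).trans (hA ⟨0, hn⟩)
    rw [div_mul_eq_mul_div, one_mul, div_le_iff₀ (by positivity)]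
    field_simp
    nlinarith
  have e3 : ∫ x, (∑ i, s i * x i ^ 2 - 1) ^ 2 ∂ν ≤ 2 * A / n := by
    have : ∀ x : EuclideanSpace ℝ (Fin n), (∑ i, s i * x i ^ 2 - 1) ^ 2
        = (∑ i, s i * x i ^ 2) ^ 2 - 2 * (∑ i, s i * x i ^ 2) + 1 := fun x => by ring
    simp_rw [this]
    rw [integral_add (h.integrable_of_continuous (by fun_prop)) (integrable_const _),
      integral_sub (h.integrable_of_continuous (by fun_prop))
      (h.integrable_of_continuous (by fun_prop)), integral_const_mul, e1]
    simp
    linarith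
  have e4 := mul_meas_ge_le_integral_of_nonneg (μ := ν)
    (f := fun x : EuclideanSpace ℝ (Fin n) => (∑ i, s i * x i ^ 2 - 1) ^ 2)
    (Filter.Eventually.of_forall fun x => sq_nonneg _)
    (h.integrable_of_continuous (by fun_prop)) (1 / 4)
  have e5 : ν.real {x | ∑ i, s i * x i ^ 2 ≤ 1 / 2}
      ≤ ν.real {x | 1 / 4 ≤ (∑ i, s i * x i ^ 2 - 1) ^ 2} := by
    refine measureReal_mono fun x hx => ?_
    simp only [Set.mem_ofPred_eq] at hx ⊢
    nlinarith
  have : 8 * A / n = 4 * (2 * A / n) := by ring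
  linarith

/-- With high probability no coordinate is large. The moment of order `16` of each coordinate beats
the union bound by a factor `n³`. -/
lemma measure_exists_coord_large (h : IsSphereUniform ν) (hn : 0 < n) :
    ν.real {x | ∃ j, 1 / (2 * √n) < x j ^ 2} ≤ 1024 * (16).factorial / n ^ 3 := by
  have := h.isProbabilityMeasure
  have hn' : (0 : ℝ) < n := by exact_mod_cast hn
  have h1 : ∀ j, ν.real {x | 1 / (2 * √n) < x j ^ 2} ≤ 1024 * (16).factorial / n ^ 4 := by
    intro j
    have e4 := mul_meas_ge_le_integral_of_nonneg (μ := ν)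
      (f := fun x : EuclideanSpace ℝ (Fin n) => x j ^ (2 * 8))
      (Filter.Eventually.of_forall fun x => (even_two_mul 8).pow_nonneg _)
      (h.integrable_of_continuous (by fun_prop)) (1 / (256 * n ^ 4))
    have e5 : ν.real {x | 1 / (2 * √n) < x j ^ 2}
        ≤ ν.real {x | 1 / (256 * (n : ℝ) ^ 4) ≤ x j ^ (2 * 8)} := by
      refine measureReal_mono fun x hx => ?_
      simp only [Set.mem_ofPred_eq] at hx ⊢
      have : 1 / (256 * (n : ℝ) ^ 4) = (1 / (2 * √n)) ^ 8 := by
        rw [div_pow, mul_pow, one_pow, show √(n : ℝ) ^ 8 = (√n ^ 2) ^ 4 by ring,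
          Real.sq_sqrt hn'.le]; norm_num
      rw [this, pow_mul]
      gcongr
    have e6 := e4.trans (h.integral_coord_pow_le 8 j)
    rw [one_div_mul_eq_div, div_le_iff₀ (by positivity)] at e6
    refine e5.trans (e6.trans (le_of_eq ?_))
    field_simp
    norm_num
  have h2 : {x : EuclideanSpace ℝ (Fin n) | ∃ j, 1 / (2 * √n) < x j ^ 2}
      = ⋃ j ∈ (Finset.univ : Finset (Fin n)), {x | 1 / (2 * √n) < x j ^ 2} := by ext x; simp
  rw [h2]
  refine (measureReal_biUnion_finset_le _ _).trans ?_
  refine (Finset.sum_le_sum fun j _ => h1 j).trans (le_of_eq ?_)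
  simp
  field_simp

end IsSphereUniform

end RandomizedMartingale

/-! ### Decay of the characteristic function of the uniform distribution -/

namespace RandomizedMartingale

/-- The uniform distribution on the interval of angles `(-π, π]`. -/
def angleMeasure : Measure ℝ :=
  (ENNReal.ofReal (2 * Real.pi))⁻¹ • volume.restrict (Set.Ioc (-Real.pi) Real.pi)

instance : IsProbabilityMeasure angleMeasure := by
  constructor
  have h : (0 : ℝ) < 2 * Real.pi := by positivity
  rw [angleMeasure, Measure.smul_apply, Measure.restrict_apply MeasurableSet.univ, Set.univ_inter,
    Real.volume_Ioc, smul_eq_mul, show Real.pi - -Real.pi = 2 * Real.pi by ring]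
  exact ENNReal.inv_mul_cancel (by simpa using h) ENNReal.ofReal_ne_top

open Complex in
lemma norm_integral_angleMeasure_le (a b : ℝ) :
    ‖∫ φ, exp ((a * Real.cos φ + b * Real.sin φ : ℝ) * I) ∂angleMeasure‖
      ≤ Real.exp (-(min (a ^ 2 + b ^ 2) 1 / 40)) := by
  have hpi := Real.pi_pos
  rw [angleMeasure, integral_smul_measure,
    ← intervalIntegral.integral_of_le (by linarith : -Real.pi ≤ Real.pi), norm_smul,
    ENNReal.toReal_inv, ENNReal.toReal_ofReal (by positivity), Real.norm_eq_abs,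
    abs_of_pos (by positivity), inv_mul_le_iff₀ (by positivity)]
  exact norm_integral_exp_cos_sin_le a b

namespace IsSphereUniform

variable {n : ℕ} {ν : Measure (EuclideanSpace ℝ (Fin n))}

open Complex in
/-- The characteristic function of the uniform law on the sphere at `w` does not change when `w` is
replaced by a vector of the same norm made of `m` planar blocks of equal lengths. Averaging over the
directions of the blocks turns it into a mean of products of Bessel functions. -/
lemma norm_integral_exp_inner_le (h : IsSphereUniform ν) {m : ℕ} (hm : 0 < m)
    (ι : Fin m × Fin 2 → Fin n) (hι : Function.Injective ι) (w : EuclideanSpace ℝ (Fin n)) :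
    ‖∫ x, exp ((inner ℝ w x : ℝ) * I) ∂ν‖ ≤ ∫ x : EuclideanSpace ℝ (Fin n),
      Real.exp (-((∑ k, min (‖w‖ ^ 2 / m * (x (ι (k, 0)) ^ 2 + x (ι (k, 1)) ^ 2)) 1) / 40)) ∂ν := by
  have := h.isProbabilityMeasure
  have hm' : (0 : ℝ) < m := by exact_mod_cast hm
  set c : ℝ := ‖w‖ / √m with hc
  have hc2 : c ^ 2 = ‖w‖ ^ 2 / m := by rw [hc, div_pow, Real.sq_sqrt hm'.le]
  let a : (Fin m → ℝ) → Fin m × Fin 2 → ℝ := fun φ p =>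
    c * if p.2 = 0 then Real.cos (φ p.1) else Real.sin (φ p.1)
  have horth : Orthonormal ℝ (fun p => EuclideanSpace.basisFun (Fin n) ℝ (ι p)) :=
    (EuclideanSpace.basisFun (Fin n) ℝ).orthonormal.comp ι hι
  let v : (Fin m → ℝ) → EuclideanSpace ℝ (Fin n) := fun φ =>
    ∑ p, a φ p • EuclideanSpace.basisFun (Fin n) ℝ (ι p)
  have hv : ∀ φ, ‖w‖ = ‖v φ‖ := by
    intro φ
    have h1 : ‖v φ‖ ^ 2 = ‖w‖ ^ 2 := by
      rw [← real_inner_self_eq_norm_sq, horth.inner_sum, Fintype.sum_prod_type]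
      have : ∀ k, ∑ b : Fin 2, (starRingEnd ℝ) (a φ (k, b)) * a φ (k, b) = c ^ 2 := by
        intro k
        simp only [Fin.sum_univ_two, a, conj_trivial, if_true, one_ne_zero, if_false]
        linear_combination c ^ 2 * Real.sin_sq_add_cos_sq (φ k)
      rw [Finset.sum_congr rfl fun k _ => this k]
      simp [hc2]
      field_simp
    exact (sq_eq_sq₀ (norm_nonneg _) (norm_nonneg _)).1 h1.symm
  have hinner : ∀ φ x, inner ℝ (v φ) x = ∑ k, (c * x (ι (k, 0)) * Real.cos (φ k)
      + c * x (ι (k, 1)) * Real.sin (φ k)) := by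
    intro φ x
    simp only [v, sum_inner, Fintype.sum_prod_type, Fin.sum_univ_two, a]
    refine Finset.sum_congr rfl fun k _ => ?_
    simp [inner_add_left, inner_smul_left, EuclideanSpace.inner_single_left]
    ring
  have hJ : ∀ φ : Fin m → ℝ, ∫ x, exp ((inner ℝ w x : ℝ) * I) ∂ν
      = ∫ x : EuclideanSpace ℝ (Fin n), ∏ k, exp ((c * x (ι (k, 0)) * Real.cos (φ k)
      + c * x (ι (k, 1)) * Real.sin (φ k) : ℝ) * I) ∂ν := by
    intro φ
    rw [h.integral_comp_inner (fun y : ℝ => exp (y * I)) (hv φ)]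
    congr 1; ext x
    rw [hinner, ← exp_sum, ← Finset.sum_mul]
    push_cast
    rfl
  have hJ2 : ∫ x, exp ((inner ℝ w x : ℝ) * I) ∂ν
      = ∫ x : EuclideanSpace ℝ (Fin n), ∏ k, ∫ φ, exp ((c * x (ι (k, 0)) * Real.cos φ
      + c * x (ι (k, 1)) * Real.sin φ : ℝ) * I) ∂angleMeasure ∂ν := by
    have h1 : ∫ x, exp ((inner ℝ w x : ℝ) * I) ∂ν
        = ∫ φ, ∫ x, exp ((inner ℝ w x : ℝ) * I) ∂ν ∂(Measure.pi fun _ : Fin m => angleMeasure) := by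
      simp
    rw [h1, integral_congr_ae (ae_of_all _ hJ), integral_integral_swap]
    · congr 1; ext x
      exact integral_fintype_prod_eq_prod (μ := fun _ : Fin m => angleMeasure)
        (fun k φ => exp ((c * x (ι (k, 0)) * Real.cos φ + c * x (ι (k, 1)) * Real.sin φ : ℝ) * I))
    · refine Integrable.of_bound (Continuous.aestronglyMeasurable ?_) 1 ?_
      · exact continuous_finsetProd _ fun k _ => by fun_prop
      · refine Filter.Eventually.of_forall fun p => ?_
        rw [Function.uncurry, norm_prod]
        simp only [norm_exp_ofReal_mul_I, Finset.prod_const_one, le_refl]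
  rw [hJ2]
  refine norm_integral_le_of_norm_le (h.integrable_of_continuous (by fun_prop))
    (Filter.Eventually.of_forall fun x => ?_)
  rw [norm_prod, Finset.sum_div, ← Finset.sum_neg_distrib, Real.exp_sum]
  refine Finset.prod_le_prod (fun k _ => norm_nonneg _) fun k _ => ?_
  refine (norm_integral_angleMeasure_le _ _).trans (le_of_eq ?_)
  rw [mul_pow, mul_pow, ← mul_add, hc2]

open Complex in
/-- Decay of the characteristic function of the uniform law on the sphere, at vectors of norm at
least `t √n / 2`. If all coordinates satisfy `θ_j² ≤ 1 / (2 √n)`, then up to `t² = √n` the planar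
blocks of `norm_integral_exp_inner_le` stay where the Bessel bound is quadratic, and the exponents
add up to a multiple of `t² ∑ θ_j²`. -/
lemma norm_charFun_le (h : IsSphereUniform ν) (hn : 2 ≤ n) {t : ℝ}
    {w : EuclideanSpace ℝ (Fin n)} (hw : t ^ 2 * n / 4 ≤ ‖w‖ ^ 2) :
    ‖∫ x, exp ((inner ℝ w x : ℝ) * I) ∂ν‖
      ≤ Real.exp (-(min (t ^ 2) √n / 160)) + 1024 * (16).factorial / n ^ 3 := by
  have := h.isProbabilityMeasure
  have hn' : (2 : ℝ) ≤ n := by exact_mod_cast hn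
  have hm : 0 < n / 2 := by omega
  have hm1 : (0 : ℝ) < (n / 2 : ℕ) := by exact_mod_cast hm
  have hm2 : ((n / 2 : ℕ) : ℝ) ≤ n / 2 := Nat.cast_div_le
  let ι : Fin (n / 2) × Fin 2 → Fin n := fun p =>
    Fin.castLE (by omega : n / 2 * 2 ≤ n) (finProdFinEquiv p)
  have hι : Function.Injective ι := (Fin.castLE_injective _).comp finProdFinEquiv.injective
  refine (h.norm_integral_exp_inner_le hm ι hι w).trans ?_
  set B := {x : EuclideanSpace ℝ (Fin n) | ∃ j, 1 / (2 * √n) < x j ^ 2} with hB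
  have hBm : MeasurableSet B := by
    have : B = ⋃ j, {x : EuclideanSpace ℝ (Fin n) | 1 / (2 * √n) < x j ^ 2} := by
      ext x; simp [hB]
    rw [this]
    exact MeasurableSet.iUnion fun j => measurableSet_lt (by fun_prop) (by fun_prop)
  set g := Real.exp (-(min (t ^ 2) √n / 160)) with hg
  have hs1 : (1 : ℝ) ≤ √n := Real.one_le_sqrt.2 (by linarith)
  have hle : ∀ᵐ x ∂ν, Real.exp (-((∑ k, min (‖w‖ ^ 2 / (n / 2 : ℕ) *
      (x (ι (k, 0)) ^ 2 + x (ι (k, 1)) ^ 2)) 1) / 40)) ≤ g + B.indicator (fun _ => (1 : ℝ)) x := by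
    filter_upwards [h.ae_sum_sq] with x hx
    by_cases hxB : x ∈ B
    · rw [Set.indicator_of_mem hxB]
      have : Real.exp (-((∑ k, min (‖w‖ ^ 2 / (n / 2 : ℕ) *
        (x (ι (k, 0)) ^ 2 + x (ι (k, 1)) ^ 2)) 1) / 40)) ≤ 1 := by
        rw [Real.exp_le_one_iff, neg_nonpos]; positivity
      linarith [Real.exp_pos (-(min (t ^ 2) √n / 160))]
    · rw [Set.indicator_of_notMem hxB, add_zero, hg]
      apply Real.exp_le_exp.2
      have hx2 : ∀ j, x j ^ 2 ≤ 1 / (2 * √n) := by simpa [hB] using hxB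
      set τ := min (t ^ 2) √n with hτ
      have hτ0 : 0 ≤ τ := by positivity
      have h1 : ∀ k, τ / 2 * (x (ι (k, 0)) ^ 2 + x (ι (k, 1)) ^ 2) ≤ min (‖w‖ ^ 2 / (n / 2 : ℕ) *
          (x (ι (k, 0)) ^ 2 + x (ι (k, 1)) ^ 2)) 1 := by
        intro k
        refine le_min ?_ ?_
        · refine mul_le_mul_of_nonneg_right ?_ (by positivity)
          rw [le_div_iff₀ hm1]
          have : τ ≤ t ^ 2 := min_le_left _ _
          nlinarith
        · have e0 := hx2 (ι (k, 0))
          have e1 := hx2 (ι (k, 1))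
          calc τ / 2 * (x (ι (k, 0)) ^ 2 + x (ι (k, 1)) ^ 2)
              ≤ √n / 2 * (1 / (2 * √n) + 1 / (2 * √n)) := by
                gcongr; exact min_le_right _ _
            _ ≤ 1 := by field_simp; norm_num
      have h2 : 1 / 2 ≤ ∑ k, (x (ι (k, 0)) ^ 2 + x (ι (k, 1)) ^ 2) := by
        have e1 : ∑ k, (x (ι (k, 0)) ^ 2 + x (ι (k, 1)) ^ 2)
            = ∑ j ∈ Finset.univ.map ⟨ι, hι⟩, x j ^ 2 := by
          rw [Finset.sum_map, Fintype.sum_prod_type]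
          simp [Fin.sum_univ_two]
        have e2 := Finset.sum_add_sum_compl (Finset.univ.map ⟨ι, hι⟩) (fun j => x j ^ 2)
        -- For odd `n` the blocks leave out one coordinate.
        have e3 : ∑ j ∈ (Finset.univ.map ⟨ι, hι⟩)ᶜ, x j ^ 2 ≤ 1 / 2 := by
          have e4 : (Finset.univ.map ⟨ι, hι⟩)ᶜ.card ≤ 1 := by
            rw [Finset.card_compl, Finset.card_map]
            simp
            omega
          refine (Finset.sum_le_card_nsmul _ _ (1 / (2 * √n)) fun j _ => hx2 j).trans ?_
          rw [nsmul_eq_mul]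
          have e5 : 1 / (2 * √(n : ℝ)) ≤ 1 / 2 := by gcongr; linarith
          have e6 : (((Finset.univ.map ⟨ι, hι⟩)ᶜ.card : ℕ) : ℝ) ≤ 1 := by exact_mod_cast e4
          have e7 : (0 : ℝ) ≤ 1 / (2 * √n) := by positivity
          nlinarith
        rw [e1]; linarith
      have h3 := Finset.sum_le_sum (s := Finset.univ) fun k _ => h1 k
      rw [← Finset.mul_sum] at h3
      nlinarith
  refine (integral_mono_ae (h.integrable_of_continuous (by fun_prop))
    ((integrable_const g).add ((integrable_const (1 : ℝ)).indicator hBm)) hle).trans ?_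
  simp only [Pi.add_apply]
  rw [integral_add (integrable_const _) ((integrable_const (1 : ℝ)).indicator hBm),
    integral_indicator hBm]
  have := h.measure_exists_coord_large (by omega)
  simp only [integral_const, probReal_univ, smul_eq_mul, mul_one,
    measureReal_restrict_apply MeasurableSet.univ, Set.univ_inter]
  linarith

end IsSphereUniform

end RandomizedMartingale

/-! ### A smoothing inequality for the Kolmogorov distance -/

namespace RandomizedMartingale

open scoped NNReal ENNReal

lemma integrable_exp_neg_sq_half {ε : ℝ} (hε : 0 < ε) :
    Integrable fun t : ℝ => Real.exp (-(ε ^ 2 * t ^ 2 / 2)) := by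
  have := integrable_exp_neg_mul_sq (b := ε ^ 2 / 2) (by positivity)
  refine this.congr (ae_of_all _ fun t => ?_)
  simp only; congr 1; ring

/-- Fourier inversion for the centered Gaussian density, in real form. -/
lemma gaussianPDFReal_eq_integral_cos {ε : ℝ≥0} (hε : 0 < ε) (y : ℝ) :
    gaussianPDFReal 0 (ε ^ 2) y
      = 1 / Real.pi * ∫ t in Set.Ioi (0 : ℝ),
        Real.exp (-(ε ^ 2 * t ^ 2 / 2)) * Real.cos (t * y) := by
  have hε' : (0 : ℝ) < ε := hε
  have hpi := Real.pi_pos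
  have h1 := fourierIntegral_gaussian (b := ((ε ^ 2 / 2 : ℝ) : ℂ))
    (by rw [Complex.ofReal_re]; positivity) (y : ℂ)
  have hint : Integrable fun t : ℝ => Complex.exp (Complex.I * y * t)
      * Complex.exp (-((ε ^ 2 / 2 : ℝ) : ℂ) * t ^ 2) := by
    refine (integrable_exp_neg_sq_half hε').mono' (by fun_prop) (ae_of_all _ fun t => ?_)
    rw [norm_mul, Complex.norm_exp, Complex.norm_exp]
    simp [← Complex.ofReal_pow]
    ring_nf; rfl
  have h2 : ∫ t : ℝ, Real.exp (-(ε ^ 2 * t ^ 2 / 2)) * Real.cos (t * y)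
      = √(2 * Real.pi) / ε * Real.exp (-(y ^ 2 / (2 * ε ^ 2))) := by
    have h3 := congrArg Complex.re h1
    have hre := integral_re hint
    simp only [RCLike.re_eq_complex_re] at hre
    rw [← hre] at h3
    have h4 : ∀ t : ℝ, Real.exp (-(ε ^ 2 * t ^ 2 / 2)) * Real.cos (t * y)
        = (Complex.exp (Complex.I * y * t)
          * Complex.exp (-((ε ^ 2 / 2 : ℝ) : ℂ) * t ^ 2)).re := by
      intro t
      have e1 : Complex.exp (-((ε ^ 2 / 2 : ℝ) : ℂ) * t ^ 2)
          = ((Real.exp (-(ε ^ 2 * t ^ 2 / 2)) : ℝ) : ℂ) := by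
        push_cast; congr 1; ring
      have e2 : Complex.exp (Complex.I * y * t) = Complex.exp ((t * y : ℝ) * Complex.I) := by
        push_cast; congr 1; ring
      rw [e1, e2, Complex.re_mul_ofReal, Complex.exp_ofReal_mul_I_re]
      ring
    simp_rw [h4]
    rw [h3]
    have e1 : (Real.pi : ℂ) / ((ε ^ 2 / 2 : ℝ) : ℂ) = ((Real.pi / (ε ^ 2 / 2) : ℝ) : ℂ) := by
      push_cast; rfl
    have e2 : Complex.exp (-(y : ℂ) ^ 2 / (4 * ((ε ^ 2 / 2 : ℝ) : ℂ)))
        = ((Real.exp (-(y ^ 2 / (2 * ε ^ 2))) : ℝ) : ℂ) := by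
      push_cast; congr 1; field_simp; norm_num
    rw [e1, e2, show (1 / 2 : ℂ) = ((1 / 2 : ℝ) : ℂ) by push_cast; rfl,
      ← Complex.ofReal_cpow (by positivity), ← Complex.ofReal_mul, Complex.ofReal_re,
      ← Real.sqrt_eq_rpow]
    congr 1
    rw [show Real.pi / ((ε : ℝ) ^ 2 / 2) = 2 * Real.pi / ε ^ 2 by field_simp,
      Real.sqrt_div (by positivity), Real.sqrt_sq hε'.le]
  have h5 := integral_comp_abs (f := fun t : ℝ =>
    Real.exp (-(ε ^ 2 * t ^ 2 / 2)) * Real.cos (t * y))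
  have h6 : ∀ t : ℝ, Real.exp (-(ε ^ 2 * |t| ^ 2 / 2)) * Real.cos (|t| * y)
      = Real.exp (-(ε ^ 2 * t ^ 2 / 2)) * Real.cos (t * y) := by
    intro t
    rcases abs_cases t with ⟨e, _⟩ | ⟨e, _⟩ <;> rw [e]
    simp
  simp_rw [h6] at h5
  rw [h2] at h5
  have h7 : ∫ t in Set.Ioi (0 : ℝ), Real.exp (-(ε ^ 2 * t ^ 2 / 2)) * Real.cos (t * y)
      = √(2 * Real.pi) / ε * Real.exp (-(y ^ 2 / (2 * ε ^ 2))) / 2 := by linarith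
  rw [h7, gaussianPDFReal]
  have h8 : √(2 * Real.pi) * √(2 * Real.pi) = 2 * Real.pi := Real.mul_self_sqrt (by positivity)
  have h9 : 0 < √(2 * Real.pi) := by positivity
  push_cast
  rw [Real.sqrt_mul (by positivity), Real.sqrt_sq hε'.le]
  simp only [sub_zero, neg_div]
  field_simp
  linarith

lemma abs_sin_mul_div_le (t z : ℝ) : |Real.sin (t * z) / t| ≤ |z| := by
  rcases eq_or_ne t 0 with rfl | ht
  · simp
  · rw [abs_div, div_le_iff₀ (abs_pos.2 ht), mul_comm |z|, ← abs_mul]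
    exact Real.abs_sin_le_abs

/-- Fourier inversion for the centered Gaussian distribution function. -/
lemma gaussianReal_Iic_eq {ε : ℝ≥0} (hε : 0 < ε) (z : ℝ) :
    (gaussianReal 0 (ε ^ 2)).real (Set.Iic z) = (gaussianReal 0 (ε ^ 2)).real (Set.Iic 0)
      + 1 / Real.pi * ∫ t in Set.Ioi (0 : ℝ),
        Real.exp (-(ε ^ 2 * t ^ 2 / 2)) * (Real.sin (t * z) / t) := by
  have hε' : (0 : ℝ) < ε := hε
  have hv : ε ^ 2 ≠ 0 := by positivity
  have hcdf : ∀ z, (gaussianReal 0 (ε ^ 2)).real (Set.Iic z)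
      = ∫ y in Set.Iic z, gaussianPDFReal 0 (ε ^ 2) y := by
    intro z
    rw [Measure.real, gaussianReal_apply_eq_integral _ hv, ENNReal.toReal_ofReal]
    exact integral_nonneg fun y => gaussianPDFReal_nonneg _ _ _
  have hi := integrable_gaussianPDFReal 0 (ε ^ 2)
  have h1 := intervalIntegral.integral_Iic_sub_Iic (a := 0) (b := z) (μ := volume)
    hi.integrableOn hi.integrableOn
  rw [← hcdf, ← hcdf] at h1
  rw [← sub_eq_iff_eq_add', h1]
  simp_rw [gaussianPDFReal_eq_integral_cos hε]
  rw [intervalIntegral.integral_const_mul]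
  congr 1
  rw [intervalIntegral_integral_swap]
  · refine setIntegral_congr_fun measurableSet_Ioi fun t ht => ?_
    have ht : (t : ℝ) ≠ 0 := ne_of_gt ht
    rw [intervalIntegral.integral_const_mul]
    congr 1
    have := intervalIntegral.integral_comp_mul_left (a := 0) (b := z) (fun y => Real.cos y) ht
    rw [this]
    simp
    field_simp
  · have h2 : Integrable (fun p : ℝ × ℝ => (1 : ℝ) * Real.exp (-(ε ^ 2 * p.2 ^ 2 / 2)))
      ((volume.restrict (Set.uIoc 0 z)).prod (volume.restrict (Set.Ioi (0 : ℝ)))) :=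
      Integrable.mul_prod (μ := volume.restrict (Set.uIoc 0 z))
        (ν := volume.restrict (Set.Ioi (0 : ℝ))) (f := fun _ => (1 : ℝ))
        (integrableOn_const (by simp [Set.uIoc]))
        (integrable_exp_neg_sq_half hε').integrableOn
    refine h2.mono' (by unfold Function.uncurry; fun_prop) (ae_of_all _ fun p => ?_)
    rw [Function.uncurry, norm_mul, Real.norm_eq_abs, Real.norm_eq_abs, Real.abs_exp, one_mul]
    exact mul_le_of_le_one_right (Real.exp_pos _).le (Real.abs_cos_le_one _)

/-- Both sides are the distribution function at `x` of the convolution of `P` and `ρ`. -/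
lemma integral_measureReal_Iic_sub {P ρ : Measure ℝ} [IsProbabilityMeasure P]
    [IsProbabilityMeasure ρ] (x : ℝ) :
    ∫ y, P.real (Set.Iic (x - y)) ∂ρ = ∫ z, ρ.real (Set.Iic (x - z)) ∂P := by
  have h1 : ∀ (P : Measure ℝ) (y : ℝ), P.real (Set.Iic (x - y))
      = ∫ z, Set.indicator {p : ℝ × ℝ | p.1 + p.2 ≤ x} (fun _ => (1 : ℝ)) (y, z) ∂P := by
    intro P y
    have : (fun z => Set.indicator {p : ℝ × ℝ | p.1 + p.2 ≤ x} (fun _ => (1 : ℝ)) (y, z))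
        = Set.indicator (Set.Iic (x - y)) (fun _ => (1 : ℝ)) := by
      ext z
      by_cases h : y + z ≤ x
      · rw [Set.indicator_of_mem (by exact h), Set.indicator_of_mem]
        simp; linarith
      · rw [Set.indicator_of_notMem (by exact h), Set.indicator_of_notMem]
        simp; linarith
    rw [this, integral_indicator measurableSet_Iic]
    simp
  have hm : MeasurableSet {p : ℝ × ℝ | p.1 + p.2 ≤ x} :=
    measurableSet_le (by fun_prop) (by fun_prop)
  rw [integral_congr_ae (ae_of_all _ (h1 P)), integral_congr_ae (ae_of_all _ (h1 ρ)),
    integral_integral_swap]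
  · congr 1; ext z; congr 1; ext y
    rw [Set.indicator_apply, Set.indicator_apply]
    simp only [Set.mem_ofPred_eq, add_comm]
  · exact (integrable_const (1 : ℝ)).indicator hm

lemma measurable_measureReal_Iic (P : Measure ℝ) [IsFiniteMeasure P] :
    Measurable fun x => P.real (Set.Iic x) :=
  Monotone.measurable fun _ _ h => measureReal_mono (Set.Iic_subset_Iic.2 h)

lemma integrable_measureReal_Iic_sub (P ρ : Measure ℝ) [IsProbabilityMeasure P]
    [IsProbabilityMeasure ρ] (x : ℝ) : Integrable (fun y => P.real (Set.Iic (x - y))) ρ := by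
  refine Integrable.of_bound (Measurable.aestronglyMeasurable ?_) 1 (ae_of_all _ fun y => ?_)
  · exact (measurable_measureReal_Iic P).comp (by fun_prop)
  · rw [Real.norm_eq_abs, abs_of_nonneg measureReal_nonneg]; exact measureReal_le_one

open Complex in
lemma abs_integral_sin_sub_le {P Q : Measure ℝ} [IsProbabilityMeasure P] [IsProbabilityMeasure Q]
    {t : ℝ} (ht : 0 < t) (x : ℝ) :
    |∫ z, Real.sin (t * (x - z)) / t ∂P - ∫ z, Real.sin (t * (x - z)) / t ∂Q|
      ≤ ‖charFun P t - charFun Q t‖ / t := by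
  have h1 : ∀ (P : Measure ℝ) [IsProbabilityMeasure P], ∫ z, Real.sin (t * (x - z)) / t ∂P
      = - (exp (-(t * x * I)) * charFun P t).im / t := by
    intro P _
    have hint : Integrable (fun z : ℝ => exp (-(t * x * I)) * exp (t * z * I)) P := by
      refine Integrable.of_bound (by fun_prop) 1 (ae_of_all _ fun z => ?_)
      rw [← exp_add, Complex.norm_exp]
      simp
    rw [charFun_apply_real, ← integral_const_mul]
    have := integral_im hint
    simp only [RCLike.im_eq_complex_im] at this
    rw [← this, neg_div, ← integral_div, ← integral_neg]
    congr 1; ext z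
    rw [← exp_add, show -(t * x * I) + t * z * I = ((-(t * (x - z)) : ℝ) : ℂ) * I by
      push_cast; ring, exp_ofReal_mul_I_im, Real.sin_neg]
    ring
  rw [h1, h1, ← sub_div, abs_div, abs_of_pos ht]
  gcongr
  rw [neg_sub_neg, ← sub_im, ← mul_sub]
  refine (abs_im_le_norm _).trans ?_
  rw [norm_mul, norm_sub_rev, show -((t : ℂ) * x * I) = ((-(t * x) : ℝ) : ℂ) * I by push_cast; ring,
    norm_exp_ofReal_mul_I, one_mul]

/-- After convolution with a Gaussian law, the distance between the distribution functions is
controlled by the characteristic functions. -/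
lemma abs_integral_Iic_sub_le {P Q : Measure ℝ} [IsProbabilityMeasure P] [IsProbabilityMeasure Q]
    (hP : Integrable id P) (hQ : Integrable id Q) {ε : ℝ≥0} (hε : 0 < ε) (x : ℝ) :
    ENNReal.ofReal |∫ y, (P.real (Set.Iic (x - y)) - Q.real (Set.Iic (x - y)))
        ∂(gaussianReal 0 (ε ^ 2))|
      ≤ ∫⁻ t in Set.Ioi (0 : ℝ), ENNReal.ofReal
        (Real.exp (-(ε ^ 2 * t ^ 2 / 2)) / t * ‖charFun P t - charFun Q t‖) := by
  have hε' : (0 : ℝ) < ε := hε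
  set γ := gaussianReal 0 (ε ^ 2) with hγ
  set c := γ.real (Set.Iic 0)
  have hF : ∀ (P : Measure ℝ) [IsProbabilityMeasure P], Integrable id P →
      Integrable (fun p : ℝ × ℝ => Real.exp (-(ε ^ 2 * p.2 ^ 2 / 2))
        * (Real.sin (p.2 * (x - p.1)) / p.2)) (P.prod (volume.restrict (Set.Ioi (0 : ℝ)))) := by
    intro P _ hP
    have h2 := Integrable.mul_prod (μ := P) (ν := volume.restrict (Set.Ioi (0 : ℝ)))
      (f := fun z => |x - z|) (((integrable_const x).sub hP).abs)
      (integrable_exp_neg_sq_half hε').integrableOn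
    refine h2.mono' (Measurable.aestronglyMeasurable (by fun_prop)) (ae_of_all _ fun p => ?_)
    rw [norm_mul, Real.norm_eq_abs, Real.norm_eq_abs, Real.abs_exp, mul_comm]
    exact mul_le_mul_of_nonneg_right (abs_sin_mul_div_le _ _) (Real.exp_pos _).le
  have h1 : ∀ (P : Measure ℝ) [IsProbabilityMeasure P], Integrable id P →
      ∫ y, P.real (Set.Iic (x - y)) ∂γ = c + 1 / Real.pi * ∫ t in Set.Ioi (0 : ℝ),
        Real.exp (-(ε ^ 2 * t ^ 2 / 2)) * ∫ z, Real.sin (t * (x - z)) / t ∂P := by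
    intro P _ hP
    rw [integral_measureReal_Iic_sub]
    simp_rw [hγ, gaussianReal_Iic_eq hε (x - _)]
    rw [integral_add (integrable_const _) ((hF P hP).integral_prod_left.const_mul _),
      integral_const_mul, integral_integral_swap (hF P hP)]
    simp [integral_const_mul, c, hγ]
  have hI : ∀ (P : Measure ℝ) [IsProbabilityMeasure P], Integrable id P →
      Integrable (fun t => Real.exp (-(ε ^ 2 * t ^ 2 / 2)) * ∫ z, Real.sin (t * (x - z)) / t ∂P)
        (volume.restrict (Set.Ioi (0 : ℝ))) := by
    intro P _ hP
    simpa only [integral_const_mul] using (hF P hP).integral_prod_right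
  rw [integral_sub (integrable_measureReal_Iic_sub _ _ _) (integrable_measureReal_Iic_sub _ _ _),
    h1 P hP, h1 Q hQ, add_sub_add_left_eq_sub, ← mul_sub, ← integral_sub (hI P hP) (hI Q hQ),
    abs_mul]
  have hpi : |1 / Real.pi| ≤ 1 := by
    rw [abs_of_pos (by positivity), div_le_one Real.pi_pos]
    linarith [Real.pi_gt_three]
  refine (ENNReal.ofReal_le_ofReal (mul_le_of_le_one_left (abs_nonneg _) hpi)).trans ?_
  rw [← Real.norm_eq_abs, ofReal_norm]
  refine (enorm_integral_le_lintegral_enorm _).trans (setLIntegral_mono' measurableSet_Ioi ?_)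
  intro t ht
  rw [← ofReal_norm, ← mul_sub, norm_mul, Real.norm_eq_abs, Real.abs_exp,
    div_mul_eq_mul_div, mul_div_assoc (Real.exp _)]
  exact ENNReal.ofReal_le_ofReal
    (mul_le_mul_of_nonneg_left (abs_integral_sin_sub_le ht x) (Real.exp_pos _).le)

lemma bddAbove_abs_measureReal_sub (P Q : Measure ℝ) [IsProbabilityMeasure P]
    [IsProbabilityMeasure Q] :
    BddAbove (Set.range fun t : ℝ => |P.real (Set.Iic t) - Q.real (Set.Iic t)|) := by
  refine ⟨1, ?_⟩
  rintro _ ⟨t, rfl⟩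
  have h1 : P.real (Set.Iic t) ≤ 1 := measureReal_le_one
  have h2 : Q.real (Set.Iic t) ≤ 1 := measureReal_le_one
  have h3 : 0 ≤ P.real (Set.Iic t) := measureReal_nonneg
  have h4 : 0 ≤ Q.real (Set.Iic t) := measureReal_nonneg
  exact abs_le.2 ⟨by linarith, by linarith⟩

lemma abs_le_kolmogorovDist (P Q : Measure ℝ) [IsProbabilityMeasure P]
    [IsProbabilityMeasure Q] (t : ℝ) :
    |P.real (Set.Iic t) - Q.real (Set.Iic t)| ≤ kolmogorovDist P Q :=
  le_ciSup (bddAbove_abs_measureReal_sub P Q) t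

lemma kolmogorovDist_nonneg (P Q : Measure ℝ) : 0 ≤ kolmogorovDist P Q :=
  Real.iSup_nonneg fun _ => abs_nonneg _

lemma kolmogorovDist_le_one (P Q : Measure ℝ) [IsProbabilityMeasure P]
    [IsProbabilityMeasure Q] : kolmogorovDist P Q ≤ 1 := by
  refine ciSup_le fun t => ?_
  have h1 : P.real (Set.Iic t) ≤ 1 := measureReal_le_one
  have h2 : Q.real (Set.Iic t) ≤ 1 := measureReal_le_one
  have h3 : 0 ≤ P.real (Set.Iic t) := measureReal_nonneg
  have h4 : 0 ≤ Q.real (Set.Iic t) := measureReal_nonneg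
  exact abs_le.2 ⟨by linarith, by linarith⟩

lemma gaussianReal_abs_gt_le {ε : ℝ≥0} (hε : 0 < ε) :
    (gaussianReal 0 (ε ^ 2)).real {y | 2 * (ε : ℝ) ≤ |y|} ≤ 1 / 4 := by
  have hε' : (0 : ℝ) < ε := hε
  have h := meas_ge_le_variance_div_sq (μ := gaussianReal 0 (ε ^ 2)) (X := id) (c := 2 * ε)
    (by exact_mod_cast memLp_id_gaussianReal 2) (by positivity)
  rw [variance_id_gaussianReal] at h
  simp only [id, integral_id_gaussianReal, sub_zero] at h
  refine ENNReal.toReal_le_of_le_ofReal (by norm_num) (h.trans (le_of_eq ?_))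
  congr 1
  push_cast
  field_simp
  norm_num

/-- A bounded function `D` which decreases at rate at most `m` to the right of `x` is not much
larger at `x` than a Gaussian mean of `D` centered to the right of `x`. -/
lemma le_of_gaussian_mean_le {D : ℝ → ℝ} {K m Δ : ℝ} (hDm : Measurable D) (hK : ∀ x, |D x| ≤ K)
    {ε : ℝ≥0} (hε : 0 < ε) (hm : 0 ≤ m) (x : ℝ) (hD : ∀ s, 0 ≤ s → D x - m * s ≤ D (x + s))
    (hΔ : |∫ y, D (x + 2 * ε - y) ∂(gaussianReal 0 (ε ^ 2))| ≤ Δ) :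
    D x ≤ 4 * m * ε + 4 / 3 * Δ + K / 3 := by
  have hε' : (0 : ℝ) < ε := hε
  set γ := gaussianReal 0 (ε ^ 2)
  set B := {y : ℝ | 2 * (ε : ℝ) ≤ |y|} with hB
  have hBm : MeasurableSet B := measurableSet_le (by fun_prop) (by fun_prop)
  have hK0 : 0 ≤ K := (abs_nonneg _).trans (hK x)
  set a := D x - m * (4 * ε) with ha
  -- Off `B` the point `x + 2 ε - y` lies in `[x, x + 4 ε]`, where `D` is at least `a`; on `B` only
  -- `D ≥ -K` is known. If `a + K` is negative, the claim is trivial.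
  by_cases h0 : a + K < 0
  · nlinarith [abs_nonneg (∫ y, D (x + 2 * ε - y) ∂γ)]
  push Not at h0
  have h1 : ∀ y, a - B.indicator (fun _ => a + K) y ≤ D (x + 2 * ε - y) := by
    intro y
    by_cases hy : y ∈ B
    · rw [Set.indicator_of_mem hy]
      linarith [(abs_le.1 (hK (x + 2 * ε - y))).1]
    · rw [Set.indicator_of_notMem hy]
      simp only [hB, Set.mem_ofPred_eq, not_le] at hy
      have h2 := abs_lt.1 hy
      have h3 := hD (2 * ε - y) (by linarith)
      rw [← add_sub_assoc] at h3
      nlinarith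
  have h2 : ∫ y, (a - B.indicator (fun _ => a + K) y) ∂γ ≤ ∫ y, D (x + 2 * ε - y) ∂γ := by
    refine integral_mono ((integrable_const _).sub ((integrable_const _).indicator hBm)) ?_ h1
    exact Integrable.of_bound (hDm.comp (by fun_prop)).aestronglyMeasurable K
      (ae_of_all _ fun y => hK _)
  rw [integral_sub (integrable_const _) ((integrable_const _).indicator hBm),
    integral_indicator hBm] at h2
  simp only [integral_const, probReal_univ, smul_eq_mul, one_mul,
    measureReal_restrict_apply MeasurableSet.univ, Set.univ_inter] at h2
  have h3 : γ.real B ≤ 1 / 4 := gaussianReal_abs_gt_le hε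
  have h4 := (abs_le.1 hΔ).2
  nlinarith

/-- Gaussian smoothing inequality: a variant of Esseen's inequality in which the truncation of the
frequencies at `1 / ε` is replaced by a Gaussian weight. -/
lemma ofReal_kolmogorovDist_le {P Q : Measure ℝ} [IsProbabilityMeasure P] [IsProbabilityMeasure Q]
    (hP : Integrable id P) (hQ : Integrable id Q) {ε : ℝ≥0} (hε : 0 < ε) {m : ℝ} (hm : 0 ≤ m)
    (hQm : ∀ x s, 0 ≤ s → Q.real (Set.Iic (x + s)) ≤ Q.real (Set.Iic x) + m * s) :
    ENNReal.ofReal (kolmogorovDist P Q) ≤ ENNReal.ofReal (6 * m * ε)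
      + 2 * ∫⁻ t in Set.Ioi (0 : ℝ), ENNReal.ofReal
        (Real.exp (-(ε ^ 2 * t ^ 2 / 2)) / t * ‖charFun P t - charFun Q t‖) := by
  have hε' : (0 : ℝ) < ε := hε
  set L := ∫⁻ t in Set.Ioi (0 : ℝ), ENNReal.ofReal
        (Real.exp (-(ε ^ 2 * t ^ 2 / 2)) / t * ‖charFun P t - charFun Q t‖) with hL
  by_cases hLtop : L = ∞
  · simp [hLtop]
  set K := kolmogorovDist P Q
  set D : ℝ → ℝ := fun x => P.real (Set.Iic x) - Q.real (Set.Iic x) with hD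
  have hΔ : ∀ x, |∫ y, D (x - y) ∂(gaussianReal 0 (ε ^ 2))| ≤ L.toReal := fun x =>
    (ENNReal.ofReal_le_iff_le_toReal hLtop).1 (abs_integral_Iic_sub_le hP hQ hε x)
  have hKD : ∀ x, |D x| ≤ K := fun x => abs_le_kolmogorovDist P Q x
  have hDm : Measurable D := (measurable_measureReal_Iic P).sub (measurable_measureReal_Iic Q)
  have hbound : ∀ x, |D x| ≤ 4 * m * ε + 4 / 3 * L.toReal + K / 3 := by
    intro x
    refine abs_le'.2 ⟨le_of_gaussian_mean_le hDm hKD hε hm x (fun s hs => ?_) (hΔ _), ?_⟩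
    · have h1 : P.real (Set.Iic x) ≤ P.real (Set.Iic (x + s)) :=
        measureReal_mono (Set.Iic_subset_Iic.2 (by linarith))
      have h2 := hQm x s hs
      simp only [hD]; linarith
    · -- the mirror image: the distribution functions are read from the right
      have h3 := le_of_gaussian_mean_le (D := fun y => - D (-y)) (K := K) (m := m) (Δ := L.toReal)
        (hDm.comp measurable_neg).neg (fun y => by rw [abs_neg]; exact hKD _) hε hm (-x)
        (fun s hs => ?_) ?_
      · simpa using h3
      · have h1 : P.real (Set.Iic (x - s)) ≤ P.real (Set.Iic x) :=
          measureReal_mono (Set.Iic_subset_Iic.2 (by linarith))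
        have h2 := hQm (x - s) s hs
        rw [sub_add_cancel] at h2
        simp only [hD, neg_neg, neg_add_rev]
        rw [show -s + x = x - s by ring]
        linarith
      · have h4 := hΔ (x - 2 * ε)
        have h5 : ∫ y, D (x - 2 * ε - y) ∂(gaussianReal 0 (ε ^ 2))
            = ∫ y, D (x - 2 * ε + y) ∂(gaussianReal 0 (ε ^ 2)) := by
          have h6 : (gaussianReal 0 (ε ^ 2)).map (fun x => -x) = gaussianReal 0 (ε ^ 2) := by
            rw [gaussianReal_map_neg, neg_zero]
          conv_rhs => rw [← h6]
          rw [integral_map (by fun_prop)]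
          · simp [sub_eq_add_neg]
          · exact (hDm.comp (by fun_prop)).aestronglyMeasurable
        rw [h5] at h4
        rw [integral_neg, abs_neg]
        convert h4 using 5
        ring
  have hfin : K ≤ 6 * m * ε + 2 * L.toReal := by
    have : K ≤ 4 * m * ε + 4 / 3 * L.toReal + K / 3 := ciSup_le hbound
    linarith
  refine (ENNReal.ofReal_le_ofReal hfin).trans ?_
  rw [ENNReal.ofReal_add (by positivity) (by positivity),
    ENNReal.ofReal_mul (p := 2) (by norm_num), ENNReal.ofReal_toReal hLtop]
  simp

/-- A normal law of variance at least `1 / 2` has a density bounded by `1`, because `2 π v ≥ 1`. -/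
lemma gaussianReal_Iic_add_le {v : ℝ≥0} (hv : 1 / 2 ≤ v) (x s : ℝ) (hs : 0 ≤ s) :
    (gaussianReal 0 v).real (Set.Iic (x + s)) ≤ (gaussianReal 0 v).real (Set.Iic x) + 1 * s := by
  have hv' : (1 / 2 : ℝ) ≤ v := by exact_mod_cast hv
  have hv0 : v ≠ 0 := by rintro rfl; norm_num at hv'
  have hcdf : ∀ z, (gaussianReal 0 v).real (Set.Iic z)
      = ∫ y in Set.Iic z, gaussianPDFReal 0 v y := by
    intro z
    rw [Measure.real, gaussianReal_apply_eq_integral _ hv0, ENNReal.toReal_ofReal]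
    exact integral_nonneg fun y => gaussianPDFReal_nonneg _ _ _
  have hi := integrable_gaussianPDFReal 0 v
  have h1 := intervalIntegral.integral_Iic_sub_Iic (a := x) (b := x + s) (μ := volume)
    hi.integrableOn hi.integrableOn
  rw [← hcdf, ← hcdf] at h1
  have h2 : ∫ y in x..(x + s), gaussianPDFReal 0 v y ≤ ∫ y in x..(x + s), (1 : ℝ) := by
    refine intervalIntegral.integral_mono_on (by linarith) hi.intervalIntegrable (by simp)
      fun y _ => ?_
    rw [gaussianPDFReal]
    have h3 : (√(2 * Real.pi * v))⁻¹ ≤ 1 := by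
      apply inv_le_one_of_one_le₀
      rw [Real.one_le_sqrt]
      nlinarith [Real.pi_gt_three]
    have h4 : Real.exp (-(y - 0) ^ 2 / (2 * v)) ≤ 1 := by
      rw [Real.exp_le_one_iff, neg_div, neg_nonpos]; positivity
    exact mul_le_one₀ h3 (Real.exp_pos _).le h4
  simp at h2
  linarith

end RandomizedMartingale

/-! ### Lindeberg replacement for martingale differences -/

namespace RandomizedMartingale

/-- The Cauchy-Schwarz inequality, from the discriminant of `l ↦ ∫ (l f + g)²`. -/
lemma sq_integral_mul_le {α : Type*} {mα : MeasurableSpace α} {μ : Measure α} {f g : α → ℝ}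
    (hf : Integrable (fun x => f x ^ 2) μ) (hg : Integrable (fun x => g x ^ 2) μ)
    (hfg : Integrable (fun x => f x * g x) μ) :
    (∫ x, f x * g x ∂μ) ^ 2 ≤ (∫ x, f x ^ 2 ∂μ) * ∫ x, g x ^ 2 ∂μ := by
  have h1 : ∀ l : ℝ, 0 ≤ (∫ x, f x ^ 2 ∂μ) * (l * l) + (2 * ∫ x, f x * g x ∂μ) * l
      + ∫ x, g x ^ 2 ∂μ := by
    intro l
    have h2 : 0 ≤ ∫ x, (f x ^ 2 * (l * l) + f x * g x * (2 * l) + g x ^ 2) ∂μ :=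
      integral_nonneg fun x => by
        have : f x ^ 2 * (l * l) + f x * g x * (2 * l) + g x ^ 2 = (f x * l + g x) ^ 2 := by ring
        simp only [this]; exact sq_nonneg _
    rw [integral_add ((hf.mul_const _).fun_add (hfg.mul_const _)) hg,
      integral_add (hf.mul_const _) (hfg.mul_const _), integral_mul_const, integral_mul_const] at h2
    linarith
  have h3 := discrim_le_zero h1
  rw [discrim] at h3
  nlinarith

lemma integral_le_sqrt_integral_sq {α : Type*} {mα : MeasurableSpace α} {μ : Measure α}
    [IsProbabilityMeasure μ] {f : α → ℝ} (hf : Integrable f μ)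
    (hf2 : Integrable (fun x => f x ^ 2) μ) : ∫ x, f x ∂μ ≤ √(∫ x, f x ^ 2 ∂μ) := by
  apply Real.le_sqrt_of_sq_le
  have := sq_integral_mul_le (f := f) (g := fun _ => 1) (μ := μ) hf2 (by simp) (by simpa using hf)
  simpa using this

section Conditional

variable {Ω : Type*} {mΩ : MeasurableSpace Ω} {n : ℕ} {μ : Measure Ω}

/-- A bounded measurable complex weight may be tested against the conditional expectation. -/
lemma integral_mul_condExp {m : MeasurableSpace Ω} (hm : m ≤ mΩ) [IsFiniteMeasure μ]
    {Z : Ω → ℂ} (hZ : StronglyMeasurable[m] Z) (hZ1 : ∀ ω, ‖Z ω‖ ≤ 1) {h : Ω → ℝ}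
    (hh : Integrable h μ) :
    ∫ ω, Z ω * (h ω : ℂ) ∂μ = ∫ ω, Z ω * ((μ[h | m]) ω : ℂ) ∂μ := by
  have h1 : ∀ ω, Z ω * (h ω : ℂ) = (h • Z) ω := by
    intro ω; simp [mul_comm]
  have h2 : ∀ ω, Z ω * ((μ[h | m]) ω : ℂ) = (μ[h | m] • Z) ω := by
    intro ω; simp [mul_comm]
  have hint : Integrable (h • Z) μ :=
    (hh.smul_bdd 1 (hZ.mono hm).aestronglyMeasurable (ae_of_all _ hZ1))
  simp_rw [h1, h2]
  rw [← integral_condExp hm]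
  exact integral_congr_ae
    (condExp_smul_of_aestronglyMeasurable_right hh hint hZ.aestronglyMeasurable)

/-- The partial sums `∑_{i < k} a_i d_i`. -/
def partialSum (d : Fin n → Ω → ℝ) (a : Fin n → ℝ) (k : ℕ) (ω : Ω) : ℝ :=
  ∑ i with i.val < k, a i * d i ω

lemma partialSum_zero (d : Fin n → Ω → ℝ) (a : Fin n → ℝ) (ω : Ω) : partialSum d a 0 ω = 0 := by
  simp [partialSum]

lemma partialSum_last (d : Fin n → Ω → ℝ) (a : Fin n → ℝ) (ω : Ω) :
    partialSum d a n ω = ∑ i, a i * d i ω := by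
  simp [partialSum]

lemma sum_filter_lt_succ {M : Type*} [AddCommMonoid M] (f : Fin n → M) (j : Fin n) :
    ∑ i with i.val < j.val + 1, f i = ∑ i with i.val < j.val, f i + f j := by
  have : (Finset.univ.filter fun i : Fin n => i.val < j.val + 1)
      = insert j (Finset.univ.filter fun i : Fin n => i.val < j.val) := by
    ext i; simp [Fin.ext_iff]; omega
  rw [this, Finset.sum_insert (by simp), add_comm]

lemma sum_filter_le_eq {M : Type*} [AddCommMonoid M] (f : Fin n → M) (j : Fin n) :
    ∑ i with j.val ≤ i.val, f i = f j + ∑ i with j.val + 1 ≤ i.val, f i := by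
  have : (Finset.univ.filter fun i : Fin n => j.val ≤ i.val)
      = insert j (Finset.univ.filter fun i : Fin n => j.val + 1 ≤ i.val) := by
    ext i; simp [Fin.ext_iff]; omega
  rw [this, Finset.sum_insert (by simp)]

lemma partialSum_succ (d : Fin n → Ω → ℝ) (a : Fin n → ℝ) (j : Fin n) (ω : Ω) :
    partialSum d a (j.val + 1) ω = partialSum d a j.val ω + a j * d j ω :=
  sum_filter_lt_succ _ j

variable {ℱ : Filtration (Fin (n + 1)) mΩ} {d : Fin n → Ω → ℝ}

namespace IsMartingaleDifference

lemma measurable_ambient (hd : IsMartingaleDifference μ ℱ d) (j : Fin n) : Measurable (d j) :=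
  (hd.measurable j).mono (ℱ.le' _) le_rfl

lemma measurable_partialSum (hd : IsMartingaleDifference μ ℱ d) (a : Fin n → ℝ) (j : Fin n) :
    Measurable[ℱ j.castSucc] (partialSum d a j.val) := by
  unfold partialSum
  refine Finset.measurable_fun_sum (m := ℱ j.castSucc) _ fun i hi => ?_
  have hij : i.val < j.val := by simpa using hi
  have : Measurable[ℱ j.castSucc] (d i) := (hd.measurable i).mono
    (ℱ.mono' (by rw [Fin.le_def]; simp; omega)) le_rfl
  exact this.const_mul (a i)

lemma measurable_partialSum_ambient (hd : IsMartingaleDifference μ ℱ d) (a : Fin n → ℝ) (k : ℕ) :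
    Measurable (partialSum d a k) := by
  unfold partialSum
  exact Finset.measurable_fun_sum _ fun i _ => (hd.measurable_ambient i).const_mul (a i)

end IsMartingaleDifference

/-- The variables `exp (i ∑_{i < k} a_i d_i)`. -/
def phase (d : Fin n → Ω → ℝ) (a : Fin n → ℝ) (k : ℕ) (ω : Ω) : ℂ :=
  Complex.exp (partialSum d a k ω * Complex.I)

lemma norm_phase (d : Fin n → Ω → ℝ) (a : Fin n → ℝ) (k : ℕ) (ω : Ω) : ‖phase d a k ω‖ = 1 :=
  Complex.norm_exp_ofReal_mul_I _

lemma IsMartingaleDifference.stronglyMeasurable_phase (hd : IsMartingaleDifference μ ℱ d)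
    (a : Fin n → ℝ) (j : Fin n) : StronglyMeasurable[ℱ j.castSucc] (phase d a j.val) := by
  have h := hd.measurable_partialSum a j
  have : Measurable[ℱ j.castSucc] (phase d a j.val) :=
    (by fun_prop : Measurable fun s : ℝ => Complex.exp (s * Complex.I)).comp h
  exact this.stronglyMeasurable

lemma IsMartingaleDifference.measurable_phase (hd : IsMartingaleDifference μ ℱ d)
    (a : Fin n → ℝ) (k : ℕ) : Measurable (phase d a k) :=
  (by fun_prop : Measurable fun s : ℝ => Complex.exp (s * Complex.I)).comp
    (hd.measurable_partialSum_ambient a k)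

/-- The term of order three in the comparison of the `j`-th difference with a Gaussian variable:
it involves the conditional third moment of `d j`, the differences before `j` and Gaussian variables
after `j`. -/
def thirdOrderTerm (μ : Measure Ω) (ℱ : Filtration (Fin (n + 1)) mΩ) (d : Fin n → Ω → ℝ)
    (a : Fin n → ℝ) (j : Fin n) : ℂ :=
  ((a j ^ 3 / 6 : ℝ) : ℂ)
    * ((Real.exp (-((∑ i with j.val + 1 ≤ i.val, a i ^ 2 * ∫ ω, d i ω ^ 2 ∂μ) / 2)) : ℝ) : ℂ)
    * ∫ ω, phase d a j ω * ((μ[fun ω' => d j ω' ^ 3 | ℱ j.castSucc]) ω : ℂ) ∂μ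

lemma integrable_pow_of_memLp_four [IsFiniteMeasure μ] {f : Ω → ℝ} (hf : MemLp f 4 μ) {k : ℕ}
    (hk : k ≤ 4) :
    Integrable (fun ω => f ω ^ k) μ := by
  have h := (hf.mono_exponent (p := k) (by exact_mod_cast hk)).integrable_norm_pow'
  refine h.mono' (hf.aestronglyMeasurable.pow k) (ae_of_all _ fun ω => ?_)
  rw [norm_pow]

lemma integral_pow_four_le_alpha (d : Fin n → Ω → ℝ) (j : Fin n) :
    ∫ ω, d j ω ^ 4 ∂μ ≤ alpha μ d :=
  le_ciSup (f := fun k => ∫ ω, d k ω ^ 4 ∂μ) (Set.finite_range _).bddAbove j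

lemma sq_integral_sq_le_alpha [IsProbabilityMeasure μ] (h4 : ∀ j, MemLp (d j) 4 μ) (j : Fin n) :
    (∫ ω, d j ω ^ 2 ∂μ) ^ 2 ≤ alpha μ d := by
  have h1 := sq_integral_mul_le (μ := μ) (f := fun ω => d j ω ^ 2) (g := fun _ => 1)
    (by simpa [← pow_mul] using integrable_pow_of_memLp_four (h4 j) (k := 4) le_rfl) (by simp)
    (by simpa using integrable_pow_of_memLp_four (h4 j) (k := 2) (by norm_num))
  refine le_trans ?_ (integral_pow_four_le_alpha d j)
  simpa [← pow_mul] using h1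

/-- Expansion of `exp (i u) - exp (-b)` to order three, for `b` of the order of `u²`. -/
lemma norm_exp_mul_I_sub_exp_sub_le (u b : ℝ) (hb : 0 ≤ b) :
    ‖Complex.exp (u * Complex.I) - (Real.exp (-b) : ℂ)
      - ((u : ℂ) * Complex.I - ((u ^ 2 / 2 - b : ℝ) : ℂ) - ((u ^ 3 / 6 : ℝ) : ℂ) * Complex.I)‖
      ≤ u ^ 4 / 24 + b ^ 2 / 2 := by
  have h1 := norm_exp_mul_I_sub_sum_le 3 u
  rw [show (3 + 1 : ℕ) = 4 by norm_num] at h1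
  have h2 : ‖(((1 - b) - Real.exp (-b) : ℝ) : ℂ)‖ ≤ b ^ 2 / 2 := by
    rw [Complex.norm_real, Real.norm_eq_abs]
    have e1 := Real.add_one_le_exp (-b)
    have e2 : Real.exp (-b) ≤ 1 - b + b ^ 2 / 2 := by
      have e3 := Real.quadratic_le_exp_of_nonneg hb
      have e4 : Real.exp (-b) * Real.exp b = 1 := by rw [← Real.exp_add]; simp
      have e5 := Real.exp_pos (-b)
      nlinarith [mul_nonneg hb hb, mul_nonneg (mul_nonneg hb hb) (mul_nonneg hb hb)]
    exact abs_le.2 ⟨by linarith, by linarith⟩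
  have h3 : Complex.exp (u * Complex.I) - (Real.exp (-b) : ℂ)
      - ((u : ℂ) * Complex.I - ((u ^ 2 / 2 - b : ℝ) : ℂ) - ((u ^ 3 / 6 : ℝ) : ℂ) * Complex.I)
      = (Complex.exp (u * Complex.I)
        - ∑ j ∈ Finset.range 4, (u * Complex.I) ^ j / (j.factorial : ℂ))
        + (((1 - b) - Real.exp (-b) : ℝ) : ℂ) := by
    simp only [Finset.sum_range_succ, Finset.sum_range_zero, Nat.factorial]
    push_cast
    have e1 : ((u : ℂ) * Complex.I) ^ 2 = - u ^ 2 := by rw [mul_pow, Complex.I_sq]; ring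
    have e2 : ((u : ℂ) * Complex.I) ^ 3 = - u ^ 3 * Complex.I := by
      rw [pow_succ, e1]; ring
    rw [e1, e2]
    ring
  rw [h3]
  refine (norm_add_le _ _).trans (add_le_add (h1.trans (le_of_eq ?_)) h2)
  rw [show |u| ^ 4 = u ^ 4 from (by decide : Even 4).pow_abs u]
  norm_num [Nat.factorial]

/-- Replacement of one difference by a Gaussian variable of the same variance. Given the past, the
term of order one vanishes, the term of order two is the deviation of the conditional variance, and
the term of order three is kept on the left side. -/
lemma norm_replacement_sub_le [IsProbabilityMeasure μ] (hd : IsMartingaleDifference μ ℱ d)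
    (h4 : ∀ j, MemLp (d j) 4 μ) (a : Fin n → ℝ) (j : Fin n) :
    ‖∫ ω, phase d a j ω * (Complex.exp ((a j * d j ω : ℝ) * Complex.I)
        - (Real.exp (-(a j ^ 2 * (∫ ω, d j ω ^ 2 ∂μ) / 2)) : ℂ)) ∂μ
      + ((a j ^ 3 / 6 : ℝ) : ℂ) * Complex.I *
        ∫ ω, phase d a j ω * ((μ[fun ω' => d j ω' ^ 3 | ℱ j.castSucc]) ω : ℂ) ∂μ‖
    ≤ a j ^ 2 / 2 * ∫ ω, |(μ[fun ω' => d j ω' ^ 2 | ℱ j.castSucc]) ω - ∫ ω', d j ω' ^ 2 ∂μ| ∂μ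
      + a j ^ 4 * alpha μ d := by
  set s := ∫ ω, d j ω ^ 2 ∂μ with hs
  have hs0 : 0 ≤ s := integral_nonneg fun ω => sq_nonneg _
  have hm := ℱ.le' j.castSucc
  have hZ := hd.stronglyMeasurable_phase a j
  have hZ1 : ∀ ω, ‖phase d a j ω‖ ≤ 1 := fun ω => (norm_phase d a j ω).le
  have hZm : AEStronglyMeasurable (phase d a j) μ :=
    (hd.measurable_phase a j).aestronglyMeasurable
  have hdm := hd.measurable_ambient j
  have i1 := hd.integrable j
  have i2 := integrable_pow_of_memLp_four (h4 j) (k := 2) (by norm_num)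
  have i3 := integrable_pow_of_memLp_four (h4 j) (k := 3) (by norm_num)
  have i4 := integrable_pow_of_memLp_four (h4 j) (k := 4) (by norm_num)
  have i2s : Integrable (fun ω => d j ω ^ 2 - s) μ := i2.sub (integrable_const s)
  have hbd : ∀ {f : Ω → ℝ}, Integrable f μ → Integrable (fun ω => phase d a j ω * (f ω : ℂ)) μ := by
    intro f hf
    exact hf.ofReal.bdd_mul (c := 1) hZm (ae_of_all _ hZ1)
  set b := a j ^ 2 * s / 2 with hb
  have hb0 : 0 ≤ b := by positivity
  set R : Ω → ℂ := fun ω => Complex.exp ((a j * d j ω : ℝ) * Complex.I) - (Real.exp (-b) : ℂ)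
      - (((a j * d j ω : ℝ) : ℂ) * Complex.I - (((a j * d j ω) ^ 2 / 2 - b : ℝ) : ℂ)
        - (((a j * d j ω) ^ 3 / 6 : ℝ) : ℂ) * Complex.I) with hR
  have hRb : ∀ ω, ‖phase d a j ω * R ω‖ ≤ a j ^ 4 / 24 * d j ω ^ 4 + b ^ 2 / 2 := by
    intro ω
    rw [norm_mul, norm_phase, one_mul]
    refine (norm_exp_mul_I_sub_exp_sub_le _ b hb0).trans (le_of_eq ?_)
    ring
  have hRi : Integrable (fun ω => phase d a j ω * R ω) μ := by
    refine Integrable.mono' ((i4.const_mul _).add (integrable_const _)) ?_ (ae_of_all _ hRb)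
    exact hZm.mul (Measurable.aestronglyMeasurable (by simp only [hR]; fun_prop))
  have e1 : ∫ ω, phase d a j ω * (d j ω : ℂ) ∂μ = 0 := by
    rw [integral_mul_condExp hm hZ hZ1 i1, integral_eq_zero_of_ae]
    filter_upwards [hd.condExp_eq_zero j] with ω hω
    simp [hω]
  have e2 : ∫ ω, phase d a j ω * ((d j ω ^ 2 - s : ℝ) : ℂ) ∂μ
      = ∫ ω, phase d a j ω *
        (((μ[fun ω' => d j ω' ^ 2 | ℱ j.castSucc]) ω - s : ℝ) : ℂ) ∂μ := by
    rw [integral_mul_condExp hm hZ hZ1 i2s]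
    refine integral_congr_ae ?_
    filter_upwards [condExp_sub i2 (integrable_const s) (ℱ j.castSucc)] with ω hω
    have h5 : (μ[fun ω' => d j ω' ^ 2 - s | ℱ j.castSucc]) ω
        = (μ[fun ω' => d j ω' ^ 2 | ℱ j.castSucc]) ω - s := by
      have h6 := condExp_const (μ := μ) hm s
      have h7 : (μ[fun ω' => d j ω' ^ 2 - s | ℱ j.castSucc]) ω
        = (μ[(fun ω' => d j ω' ^ 2) - fun _ => s | ℱ j.castSucc]) ω := rfl
      rw [h7, hω, Pi.sub_apply, h6]
    rw [h5]
  have e3 := integral_mul_condExp hm hZ hZ1 i3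
  have hsplit : ∀ ω, phase d a j ω * (Complex.exp ((a j * d j ω : ℝ) * Complex.I)
        - (Real.exp (-b) : ℂ))
      = (a j : ℂ) * Complex.I * (phase d a j ω * (d j ω : ℂ))
        - ((a j ^ 2 / 2 : ℝ) : ℂ) * (phase d a j ω * ((d j ω ^ 2 - s : ℝ) : ℂ))
        - ((a j ^ 3 / 6 : ℝ) : ℂ) * Complex.I * (phase d a j ω * ((d j ω ^ 3 : ℝ) : ℂ))
        + phase d a j ω * R ω := by
    intro ω
    simp only [hR, hb]
    push_cast
    ring
  have j1 := (hbd i1).const_mul ((a j : ℂ) * Complex.I)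
  have j2 := (hbd i2s).const_mul ((a j ^ 2 / 2 : ℝ) : ℂ)
  have j3 := (hbd i3).const_mul (((a j ^ 3 / 6 : ℝ) : ℂ) * Complex.I)
  have j12 : Integrable (fun ω => (a j : ℂ) * Complex.I * (phase d a j ω * (d j ω : ℂ))
      - ((a j ^ 2 / 2 : ℝ) : ℂ) * (phase d a j ω * ((d j ω ^ 2 - s : ℝ) : ℂ))) μ := j1.sub j2
  simp_rw [hsplit]
  rw [integral_add (f := fun ω => (a j : ℂ) * Complex.I * (phase d a j ω * (d j ω : ℂ))
      - ((a j ^ 2 / 2 : ℝ) : ℂ) * (phase d a j ω * ((d j ω ^ 2 - s : ℝ) : ℂ))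
      - ((a j ^ 3 / 6 : ℝ) : ℂ) * Complex.I * (phase d a j ω * ((d j ω ^ 3 : ℝ) : ℂ)))
    (j12.sub j3) hRi, integral_sub j12 j3, integral_sub j1 j2,
    integral_const_mul, integral_const_mul, integral_const_mul, e1, e2, e3]
  set G := ∫ ω, phase d a j ω * (((μ[fun ω' => d j ω' ^ 2 | ℱ j.castSucc]) ω - s : ℝ) : ℂ) ∂μ
    with hG
  have hGle : ‖G‖ ≤ ∫ ω, |(μ[fun ω' => d j ω' ^ 2 | ℱ j.castSucc]) ω - s| ∂μ := by
    refine (norm_integral_le_integral_norm _).trans (le_of_eq ?_)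
    congr 1; ext ω
    rw [norm_mul, norm_phase, one_mul, Complex.norm_real, Real.norm_eq_abs]
  have hRle : ‖∫ ω, phase d a j ω * R ω ∂μ‖ ≤ a j ^ 4 * alpha μ d := by
    refine (norm_integral_le_of_norm_le ((i4.const_mul _).add (integrable_const _))
      (ae_of_all _ hRb)).trans ?_
    simp only [Pi.add_apply]
    rw [integral_add (i4.const_mul _) (integrable_const _), integral_const_mul]
    simp only [integral_const, probReal_univ, smul_eq_mul, one_mul]
    have h5 := integral_pow_four_le_alpha (μ := μ) d j
    have h6 := sq_integral_sq_le_alpha (μ := μ) h4 j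
    have h7 : b ^ 2 / 2 = a j ^ 4 * s ^ 2 / 8 := by rw [hb]; ring
    have h8 : 0 ≤ a j ^ 4 := by positivity
    rw [h7]
    nlinarith [mul_le_mul_of_nonneg_left h5 h8, mul_le_mul_of_nonneg_left h6 h8,
      mul_nonneg h8 (sq_nonneg s)]
  have hfin : ∀ X Y : ℂ, (a j : ℂ) * Complex.I * 0 - ((a j ^ 2 / 2 : ℝ) : ℂ) * G - X + Y + X
      = -(((a j ^ 2 / 2 : ℝ) : ℂ) * G) + Y := fun X Y => by ring
  rw [hfin]
  refine (norm_add_le _ _).trans (add_le_add ?_ hRle)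
  rw [norm_neg, norm_mul, Complex.norm_real, Real.norm_eq_abs, abs_of_nonneg (by positivity)]
  gcongr

/-- Lindeberg's telescoping argument for the characteristic function of `∑ a_j d_j`, with the terms
of order three kept apart. -/
lemma norm_integral_phase_sub_le [IsProbabilityMeasure μ] (hd : IsMartingaleDifference μ ℱ d)
    (h4 : ∀ j, MemLp (d j) 4 μ) (a : Fin n → ℝ) :
    ‖∫ ω, Complex.exp ((∑ i, a i * d i ω : ℝ) * Complex.I) ∂μ
      - (Real.exp (-((∑ i, a i ^ 2 * ∫ ω, d i ω ^ 2 ∂μ) / 2)) : ℂ)‖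
    ≤ ∑ j, (a j ^ 2 / 2
        * ∫ ω, |(μ[fun ω' => d j ω' ^ 2 | ℱ j.castSucc]) ω - ∫ ω', d j ω' ^ 2 ∂μ| ∂μ
        + a j ^ 4 * alpha μ d)
      + ‖∑ j, thirdOrderTerm μ ℱ d a j‖ := by
  set s : Fin n → ℝ := fun i => ∫ ω, d i ω ^ 2 ∂μ with hs
  have hs0 : ∀ i, 0 ≤ s i := fun i => integral_nonneg fun ω => sq_nonneg _
  -- `Φ k` is the characteristic function with the first `k` differences and Gaussian variables
  -- after them.
  let W : ℕ → ℝ := fun k => Real.exp (-((∑ i with k ≤ i.val, a i ^ 2 * s i) / 2))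
  let Φ : ℕ → ℂ := fun k => (∫ ω, phase d a k ω ∂μ) * (W k : ℂ)
  have hW1 : ∀ k, W k ≤ 1 := fun k => by
    simp only [W]
    rw [Real.exp_le_one_iff, neg_nonpos]
    exact div_nonneg (Finset.sum_nonneg fun i _ => mul_nonneg (sq_nonneg _) (hs0 i)) (by norm_num)
  have hW0 : ∀ k, 0 ≤ W k := fun k => (Real.exp_pos _).le
  have hWstep : ∀ j : Fin n, W j = Real.exp (-(a j ^ 2 * s j / 2)) * W (j.val + 1) := by
    intro j
    simp only [W]
    rw [sum_filter_le_eq, ← Real.exp_add]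
    congr 1; ring
  have hΦn : Φ n = ∫ ω, Complex.exp ((∑ i, a i * d i ω : ℝ) * Complex.I) ∂μ := by
    simp only [Φ, W, phase, partialSum_last]
    rw [Finset.filter_false_of_mem (fun i _ => by have := i.2; omega)]
    simp
  have hΦ0 : Φ 0 = (Real.exp (-((∑ i, a i ^ 2 * s i) / 2)) : ℂ) := by
    simp [Φ, W, phase, partialSum_zero]
  have htel : Φ n - Φ 0 = ∑ j : Fin n, (Φ (j.val + 1) - Φ j.val) := by
    rw [← Finset.sum_range_sub, Finset.sum_range]
  have hph : ∀ k, Integrable (phase d a k) μ := fun k =>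
    Integrable.of_bound (hd.measurable_phase a k).aestronglyMeasurable 1
      (ae_of_all _ fun ω => (norm_phase d a k ω).le)
  have hstep : ∀ j : Fin n, Φ (j.val + 1) - Φ j.val = (W (j.val + 1) : ℂ) *
      ∫ ω, phase d a j ω * (Complex.exp ((a j * d j ω : ℝ) * Complex.I)
        - (Real.exp (-(a j ^ 2 * s j / 2)) : ℂ)) ∂μ := by
    intro j
    have h1 : ∀ ω, phase d a j ω * (Complex.exp ((a j * d j ω : ℝ) * Complex.I)
        - (Real.exp (-(a j ^ 2 * s j / 2)) : ℂ))
        = phase d a (j.val + 1) ω - phase d a j ω * (Real.exp (-(a j ^ 2 * s j / 2)) : ℂ) := by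
      intro ω
      rw [mul_sub]
      congr 1
      simp only [phase, partialSum_succ]
      rw [← Complex.exp_add]
      push_cast
      congr 1; ring
    simp_rw [h1]
    rw [integral_sub (hph _) ((hph _).mul_const _), integral_mul_const]
    simp only [Φ]
    rw [hWstep j]
    push_cast
    ring
  rw [← hΦn, ← hΦ0, htel]
  have hdecomp : ∑ j : Fin n, (Φ (j.val + 1) - Φ j.val)
      = ∑ j : Fin n, (W (j.val + 1) : ℂ) *
        (∫ ω, phase d a j ω * (Complex.exp ((a j * d j ω : ℝ) * Complex.I)
        - (Real.exp (-(a j ^ 2 * s j / 2)) : ℂ)) ∂μ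
        + ((a j ^ 3 / 6 : ℝ) : ℂ) * Complex.I *
        ∫ ω, phase d a j ω * ((μ[fun ω' => d j ω' ^ 3 | ℱ j.castSucc]) ω : ℂ) ∂μ)
      - Complex.I * ∑ j, thirdOrderTerm μ ℱ d a j := by
    rw [Finset.mul_sum, ← Finset.sum_sub_distrib]
    refine Finset.sum_congr rfl fun j _ => ?_
    rw [hstep, thirdOrderTerm]
    simp only [W, hs]
    ring
  rw [hdecomp]
  refine (norm_sub_le _ _).trans (add_le_add ?_ ?_)
  · refine (norm_sum_le _ _).trans (Finset.sum_le_sum fun j _ => ?_)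
    rw [norm_mul, Complex.norm_real, Real.norm_eq_abs, abs_of_nonneg (hW0 _)]
    exact (mul_le_of_le_one_left (norm_nonneg _) (hW1 _)).trans (norm_replacement_sub_le hd h4 a j)
  · rw [norm_mul, Complex.norm_I, one_mul]

end Conditional

end RandomizedMartingale

/-! ### Low frequencies: averaging over the sphere -/

namespace RandomizedMartingale

/-- Change of sign of the coordinate `k`. -/
def flipCoord {n : ℕ} (k : Fin n) (x : EuclideanSpace ℝ (Fin n)) : EuclideanSpace ℝ (Fin n) :=
  WithLp.toLp 2 fun j => if j = k then - x j else x j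

lemma flipCoord_self {n : ℕ} (k : Fin n) (x : EuclideanSpace ℝ (Fin n)) :
    flipCoord k x k = - x k := by simp [flipCoord]

lemma flipCoord_of_ne {n : ℕ} {j k : Fin n} (h : j ≠ k) (x : EuclideanSpace ℝ (Fin n)) :
    flipCoord k x j = x j := by simp [flipCoord, h]

lemma flipCoord_sq {n : ℕ} (j k : Fin n) (x : EuclideanSpace ℝ (Fin n)) :
    flipCoord k x j ^ 2 = x j ^ 2 := by
  by_cases h : j = k
  · rw [h, flipCoord_self, neg_sq]
  · rw [flipCoord_of_ne h]

open ComplexConjugate in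
/-- Functions `T j` which are odd in the coordinate `j` and even in the later coordinates are
orthogonal for the uniform law on the sphere. -/
lemma IsSphereUniform.integral_norm_sum_sq {n : ℕ} {ν : Measure (EuclideanSpace ℝ (Fin n))}
    (h : IsSphereUniform ν) {T : Fin n → EuclideanSpace ℝ (Fin n) → ℂ}
    (hT : ∀ j, Continuous (T j)) (heven : ∀ j k x, j < k → T j (flipCoord k x) = T j x)
    (hodd : ∀ j x, T j (flipCoord j x) = - T j x) :
    ∫ x, ‖∑ j, T j x‖ ^ 2 ∂ν = ∑ j, ∫ x, ‖T j x‖ ^ 2 ∂ν := by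
  have hzero : ∀ j k, j ≠ k → ∫ x, T j x * conj (T k x) ∂ν = 0 := by
    intro j k hjk
    rcases lt_or_gt_of_ne hjk with hlt | hlt
    · have h1 := h.integral_comp_neg_coord (fun x => T j x * conj (T k x)) k
      have h2 : ∀ x, T j (flipCoord k x) * conj (T k (flipCoord k x))
          = - (T j x * conj (T k x)) := by
        intro x; rw [heven j k x hlt, hodd, map_neg]; ring
      change ∫ x, T j (flipCoord k x) * conj (T k (flipCoord k x)) ∂ν = _ at h1
      simp_rw [h2] at h1
      rw [integral_neg] at h1
      exact self_eq_neg.1 h1.symm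
    · have h1 := h.integral_comp_neg_coord (fun x => T j x * conj (T k x)) j
      have h2 : ∀ x, T j (flipCoord j x) * conj (T k (flipCoord j x))
          = - (T j x * conj (T k x)) := by
        intro x; rw [heven k j x hlt, hodd]; ring
      change ∫ x, T j (flipCoord j x) * conj (T k (flipCoord j x)) ∂ν = _ at h1
      simp_rw [h2] at h1
      rw [integral_neg] at h1
      exact self_eq_neg.1 h1.symm
  have hsq : ∀ z : ℂ, ((‖z‖ ^ 2 : ℝ) : ℂ) = z * conj z := by
    intro z; rw [Complex.mul_conj, Complex.normSq_eq_norm_sq]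
  apply Complex.ofReal_injective
  rw [Complex.ofReal_sum]
  simp_rw [← integral_complex_ofReal, hsq, map_sum, Finset.sum_mul_sum]
  rw [integral_finsetSum _ fun j _ => h.integrable_of_continuous (by fun_prop)]
  refine Finset.sum_congr rfl fun j _ => ?_
  rw [integral_finsetSum _ fun k _ => h.integrable_of_continuous (by fun_prop)]
  exact Finset.sum_eq_single j (fun k _ hk => hzero j k hk.symm) (by simp)

section

variable {Ω : Type*} {mΩ : MeasurableSpace Ω} {n : ℕ} {μ : Measure Ω}
  {ℱ : Filtration (Fin (n + 1)) mΩ} {d : Fin n → Ω → ℝ}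

/-- Characteristic function of the vector `(d_1, …, d_n)`. -/
def vectorCharFun (μ : Measure Ω) (d : Fin n → Ω → ℝ) (a : Fin n → ℝ) : ℂ :=
  ∫ ω, Complex.exp ((∑ i, a i * d i ω : ℝ) * Complex.I) ∂μ

/-- Characteristic function of a centered Gaussian vector with independent entries that have the
same variances as `(d_1, …, d_n)`. -/
def gaussianCharFun (μ : Measure Ω) (d : Fin n → Ω → ℝ) (a : Fin n → ℝ) : ℝ :=
  Real.exp (-((∑ i, a i ^ 2 * ∫ ω, d i ω ^ 2 ∂μ) / 2))

lemma phase_congr {a b : Fin n → ℝ} {j : Fin n} (h : ∀ i < j, a i = b i) :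
    phase d a j = phase d b j := by
  ext ω
  simp only [phase, partialSum]
  congr 3
  refine Finset.sum_congr rfl fun i hi => ?_
  rw [h i (Finset.mem_filter.1 hi).2]

/-- The `j`-th term of order three is odd in `a_j` and depends on the later coefficients through
their squares only. -/
lemma thirdOrderTerm_eq_of_sign {a b : Fin n → ℝ} {j : Fin n} (h1 : ∀ i < j, a i = b i)
    (h2 : ∀ i, j < i → a i ^ 2 = b i ^ 2) {ε : ℝ} (h3 : a j ^ 3 = ε * b j ^ 3) :
    thirdOrderTerm μ ℱ d a j = ε * thirdOrderTerm μ ℱ d b j := by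
  have h4 : ∑ i with j.val + 1 ≤ i.val, a i ^ 2 * ∫ ω, d i ω ^ 2 ∂μ
      = ∑ i with j.val + 1 ≤ i.val, b i ^ 2 * ∫ ω, d i ω ^ 2 ∂μ := by
    refine Finset.sum_congr rfl fun i hi => ?_
    rw [h2 i (Finset.mem_filter.1 hi).2]
  simp only [thirdOrderTerm]
  rw [phase_congr h1, h4, h3]
  push_cast
  ring

lemma continuous_thirdOrderTerm [IsProbabilityMeasure μ] (hd : IsMartingaleDifference μ ℱ d)
    (j : Fin n) : Continuous fun a : Fin n → ℝ => thirdOrderTerm μ ℱ d a j := by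
  unfold thirdOrderTerm
  refine Continuous.mul (by fun_prop) ?_
  refine continuous_of_dominated
    (bound := fun ω => |(μ[fun ω' => d j ω' ^ 3 | ℱ j.castSucc]) ω|) (fun a => ?_) (fun a => ?_)
    integrable_condExp.abs (ae_of_all _ fun ω => ?_)
  · exact (hd.measurable_phase a j).aestronglyMeasurable.mul
      (Complex.continuous_ofReal.comp_aestronglyMeasurable integrable_condExp.aestronglyMeasurable)
  · refine ae_of_all _ fun ω => ?_
    rw [norm_mul, norm_phase, one_mul, Complex.norm_real, Real.norm_eq_abs]
  · unfold phase partialSum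
    fun_prop

lemma norm_thirdOrderTerm_le (a : Fin n → ℝ) (j : Fin n) :
    ‖thirdOrderTerm μ ℱ d a j‖
      ≤ |a j| ^ 3 / 6 * ∫ ω, |(μ[fun ω' => d j ω' ^ 3 | ℱ j.castSucc]) ω| ∂μ := by
  rw [thirdOrderTerm, norm_mul, norm_mul, Complex.norm_real, Complex.norm_real, Real.norm_eq_abs,
    Real.norm_eq_abs, Real.abs_exp]
  have h1 : Real.exp (-((∑ i with j.val + 1 ≤ i.val, a i ^ 2 * ∫ ω, d i ω ^ 2 ∂μ) / 2)) ≤ 1 := by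
    rw [Real.exp_le_one_iff, neg_nonpos]
    exact div_nonneg (Finset.sum_nonneg fun i _ => mul_nonneg (sq_nonneg _)
      (integral_nonneg fun ω => sq_nonneg _)) (by norm_num)
  have h2 : ‖∫ ω, phase d a j ω * ((μ[fun ω' => d j ω' ^ 3 | ℱ j.castSucc]) ω : ℂ) ∂μ‖
      ≤ ∫ ω, |(μ[fun ω' => d j ω' ^ 3 | ℱ j.castSucc]) ω| ∂μ := by
    refine (norm_integral_le_integral_norm _).trans (le_of_eq ?_)
    congr 1; ext ω
    rw [norm_mul, norm_phase, one_mul, Complex.norm_real, Real.norm_eq_abs]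
  rw [abs_div, abs_pow, abs_of_pos (by norm_num : (0 : ℝ) < 6)]
  gcongr
  exact mul_le_of_le_one_right (by positivity) h1

lemma beta_nonneg : 0 ≤ beta μ ℱ d := integral_nonneg fun _ => Real.sqrt_nonneg _

lemma gamma_nonneg : 0 ≤ gamma μ ℱ d :=
  Finset.sum_nonneg fun _ _ => integral_nonneg fun _ => abs_nonneg _

/-- Minkowski's inequality: the Euclidean norm of the mean is at most the mean of the norm. -/
lemma sum_sq_integral_abs_le_beta (hn : 0 < n) :
    ∑ j, (∫ ω, |(μ[fun ω' => d j ω' ^ 3 | ℱ j.castSucc]) ω| ∂μ) ^ 2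
      ≤ n * beta μ ℱ d ^ 2 := by
  have hn' : (0 : ℝ) < n := by exact_mod_cast hn
  set u : Fin n → Ω → ℝ := fun j => μ[fun ω' => d j ω' ^ 3 | ℱ j.castSucc] with hu
  have hui : ∀ j, Integrable (u j) μ := fun j => integrable_condExp
  set c : Fin n → ℝ := fun j => ∫ ω, |u j ω| ∂μ with hc
  set N : Ω → ℝ := fun ω => √(∑ j, u j ω ^ 2) with hN
  have hNi : Integrable N μ := by
    refine (integrable_finsetSum Finset.univ fun j _ => (hui j).abs).mono' ?_
      (ae_of_all _ fun ω => ?_)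
    · exact Real.continuous_sqrt.comp_aestronglyMeasurable
        (Finset.aestronglyMeasurable_fun_sum _ fun j _ => (hui j).aestronglyMeasurable.pow 2)
    · rw [Real.norm_eq_abs, abs_of_nonneg (Real.sqrt_nonneg _)]
      apply Real.sqrt_le_iff.2 ⟨Finset.sum_nonneg fun j _ => abs_nonneg _, ?_⟩
      have := Finset.sum_sq_le_sq_sum_of_nonneg (s := Finset.univ) (f := fun j => |u j ω|)
        (fun j _ => abs_nonneg _)
      simpa using this
  have hbeta : beta μ ℱ d = (∫ ω, N ω ∂μ) / √n := by
    rw [beta, ← integral_div]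
    congr 1; ext ω
    rw [Real.sqrt_mul (by positivity), Real.sqrt_div (by norm_num), Real.sqrt_one]
    simp only [hN, hu]
    ring
  set A := ∑ j, c j ^ 2 with hA
  have hA0 : 0 ≤ A := Finset.sum_nonneg fun j _ => sq_nonneg _
  have h1 : A ≤ √A * ∫ ω, N ω ∂μ := by
    calc A = ∫ ω, ∑ j, c j * |u j ω| ∂μ := by
          rw [integral_finsetSum _ fun j _ => (hui j).abs.const_mul _]
          simp_rw [integral_const_mul]
          exact Finset.sum_congr rfl fun j _ => sq _
      _ ≤ ∫ ω, √A * N ω ∂μ := by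
          refine integral_mono (integrable_finsetSum _ fun j _ => (hui j).abs.const_mul _)
            (hNi.const_mul _) fun ω => ?_
          have := Real.sum_mul_le_sqrt_mul_sqrt Finset.univ c (fun j => |u j ω|)
          simpa [hA, hN] using this
      _ = _ := integral_const_mul _ _
  have hI0 : 0 ≤ ∫ ω, N ω ∂μ := integral_nonneg fun _ => Real.sqrt_nonneg _
  have h2 : √A ≤ ∫ ω, N ω ∂μ := by
    rcases hA0.eq_or_lt with h0 | h0
    · rw [← h0, Real.sqrt_zero]; exact hI0
    · have h3 : √A * √A ≤ √A * ∫ ω, N ω ∂μ := by rwa [Real.mul_self_sqrt hA0]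
      exact le_of_mul_le_mul_left h3 (Real.sqrt_pos.2 h0)
  have h4 : A ≤ (∫ ω, N ω ∂μ) ^ 2 := by
    rw [← Real.sq_sqrt hA0]; gcongr
  rw [hbeta, div_pow, Real.sq_sqrt hn'.le]
  refine h4.trans (le_of_eq ?_)
  field_simp

variable {ν : Measure (EuclideanSpace ℝ (Fin n))}

/-- The mean of a sum of orthogonal functions of order three in the coordinates is controlled by the
sum of squares of their norms, which gains a factor `√n` over adding absolute values. -/
lemma IsSphereUniform.integral_norm_sum_le (hν : IsSphereUniform ν)
    {T : Fin n → EuclideanSpace ℝ (Fin n) → ℂ}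
    (hT : ∀ j, Continuous (T j)) (heven : ∀ j k x, j < k → T j (flipCoord k x) = T j x)
    (hodd : ∀ j x, T j (flipCoord j x) = - T j x) {c : Fin n → ℝ} {A t : ℝ} (hA : 0 ≤ A)
    (hc : ∑ j, c j ^ 2 ≤ n * A ^ 2) (ht : 0 ≤ t) (hn : 0 < n)
    (hTc : ∀ j x, ‖T j x‖ ≤ |t * x j| ^ 3 / 6 * c j) :
    ∫ x, ‖∑ j, T j x‖ ∂ν ≤ 9 * t ^ 3 * A / n := by
  have := hν.isProbabilityMeasure
  have hn' : (0 : ℝ) < n := by exact_mod_cast hn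
  have hTs : Continuous fun x => ‖∑ j, T j x‖ := (continuous_finsetSum _ fun j _ => hT j).norm
  have h1 : ∀ j, ∫ x, ‖T j x‖ ^ 2 ∂ν ≤ 80 * t ^ 6 / n ^ 3 * c j ^ 2 := by
    intro j
    have hx : Continuous fun x : EuclideanSpace ℝ (Fin n) => x j ^ (2 * 3) := by fun_prop
    have h2 : ∫ x, ‖T j x‖ ^ 2 ∂ν ≤ ∫ x, t ^ 6 * c j ^ 2 / 36 * x j ^ (2 * 3) ∂ν := by
      refine integral_mono (hν.integrable_of_continuous ((hT j).norm.pow 2))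
        ((hν.integrable_of_continuous hx).const_mul _) fun x => ?_
      calc ‖T j x‖ ^ 2 ≤ (|t * x j| ^ 3 / 6 * c j) ^ 2 :=
            pow_le_pow_left₀ (norm_nonneg _) (hTc j x) 2
        _ = |t * x j| ^ 6 * c j ^ 2 / 36 := by ring
        _ = _ := by
            rw [show |t * x j| ^ 6 = (t * x j) ^ 6 from (by decide : Even 6).pow_abs _]; ring
    rw [integral_const_mul] at h2
    refine h2.trans ?_
    have h4 := hν.integral_coord_pow_le 3 j
    calc t ^ 6 * c j ^ 2 / 36 * ∫ x, x j ^ (2 * 3) ∂ν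
        ≤ t ^ 6 * c j ^ 2 / 36 * (4 * (2 * 3).factorial / n ^ 3) := by gcongr
      _ = _ := by norm_num [Nat.factorial]; ring
  have h3 : ∫ x, ‖∑ j, T j x‖ ^ 2 ∂ν ≤ (9 * t ^ 3 * A / n) ^ 2 := by
    rw [hν.integral_norm_sum_sq hT heven hodd]
    refine (Finset.sum_le_sum fun j _ => h1 j).trans ?_
    rw [← Finset.mul_sum]
    calc 80 * t ^ 6 / n ^ 3 * ∑ j, c j ^ 2 ≤ 80 * t ^ 6 / n ^ 3 * (n * A ^ 2) := by gcongr
      _ = 80 * (t ^ 3 * A / n) ^ 2 := by field_simp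
      _ ≤ 81 * (t ^ 3 * A / n) ^ 2 := by gcongr; norm_num
      _ = _ := by ring
  refine (integral_le_sqrt_integral_sq (hν.integrable_of_continuous hTs)
    (hν.integrable_of_continuous (hTs.pow 2))).trans ?_
  exact Real.sqrt_le_iff.2 ⟨by positivity, h3⟩

lemma integral_norm_sum_thirdOrderTerm_le [IsProbabilityMeasure μ] (hν : IsSphereUniform ν)
    (hd : IsMartingaleDifference μ ℱ d) (hn : 0 < n) {t : ℝ} (ht : 0 ≤ t) :
    ∫ x, ‖∑ j, thirdOrderTerm μ ℱ d (fun i => t * x i) j‖ ∂ν ≤ 9 * t ^ 3 * beta μ ℱ d / n := by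
  have hc0 : Continuous fun (x : EuclideanSpace ℝ (Fin n)) (i : Fin n) => t * x i := by fun_prop
  have hc1 : ∀ j, Continuous fun x : EuclideanSpace ℝ (Fin n) =>
      thirdOrderTerm μ ℱ d (fun i => t * x i) j := by
    intro j
    have := (continuous_thirdOrderTerm hd j).comp hc0
    exact this
  refine hν.integral_norm_sum_le (T := fun j x => thirdOrderTerm μ ℱ d (fun i => t * x i) j)
    hc1 (fun j k x hjk => ?_) (fun j x => ?_)
    beta_nonneg (sum_sq_integral_abs_le_beta hn) ht hn (fun j x => norm_thirdOrderTerm_le _ j)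
  · have := thirdOrderTerm_eq_of_sign (μ := μ) (ℱ := ℱ) (d := d)
      (a := fun i => t * flipCoord k x i) (b := fun i => t * x i) (j := j) (ε := 1)
      (fun i hi => by simp only; rw [flipCoord_of_ne (hi.trans hjk).ne])
      (fun i _ => by simp only [mul_pow]; rw [flipCoord_sq])
      (by simp only; rw [flipCoord_of_ne hjk.ne, one_mul])
    rw [this, Complex.ofReal_one, one_mul]
  · have := thirdOrderTerm_eq_of_sign (μ := μ) (ℱ := ℱ) (d := d)
      (a := fun i => t * flipCoord j x i) (b := fun i => t * x i) (j := j) (ε := -1)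
      (fun i hi => by simp only; rw [flipCoord_of_ne hi.ne])
      (fun i _ => by simp only [mul_pow]; rw [flipCoord_sq])
      (by simp only; rw [flipCoord_self]; ring)
    rw [this, Complex.ofReal_neg, Complex.ofReal_one, neg_one_mul]

lemma continuous_vectorCharFun [IsProbabilityMeasure μ] (hd : ∀ j, Measurable (d j)) :
    Continuous (vectorCharFun μ d) := by
  unfold vectorCharFun
  refine continuous_of_dominated (bound := fun _ => (1 : ℝ))
    (fun a => Measurable.aestronglyMeasurable (by fun_prop))
    (fun a => ae_of_all _ fun ω => (Complex.norm_exp_ofReal_mul_I _).le) (integrable_const _)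
    (ae_of_all _ fun ω => by fun_prop)

lemma continuous_gaussianCharFun : Continuous (gaussianCharFun μ d) := by
  unfold gaussianCharFun
  fun_prop

/-- Comparison of the characteristic functions at low frequencies, averaged over the sphere. -/
lemma integral_norm_vectorCharFun_sub_le [IsProbabilityMeasure μ] (hν : IsSphereUniform ν)
    (hd : IsMartingaleDifference μ ℱ d) (h4 : ∀ j, MemLp (d j) 4 μ) (hn : 0 < n)
    {t : ℝ} (ht : 0 ≤ t) :
    ∫ x, ‖vectorCharFun μ d (fun i => t * x i) - (gaussianCharFun μ d (fun i => t * x i) : ℂ)‖ ∂ν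
      ≤ 9 * (t ^ 2 * gamma μ ℱ d + t ^ 3 * beta μ ℱ d + t ^ 4 * alpha μ d) / n := by
  have := hν.isProbabilityMeasure
  have hn' : (0 : ℝ) < n := by exact_mod_cast hn
  set g : Fin n → ℝ := fun j =>
    ∫ ω, |(μ[fun ω' => d j ω' ^ 2 | ℱ j.castSucc]) ω - ∫ ω', d j ω' ^ 2 ∂μ| ∂μ with hg
  have hα : 0 ≤ alpha μ d := (sq_nonneg _).trans (sq_integral_sq_le_alpha h4 ⟨0, hn⟩)
  have hc0 : Continuous fun (x : EuclideanSpace ℝ (Fin n)) (i : Fin n) => t * x i := by fun_prop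
  have hc1 : Continuous fun x : EuclideanSpace ℝ (Fin n) => ‖vectorCharFun μ d (fun i => t * x i)
      - (gaussianCharFun μ d (fun i => t * x i) : ℂ)‖ :=
    (((continuous_vectorCharFun (μ := μ) hd.measurable_ambient).comp hc0).sub
      (Complex.continuous_ofReal.comp
        ((continuous_gaussianCharFun (μ := μ) (d := d)).comp hc0))).norm
  have hc2 : Continuous fun x : EuclideanSpace ℝ (Fin n) =>
      ‖∑ j, thirdOrderTerm μ ℱ d (fun i => t * x i) j‖ :=
    (continuous_finsetSum _ fun j _ => (continuous_thirdOrderTerm hd j).comp hc0).norm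
  have hc3 : ∀ c : ℝ, ∀ j, Continuous fun x : EuclideanSpace ℝ (Fin n) =>
      t ^ 2 / 2 * g j * x j ^ 2 + c * x j ^ 4 := fun c j => by fun_prop
  have h1 : ∫ x, ‖vectorCharFun μ d (fun i => t * x i)
      - (gaussianCharFun μ d (fun i => t * x i) : ℂ)‖ ∂ν
      ≤ ∫ x, (∑ j, (t ^ 2 / 2 * g j * x j ^ 2 + t ^ 4 * alpha μ d * x j ^ 4)
        + ‖∑ j, thirdOrderTerm μ ℱ d (fun i => t * x i) j‖) ∂ν := by
    refine integral_mono (hν.integrable_of_continuous hc1) (hν.integrable_of_continuous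
      ((continuous_finsetSum _ fun j _ => hc3 _ j).add hc2)) fun x => ?_
    refine (norm_integral_phase_sub_le hd h4 (fun i => t * x i)).trans (le_of_eq ?_)
    congr 1
    refine Finset.sum_congr rfl fun j _ => ?_
    simp only [hg]
    ring
  refine h1.trans ?_
  rw [integral_add (hν.integrable_of_continuous (continuous_finsetSum _ fun j _ => hc3 _ j))
    (hν.integrable_of_continuous hc2),
    integral_finsetSum _ fun j _ => hν.integrable_of_continuous (hc3 _ j)]
  have h2 : ∀ j, ∫ x, (t ^ 2 / 2 * g j * x j ^ 2 + t ^ 4 * alpha μ d * x j ^ 4) ∂ν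
      = t ^ 2 / 2 * g j * (1 / n) + t ^ 4 * alpha μ d * (3 / (n * (n + 2))) := by
    intro j
    rw [integral_add (hν.integrable_of_continuous (by fun_prop))
      (hν.integrable_of_continuous (by fun_prop)), integral_const_mul, integral_const_mul,
      hν.integral_coord_sq, hν.integral_coord_pow_four]
  have h3 := integral_norm_sum_thirdOrderTerm_le hν hd hn ht
  simp_rw [h2]
  rw [Finset.sum_add_distrib, ← Finset.sum_mul, ← Finset.mul_sum]
  have hgam : ∑ j, g j = gamma μ ℱ d := rfl
  have hγ := gamma_nonneg (μ := μ) (ℱ := ℱ) (d := d)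
  rw [hgam]
  simp only [Finset.sum_const, Finset.card_univ, Fintype.card_fin, nsmul_eq_mul]
  have h5 : (n : ℝ) * (t ^ 4 * alpha μ d * (3 / (n * (n + 2)))) ≤ 3 * (t ^ 4 * alpha μ d / n) := by
    have : (n : ℝ) * (t ^ 4 * alpha μ d * (3 / (n * (n + 2))))
        = 3 * (t ^ 4 * alpha μ d / (n + 2)) := by field_simp
    rw [this]
    gcongr
    linarith
  have h6 : 9 * (t ^ 2 * gamma μ ℱ d + t ^ 3 * beta μ ℱ d + t ^ 4 * alpha μ d) / n
      = 9 * (t ^ 2 * gamma μ ℱ d / n) + 9 * t ^ 3 * beta μ ℱ d / n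
        + 9 * (t ^ 4 * alpha μ d / n) := by ring
  have h7 : t ^ 2 / 2 * gamma μ ℱ d * (1 / n) = 1 / 2 * (t ^ 2 * gamma μ ℱ d / n) := by ring
  have h8 : 0 ≤ t ^ 2 * gamma μ ℱ d / n := by positivity
  have h9 : 0 ≤ t ^ 4 * alpha μ d / n := by positivity
  rw [h6, h7]
  linarith

end

end RandomizedMartingale

/-! ### Decay of the averaged characteristic function -/

namespace RandomizedMartingale

variable {Ω : Type*} {mΩ : MeasurableSpace Ω} {n : ℕ} {μ : Measure Ω}
  {ℱ : Filtration (Fin (n + 1)) mΩ} {d : Fin n → Ω → ℝ}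

lemma memLp_partialSum (h4 : ∀ j, MemLp (d j) 4 μ) (y : Fin n → ℝ) (k : ℕ) :
    MemLp (partialSum d y k) 4 μ := by
  unfold partialSum
  exact memLp_finsetSum _ fun i _ => (h4 i).const_mul (y i)

lemma alpha_nonneg : 0 ≤ alpha μ d :=
  Real.iSup_nonneg fun _ => integral_nonneg fun ω => by positivity

/-- If the cross term `E (S³ e)` vanishes, adding `e` to `S` increases `√(E S⁴)` by at most a
multiple of `√(E e⁴)`, so that these bounds add up along a martingale. -/
lemma integral_add_pow_four_le [IsProbabilityMeasure μ] {S e : Ω → ℝ} (hS : MemLp S 4 μ)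
    (he : MemLp e 4 μ) (horth : ∫ ω, S ω ^ 3 * e ω ∂μ = 0) {A B : ℝ} (hA : 0 ≤ A) (hB : 0 ≤ B)
    (hSA : ∫ ω, S ω ^ 4 ∂μ ≤ A ^ 2) (heB : ∫ ω, e ω ^ 4 ∂μ ≤ B ^ 2) :
    ∫ ω, (S ω + e ω) ^ 4 ∂μ ≤ (A + 4 * B) ^ 2 := by
  have iS := integrable_pow_of_memLp_four hS (k := 4) le_rfl
  have ie := integrable_pow_of_memLp_four he (k := 4) le_rfl
  have hSm := hS.aestronglyMeasurable
  have hem := he.aestronglyMeasurable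
  have i22 : Integrable (fun ω => S ω ^ 2 * e ω ^ 2) μ := by
    refine (iS.add ie).mono' ((hSm.pow 2).mul (hem.pow 2)) (ae_of_all _ fun ω => ?_)
    rw [Real.norm_eq_abs, abs_of_nonneg (by positivity), Pi.add_apply]
    nlinarith [sq_nonneg (S ω ^ 2 - e ω ^ 2), sq_nonneg (S ω ^ 2 + e ω ^ 2)]
  have i31 : Integrable (fun ω => S ω ^ 3 * e ω) μ := by
    refine (iS.add ie).mono' ((hSm.pow 3).mul hem) (ae_of_all _ fun ω => ?_)
    rw [Real.norm_eq_abs, abs_le, Pi.add_apply]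
    constructor
    · nlinarith [sq_nonneg (S ω ^ 2 - e ω ^ 2), sq_nonneg (S ω * (S ω + e ω)),
        sq_nonneg (S ω ^ 2), sq_nonneg (e ω ^ 2)]
    · nlinarith [sq_nonneg (S ω ^ 2 - e ω ^ 2), sq_nonneg (S ω * (S ω - e ω)),
        sq_nonneg (S ω ^ 2), sq_nonneg (e ω ^ 2)]
  have h22 : ∫ ω, S ω ^ 2 * e ω ^ 2 ∂μ ≤ A * B := by
    have h1 := sq_integral_mul_le (μ := μ) (f := fun ω => S ω ^ 2) (g := fun ω => e ω ^ 2)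
      (by simpa [← pow_mul] using iS) (by simpa [← pow_mul] using ie) i22
    simp only [← pow_mul] at h1
    norm_num at h1
    have h2 : (∫ ω, S ω ^ 2 * e ω ^ 2 ∂μ) ^ 2 ≤ (A * B) ^ 2 := by
      rw [mul_pow]
      refine h1.trans (mul_le_mul hSA heB (integral_nonneg fun ω => by positivity) (by positivity))
    exact (sq_le_sq₀ (integral_nonneg fun ω => by positivity) (by positivity)).1 h2
  have i4 : Integrable (fun ω => (S ω + e ω) ^ 4) μ :=
    integrable_pow_of_memLp_four (hS.add he) (k := 4) le_rfl
  have h3 : ∫ ω, (S ω + e ω) ^ 4 ∂μ ≤ ∫ ω, (S ω ^ 4 + 4 * (S ω ^ 3 * e ω)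
      + 8 * (S ω ^ 2 * e ω ^ 2) + 3 * e ω ^ 4) ∂μ := by
    refine integral_mono i4 (((iS.add (i31.const_mul 4)).add (i22.const_mul 8)).add
      (ie.const_mul 3)) fun ω => ?_
    simp only
    nlinarith [mul_nonneg (sq_nonneg (e ω)) (sq_nonneg (S ω - e ω))]
  have j1 : Integrable (fun ω => S ω ^ 4 + 4 * (S ω ^ 3 * e ω)) μ := iS.add (i31.const_mul 4)
  have j2 : Integrable (fun ω => S ω ^ 4 + 4 * (S ω ^ 3 * e ω)
      + 8 * (S ω ^ 2 * e ω ^ 2)) μ := j1.add (i22.const_mul 8)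
  rw [integral_add j2 (ie.const_mul 3), integral_add j1 (i22.const_mul 8),
    integral_add iS (i31.const_mul 4), integral_const_mul, integral_const_mul,
    integral_const_mul, horth] at h3
  nlinarith

/-- Weighted sums of martingale differences have fourth moments of the same order as in the
independent case. -/
lemma integral_sum_pow_four_le [IsProbabilityMeasure μ] (hd : IsMartingaleDifference μ ℱ d)
    (h4 : ∀ j, MemLp (d j) 4 μ) (y : Fin n → ℝ) :
    ∫ ω, (∑ j, y j * d j ω) ^ 4 ∂μ ≤ 16 * alpha μ d * (∑ j, y j ^ 2) ^ 2 := by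
  have hα : 0 ≤ alpha μ d := alpha_nonneg
  have key : ∀ k : ℕ, k ≤ n → ∫ ω, partialSum d y k ω ^ 4 ∂μ
      ≤ (4 * √(alpha μ d) * ∑ i with i.val < k, y i ^ 2) ^ 2 := by
    intro k
    induction k with
    | zero => intro _; simp [partialSum_zero]
    | succ k ih =>
      intro hk
      let j : Fin n := ⟨k, hk⟩
      have ih' := ih (by omega)
      have e1 : ∀ ω, partialSum d y (k + 1) ω = partialSum d y k ω + y j * d j ω :=
        fun ω => partialSum_succ d y j ω
      have e2 : ∑ i : Fin n with i.val < k + 1, y i ^ 2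
          = ∑ i : Fin n with i.val < k, y i ^ 2 + y j ^ 2 :=
        sum_filter_lt_succ (fun i => y i ^ 2) j
      have hS := memLp_partialSum h4 y k
      have he := (h4 j).const_mul (y j)
      have horth : ∫ ω, partialSum d y k ω ^ 3 * (y j * d j ω) ∂μ = 0 := by
        have hm := ℱ.le' j.castSucc
        have hSm : StronglyMeasurable[ℱ j.castSucc] fun ω => partialSum d y k ω ^ 3 * y j :=
          (((hd.measurable_partialSum y j).pow_const 3).mul_const (y j)).stronglyMeasurable
        have iS := integrable_pow_of_memLp_four hS (k := 4) le_rfl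
        have ie := integrable_pow_of_memLp_four he (k := 4) le_rfl
        have hint : Integrable ((fun ω => partialSum d y k ω ^ 3 * y j) * d j) μ := by
          refine (iS.add ie).mono' (((hSm.mono hm).aestronglyMeasurable).mul
            (h4 j).aestronglyMeasurable) (ae_of_all _ fun ω => ?_)
          have : ((fun ω => partialSum d y k ω ^ 3 * y j) * d j) ω
              = partialSum d y k ω ^ 3 * (y j * d j ω) := by
            simp only [Pi.mul_apply]; ring
          rw [this, Real.norm_eq_abs, abs_le, Pi.add_apply]
          set S := partialSum d y k ω
          set e := y j * d j ω
          constructor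
          · nlinarith [sq_nonneg (S ^ 2 - e ^ 2), sq_nonneg (S * (S + e)),
              sq_nonneg (S ^ 2), sq_nonneg (e ^ 2)]
          · nlinarith [sq_nonneg (S ^ 2 - e ^ 2), sq_nonneg (S * (S - e)),
              sq_nonneg (S ^ 2), sq_nonneg (e ^ 2)]
        have h1 := condExp_mul_of_stronglyMeasurable_left hSm hint (hd.integrable j)
        have h2 : ∫ ω, partialSum d y k ω ^ 3 * (y j * d j ω) ∂μ
            = ∫ ω, ((fun ω => partialSum d y k ω ^ 3 * y j) * d j) ω ∂μ := by
          congr 1; ext ω; simp only [Pi.mul_apply]; ring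
        rw [h2, ← integral_condExp hm, integral_eq_zero_of_ae]
        filter_upwards [h1, hd.condExp_eq_zero j] with ω hω1 hω2
        rw [hω1, Pi.mul_apply, hω2]
        simp
      have heB : ∫ ω, (y j * d j ω) ^ 4 ∂μ ≤ (√(alpha μ d) * y j ^ 2) ^ 2 := by
        simp_rw [mul_pow]
        rw [integral_const_mul, Real.sq_sqrt hα]
        have := integral_pow_four_le_alpha (μ := μ) d j
        have h0 : 0 ≤ y j ^ 4 := by positivity
        nlinarith
      have := integral_add_pow_four_le hS he horth
        (mul_nonneg (by positivity) (Finset.sum_nonneg fun i _ => sq_nonneg _)) (by positivity)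
        ih' heB
      simp_rw [e1]
      rw [e2]
      refine this.trans (le_of_eq ?_)
      ring
  have h1 := key n le_rfl
  simp_rw [partialSum_last] at h1
  rw [Finset.filter_true_of_mem (fun i _ => i.2), mul_pow, mul_pow, Real.sq_sqrt hα] at h1
  linarith

lemma integral_sq_sum_sq_le [IsProbabilityMeasure μ] (h4 : ∀ j, MemLp (d j) 4 μ) :
    ∫ ω, (∑ j, d j ω ^ 2) ^ 2 ∂μ ≤ n ^ 2 * alpha μ d := by
  have h1 : ∫ ω, (∑ j, d j ω ^ 2) ^ 2 ∂μ ≤ ∫ ω, n * ∑ j, d j ω ^ 4 ∂μ := by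
    have hint : Integrable (fun ω => n * ∑ j, d j ω ^ 4) μ :=
      (integrable_finsetSum _ fun j _ =>
        integrable_pow_of_memLp_four (h4 j) (k := 4) le_rfl).const_mul _
    refine integral_mono_of_nonneg (ae_of_all _ fun ω => sq_nonneg _) hint
      (ae_of_all _ fun ω => ?_)
    have := sq_sum_le_card_mul_sum_sq (s := Finset.univ) (f := fun j => d j ω ^ 2)
    simpa [← pow_mul] using this
  refine h1.trans ?_
  rw [integral_const_mul, integral_finsetSum _ fun j _ =>
    integrable_pow_of_memLp_four (h4 j) (k := 4) le_rfl]
  have h2 := Finset.sum_le_sum (s := Finset.univ) fun j _ => integral_pow_four_le_alpha (μ := μ) d j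
  simp only [Finset.sum_const, Finset.card_univ, Fintype.card_fin, nsmul_eq_mul] at h2
  calc (n : ℝ) * ∑ j, ∫ ω, d j ω ^ 4 ∂μ ≤ n * (n * alpha μ d) := by gcongr
    _ = _ := by ring

lemma sigmaFourSq_nonneg : 0 ≤ sigmaFourSq μ d :=
  mul_nonneg (by positivity) (variance_nonneg _ _)

lemma memLp_two_sum_sq [IsProbabilityMeasure μ] (hd : ∀ j, Measurable (d j))
    (h4 : ∀ j, MemLp (d j) 4 μ) : MemLp (fun ω => ∑ j, d j ω ^ 2) 2 μ := by
  refine memLp_finsetSum _ fun j _ => ?_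
  rw [memLp_two_iff_integrable_sq (by fun_prop)]
  simpa [← pow_mul] using integrable_pow_of_memLp_four (h4 j) (k := 4) le_rfl

/-- Chebyshev's inequality: the vector `(d_1, …, d_n)` is rarely short. -/
lemma measureReal_sum_sq_le [IsProbabilityMeasure μ] (hd : ∀ j, Measurable (d j))
    (h4 : ∀ j, MemLp (d j) 4 μ) (hsum : ∑ k, ∫ ω, d k ω ^ 2 ∂μ = n) (hn : 0 < n) :
    μ.real {ω | ∑ j, d j ω ^ 2 ≤ n / 2} ≤ 4 * sigmaFourSq μ d / n := by
  have hn' : (0 : ℝ) < n := by exact_mod_cast hn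
  have hmean : ∫ ω, ∑ j, d j ω ^ 2 ∂μ = n := by
    rw [integral_finsetSum _ fun j _ => integrable_pow_of_memLp_four (h4 j) (by norm_num), hsum]
  have h1 := meas_ge_le_variance_div_sq (memLp_two_sum_sq hd h4) (c := (n : ℝ) / 2) (by positivity)
  rw [hmean] at h1
  have h2 : μ {ω | ∑ j, d j ω ^ 2 ≤ n / 2} ≤ μ {ω | (n : ℝ) / 2 ≤ |∑ j, d j ω ^ 2 - n|} := by
    refine measure_mono fun ω hω => ?_
    simp only [Set.mem_ofPred_eq] at hω ⊢
    rw [abs_of_nonpos (by linarith)]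
    linarith
  have h3 : 0 ≤ 4 * sigmaFourSq μ d / n := by
    have := sigmaFourSq_nonneg (μ := μ) (d := d)
    positivity
  refine ENNReal.toReal_le_of_le_ofReal h3 ((h2.trans h1).trans (le_of_eq ?_))
  congr 1
  rw [sigmaFourSq]
  field_simp
  norm_num

/-- Two independent copies of `(d_1, …, d_n)` are rarely close. If they are close, then both of them
are short or their inner product is large. -/
lemma measureReal_sum_sq_sub_lt [IsProbabilityMeasure μ] (hd : IsMartingaleDifference μ ℱ d)
    (h4 : ∀ j, MemLp (d j) 4 μ) (hsum : ∑ k, ∫ ω, d k ω ^ 2 ∂μ = n) (hn : 0 < n) :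
    (μ.prod μ).real {p | ∑ j, (d j p.1 - d j p.2) ^ 2 < n / 4}
      ≤ (4 * sigmaFourSq μ d / n) ^ 2 + (256 * alpha μ d / n) ^ 2 := by
  have hn' : (0 : ℝ) < n := by exact_mod_cast hn
  have hdm := hd.measurable_ambient
  set A := {ω | ∑ j, d j ω ^ 2 ≤ n / 2} with hA
  set G : Ω × Ω → ℝ := fun p => (∑ j, d j p.2 * d j p.1) ^ 4 with hG
  have hGm : Measurable G := by fun_prop
  have hinner : ∀ ω', ∫ ω, (∑ j, d j ω' * d j ω) ^ 4 ∂μ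
      ≤ 16 * alpha μ d * (∑ j, d j ω' ^ 2) ^ 2 := fun ω' =>
    integral_sum_pow_four_le hd h4 fun j => d j ω'
  have hint1 : ∀ ω', Integrable (fun ω => (∑ j, d j ω' * d j ω) ^ 4) μ := fun ω' =>
    integrable_pow_of_memLp_four (memLp_finsetSum _ fun j _ => (h4 j).const_mul _) le_rfl
  have hint2 : Integrable (fun ω' => 16 * alpha μ d * (∑ j, d j ω' ^ 2) ^ 2) μ :=
    ((memLp_two_iff_integrable_sq (by fun_prop)).1 (memLp_two_sum_sq hdm h4)).const_mul _
  have hGnorm : ∀ p, ‖G p‖ = G p := fun p => by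
    rw [Real.norm_eq_abs, abs_of_nonneg (by simp only [hG]; positivity)]
  have hGi : Integrable G (μ.prod μ) := by
    rw [integrable_prod_iff' hGm.aestronglyMeasurable]
    refine ⟨ae_of_all _ fun ω' => hint1 ω', ?_⟩
    simp_rw [hGnorm]
    refine hint2.mono' (hGm.stronglyMeasurable.integral_prod_left').aestronglyMeasurable
      (ae_of_all _ fun ω' => ?_)
    rw [Real.norm_eq_abs, abs_of_nonneg (integral_nonneg fun ω => by simp only [hG]; positivity)]
    exact hinner ω'
  have hGle : ∫ p, G p ∂(μ.prod μ) ≤ 16 * alpha μ d * (n ^ 2 * alpha μ d) := by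
    rw [integral_prod_symm _ hGi]
    refine (integral_mono hGi.integral_prod_right hint2 hinner).trans ?_
    rw [integral_const_mul]
    have := alpha_nonneg (μ := μ) (d := d)
    gcongr
    exact integral_sq_sum_sq_le h4
  have hsub : {p : Ω × Ω | ∑ j, (d j p.1 - d j p.2) ^ 2 < n / 4}
      ⊆ A ×ˢ A ∪ {p | ((n : ℝ) / 8) ^ 4 ≤ G p} := by
    intro p hp
    simp only [Set.mem_ofPred_eq] at hp
    have e1 : ∑ j, (d j p.1 - d j p.2) ^ 2
        = ∑ j, d j p.1 ^ 2 + ∑ j, d j p.2 ^ 2 - 2 * ∑ j, d j p.2 * d j p.1 := by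
      rw [Finset.mul_sum, ← Finset.sum_add_distrib, ← Finset.sum_sub_distrib]
      exact Finset.sum_congr rfl fun j _ => by ring
    have e2 : 0 ≤ ∑ j, d j p.1 ^ 2 := Finset.sum_nonneg fun j _ => sq_nonneg _
    have e3 : 0 ≤ ∑ j, d j p.2 ^ 2 := Finset.sum_nonneg fun j _ => sq_nonneg _
    by_cases h : (n : ℝ) / 8 ≤ ∑ j, d j p.2 * d j p.1
    · right
      simp only [Set.mem_ofPred_eq, hG]
      gcongr
    · left
      push Not at h
      simp only [hA, Set.mem_prod, Set.mem_ofPred_eq]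
      constructor <;> linarith
  have hmarkov := mul_meas_ge_le_integral_of_nonneg (μ := μ.prod μ) (f := G)
    (ae_of_all _ fun p => by simp only [hG]; positivity) hGi (((n : ℝ) / 8) ^ 4)
  have hA1 : μ.real A ≤ 4 * sigmaFourSq μ d / n := measureReal_sum_sq_le hdm h4 hsum hn
  refine (measureReal_mono hsub).trans ((measureReal_union_le _ _).trans (add_le_add ?_ ?_))
  · rw [measureReal_prod_prod, sq]
    exact mul_self_le_mul_self measureReal_nonneg hA1
  · have := hmarkov.trans hGle
    rw [mul_comm, ← le_div_iff₀ (by positivity)] at this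
    refine this.trans (le_of_eq ?_)
    field_simp
    ring

open ComplexConjugate in
/-- The squared modulus of the characteristic function is the characteristic function of the
difference of two independent copies of the vector; averaging over the sphere first gives the
characteristic function of the uniform law on the sphere at that difference. -/
lemma integral_norm_vectorCharFun_sq_le [IsProbabilityMeasure μ]
    {ν : Measure (EuclideanSpace ℝ (Fin n))} (hν : IsSphereUniform ν) (hd : ∀ j, Measurable (d j))
    (hn : 2 ≤ n) (t : ℝ) :
    ∫ x, ‖vectorCharFun μ d (fun i => t * x i)‖ ^ 2 ∂ν
      ≤ (μ.prod μ).real {p | ∑ j, (d j p.1 - d j p.2) ^ 2 < n / 4}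
        + (Real.exp (-(min (t ^ 2) √n / 160)) + 1024 * (16).factorial / n ^ 3) := by
  have := hν.isProbabilityMeasure
  set Jb := Real.exp (-(min (t ^ 2) √n / 160)) + 1024 * (16).factorial / n ^ 3 with hJb
  have hJb0 : 0 ≤ Jb := by positivity
  set B := {p : Ω × Ω | ∑ j, (d j p.1 - d j p.2) ^ 2 < n / 4} with hB
  have hBm : MeasurableSet B := measurableSet_lt (by fun_prop) (by fun_prop)
  let w : Ω × Ω → EuclideanSpace ℝ (Fin n) := fun p =>
    WithLp.toLp 2 fun i => t * (d i p.1 - d i p.2)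
  have hinner : ∀ p x, inner ℝ (w p) x = ∑ i, t * x i * d i p.1 - ∑ i, t * x i * d i p.2 := by
    intro p x
    rw [PiLp.inner_apply, ← Finset.sum_sub_distrib]
    refine Finset.sum_congr rfl fun i _ => ?_
    simp [w]
    ring
  have hsq : ∀ x : EuclideanSpace ℝ (Fin n),
      ((‖vectorCharFun μ d (fun i => t * x i)‖ ^ 2 : ℝ) : ℂ)
      = ∫ p, Complex.exp ((inner ℝ (w p) x : ℝ) * Complex.I) ∂(μ.prod μ) := by
    intro x
    rw [← Complex.normSq_eq_norm_sq, ← Complex.mul_conj, vectorCharFun, ← integral_conj,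
      ← integral_prod_mul]
    congr 1; ext p
    rw [hinner, ← Complex.exp_conj, ← Complex.exp_add]
    congr 1
    simp only [map_mul, Complex.conj_ofReal, Complex.conj_I]
    push_cast
    ring
  have hmeas : Measurable fun q : EuclideanSpace ℝ (Fin n) × (Ω × Ω) =>
      Complex.exp ((inner ℝ (w q.2) q.1 : ℝ) * Complex.I) := by
    simp_rw [hinner]
    fun_prop
  have hswap : ((∫ x, ‖vectorCharFun μ d (fun i => t * x i)‖ ^ 2 ∂ν : ℝ) : ℂ)
      = ∫ p, ∫ x, Complex.exp ((inner ℝ (w p) x : ℝ) * Complex.I) ∂ν ∂(μ.prod μ) := by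
    rw [← integral_complex_ofReal, integral_congr_ae (ae_of_all _ hsq), integral_integral_swap]
    exact Integrable.of_bound hmeas.aestronglyMeasurable 1
      (ae_of_all _ fun q => (Complex.norm_exp_ofReal_mul_I _).le)
  have hnn : 0 ≤ ∫ x, ‖vectorCharFun μ d (fun i => t * x i)‖ ^ 2 ∂ν :=
    integral_nonneg fun x => sq_nonneg _
  rw [← abs_of_nonneg hnn, ← Real.norm_eq_abs, ← Complex.norm_real, hswap]
  refine (norm_integral_le_of_norm_le (g := fun p => B.indicator (fun _ => (1 : ℝ)) p + Jb)
    (((integrable_const _).indicator hBm).add (integrable_const _))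
    (ae_of_all _ fun p => ?_)).trans ?_
  · by_cases hp : p ∈ B
    · rw [Set.indicator_of_mem hp]
      have : ‖∫ x, Complex.exp ((inner ℝ (w p) x : ℝ) * Complex.I) ∂ν‖ ≤ 1 := by
        refine (norm_integral_le_of_norm_le (g := fun _ => (1 : ℝ)) (integrable_const _)
          (ae_of_all _ fun x => (Complex.norm_exp_ofReal_mul_I _).le)).trans ?_
        simp
      linarith
    · rw [Set.indicator_of_notMem hp, zero_add]
      refine hν.norm_charFun_le hn ?_
      simp only [hB, Set.mem_ofPred_eq, not_lt] at hp
      rw [EuclideanSpace.real_norm_sq_eq]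
      simp only [w, mul_pow]
      rw [← Finset.mul_sum]
      nlinarith [sq_nonneg t]
  · rw [integral_add ((integrable_const _).indicator hBm) (integrable_const _),
      integral_indicator hBm]
    simp

end RandomizedMartingale

/-! ### High frequencies and integration over all frequencies -/

namespace RandomizedMartingale

open scoped ENNReal

variable {Ω : Type*} {mΩ : MeasurableSpace Ω} {n : ℕ} {μ : Measure Ω}
  {ℱ : Filtration (Fin (n + 1)) mΩ} {d : Fin n → Ω → ℝ}

/-- Where the exponent is capped at `√n`, the exponential is at most a multiple of `n^{-3/2}`. -/
lemma exp_neg_min_add_le (hn : 2 ≤ n) (t : ℝ) :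
    √(Real.exp (-(min (t ^ 2) √n / 160)) + 1024 * (16).factorial / n ^ 3)
      ≤ Real.exp (-(t ^ 2 / 320)) + 4 * 10 ^ 8 / √n ^ 3 := by
  have hn' : (0 : ℝ) < n := by exact_mod_cast (by omega : 0 < n)
  set r := √(n : ℝ) with hr
  have hr0 : 0 < r := Real.sqrt_pos.2 hn'
  have hr2 : r ^ 2 = n := Real.sq_sqrt hn'.le
  -- `196608000 = 3! * 320 ^ 3`
  have h1 : Real.exp (-(r / 320)) ≤ 196608000 / r ^ 3 := by
    have h2 := Real.pow_div_factorial_le_exp (r / 320) (by positivity) 3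
    rw [Real.exp_neg, inv_le_comm₀ (Real.exp_pos _) (by positivity), inv_div]
    refine le_trans (le_of_eq ?_) h2
    norm_num [Nat.factorial]
    ring
  have h2 : Real.exp (-(min (t ^ 2) r / 320)) ≤ Real.exp (-(t ^ 2 / 320))
      + 196608000 / r ^ 3 := by
    rcases min_choice (t ^ 2) r with h | h <;> rw [h]
    · have : 0 ≤ 196608000 / r ^ 3 := by positivity
      linarith
    · linarith [Real.exp_pos (-(t ^ 2 / 320))]
  have h3 : √(Real.exp (-(min (t ^ 2) r / 160)) + 1024 * (16).factorial / n ^ 3)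
      ≤ Real.exp (-(min (t ^ 2) r / 320)) + 16 * 10 ^ 7 / r ^ 3 := by
    refine Real.sqrt_le_iff.2 ⟨by positivity, ?_⟩
    have e1 : Real.exp (-(min (t ^ 2) r / 160)) = Real.exp (-(min (t ^ 2) r / 320)) ^ 2 := by
      rw [← Real.exp_nat_mul]; congr 1; push_cast; ring
    have e2 : 1024 * ((16).factorial : ℝ) / n ^ 3 ≤ (16 * 10 ^ 7 / r ^ 3) ^ 2 := by
      rw [div_pow, ← pow_mul, show 3 * 2 = 2 * 3 by norm_num, pow_mul, hr2]
      gcongr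
      norm_num [Nat.factorial]
    have e3 : 0 ≤ Real.exp (-(min (t ^ 2) r / 320)) * (16 * 10 ^ 7 / r ^ 3) := by positivity
    rw [e1, add_sq]
    linarith
  have h4 : 4 * 10 ^ 8 / r ^ 3 - 196608000 / r ^ 3 - 16 * 10 ^ 7 / r ^ 3 = 43392000 / r ^ 3 := by
    ring
  have h5 : 0 ≤ 43392000 / r ^ 3 := by positivity
  linarith

/-- At high frequencies both characteristic functions are small on average over the sphere. -/
lemma integral_norm_vectorCharFun_sub_le_add_exp [IsProbabilityMeasure μ]
    {ν : Measure (EuclideanSpace ℝ (Fin n))} (hν : IsSphereUniform ν)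
    (hd : IsMartingaleDifference μ ℱ d) (h4 : ∀ j, MemLp (d j) 4 μ)
    (hsum : ∑ k, ∫ ω, d k ω ^ 2 ∂μ = n) (hn : 2 ≤ n) (t : ℝ) :
    ∫ x, ‖vectorCharFun μ d (fun i => t * x i) - (gaussianCharFun μ d (fun i => t * x i) : ℂ)‖ ∂ν
      ≤ (4 * sigmaFourSq μ d + 264 * alpha μ d) / n + 4 * 10 ^ 8 / √n ^ 3
        + 2 * Real.exp (-(t ^ 2 / 320)) := by
  have := hν.isProbabilityMeasure
  have hn' : (0 : ℝ) < n := by exact_mod_cast (by omega : 0 < n)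
  have hα := alpha_nonneg (μ := μ) (d := d)
  have hσ := sigmaFourSq_nonneg (μ := μ) (d := d)
  have hc0 : Continuous fun (x : EuclideanSpace ℝ (Fin n)) (i : Fin n) => t * x i := by fun_prop
  have hc1 : Continuous fun x : EuclideanSpace ℝ (Fin n) => vectorCharFun μ d (fun i => t * x i) :=
    (continuous_vectorCharFun (μ := μ) hd.measurable_ambient).comp hc0
  have hc2 : Continuous fun x : EuclideanSpace ℝ (Fin n) =>
      gaussianCharFun μ d (fun i => t * x i) :=
    (continuous_gaussianCharFun (μ := μ) (d := d)).comp hc0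
  have hf : ∫ x, ‖vectorCharFun μ d (fun i => t * x i)‖ ∂ν ≤ 4 * sigmaFourSq μ d / n
      + 256 * alpha μ d / n + (Real.exp (-(t ^ 2 / 320)) + 4 * 10 ^ 8 / √n ^ 3) := by
    refine (integral_le_sqrt_integral_sq (hν.integrable_of_continuous hc1.norm)
      (hν.integrable_of_continuous (hc1.norm.pow 2))).trans ?_
    set Jb := Real.exp (-(min (t ^ 2) √n / 160)) + 1024 * (16).factorial / n ^ 3 with hJb
    have hJb0 : 0 ≤ Jb := by positivity
    set p := 4 * sigmaFourSq μ d / n with hp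
    set q := 256 * alpha μ d / n with hq
    have hp0 : 0 ≤ p := by positivity
    have hq0 : 0 ≤ q := by positivity
    have h1 := integral_norm_vectorCharFun_sq_le (μ := μ) (d := d) hν hd.measurable_ambient hn t
    have h2 := measureReal_sum_sq_sub_lt (μ := μ) (d := d) hd h4 hsum (by omega)
    have h3 : √(∫ x, ‖vectorCharFun μ d (fun i => t * x i)‖ ^ 2 ∂ν) ≤ p + q + √Jb := by
      refine Real.sqrt_le_iff.2 ⟨by positivity, ?_⟩
      have e1 : √Jb ^ 2 = Jb := Real.sq_sqrt hJb0
      have e2 : 0 ≤ p * q + p * √Jb + q * √Jb := by positivity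
      nlinarith
    have h5 : √Jb ≤ _ := exp_neg_min_add_le hn t
    linarith
  have hg : ∫ x, gaussianCharFun μ d (fun i => t * x i) ∂ν
      ≤ 8 * alpha μ d / n + Real.exp (-(t ^ 2 / 320)) := by
    set s : Fin n → ℝ := fun i => ∫ ω, d i ω ^ 2 ∂μ with hs
    have hs0 : ∀ i, 0 ≤ s i := fun i => integral_nonneg fun ω => sq_nonneg _
    set B := {x : EuclideanSpace ℝ (Fin n) | ∑ i, s i * x i ^ 2 ≤ 1 / 2} with hB
    have hBm : MeasurableSet B := measurableSet_le (by fun_prop) (by fun_prop)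
    have hB1 := hν.measure_weighted_sum_le hsum (fun i => sq_integral_sq_le_alpha h4 i)
      (by omega)
    have hle : ∀ x : EuclideanSpace ℝ (Fin n), gaussianCharFun μ d (fun i => t * x i)
        ≤ B.indicator (fun _ => (1 : ℝ)) x + Real.exp (-(t ^ 2 / 320)) := by
      intro x
      have e1 : gaussianCharFun μ d (fun i => t * x i)
          = Real.exp (-(t ^ 2 * (∑ i, s i * x i ^ 2) / 2)) := by
        rw [gaussianCharFun, Finset.mul_sum]
        congr 3
        exact Finset.sum_congr rfl fun i _ => by simp only [hs]; ring
      rw [e1]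
      by_cases hx : x ∈ B
      · rw [Set.indicator_of_mem hx]
        have : Real.exp (-(t ^ 2 * (∑ i, s i * x i ^ 2) / 2)) ≤ 1 := by
          rw [Real.exp_le_one_iff, neg_nonpos]
          have := Finset.sum_nonneg fun i (_ : i ∈ Finset.univ) =>
            mul_nonneg (hs0 i) (sq_nonneg (x i))
          positivity
        linarith [Real.exp_pos (-(t ^ 2 / 320))]
      · rw [Set.indicator_of_notMem hx, zero_add]
        simp only [hB, Set.mem_ofPred_eq, not_le] at hx
        apply Real.exp_le_exp.2
        nlinarith [sq_nonneg t]
    refine (integral_mono (hν.integrable_of_continuous hc2)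
      (((integrable_const _).indicator hBm).add (integrable_const _)) hle).trans ?_
    simp only [Pi.add_apply]
    rw [integral_add ((integrable_const _).indicator hBm) (integrable_const _),
      integral_indicator hBm]
    simp only [integral_const, probReal_univ, smul_eq_mul, one_mul, mul_one,
      measureReal_restrict_apply MeasurableSet.univ, Set.univ_inter]
    exact add_le_add hB1 le_rfl
  have hle : ∫ x, ‖vectorCharFun μ d (fun i => t * x i)
      - (gaussianCharFun μ d (fun i => t * x i) : ℂ)‖ ∂ν
      ≤ ∫ x, (‖vectorCharFun μ d (fun i => t * x i)‖
        + gaussianCharFun μ d (fun i => t * x i)) ∂ν := by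
    refine integral_mono (hν.integrable_of_continuous
      (hc1.sub (Complex.continuous_ofReal.comp hc2)).norm)
      (hν.integrable_of_continuous (hc1.norm.add hc2)) fun x => ?_
    refine (norm_sub_le _ _).trans (le_of_eq ?_)
    rw [Complex.norm_real, Real.norm_eq_abs, gaussianCharFun, Real.abs_exp]
  rw [integral_add (hν.integrable_of_continuous hc1.norm) (hν.integrable_of_continuous hc2)] at hle
  have e : (4 * sigmaFourSq μ d + 264 * alpha μ d) / n = 4 * sigmaFourSq μ d / n
      + 256 * alpha μ d / n + 8 * alpha μ d / n := by ring
  rw [e]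
  linarith

lemma lintegral_Ioi_inv_cube {c : ℝ} (hc : 0 < c) :
    ∫⁻ t in Set.Ioi c, ENNReal.ofReal (1 / t ^ 3) = ENNReal.ofReal (1 / (2 * c ^ 2)) := by
  have h1 : ∫⁻ t in Set.Ioi c, ENNReal.ofReal (1 / t ^ 3)
      = ∫⁻ t in Set.Ioi c, ENNReal.ofReal (t ^ (-3 : ℝ)) := by
    refine setLIntegral_congr_fun measurableSet_Ioi fun t ht => ?_
    have ht0 : 0 < t := hc.trans ht
    rw [Real.rpow_neg ht0.le, one_div, show (3 : ℝ) = (3 : ℕ) by norm_num, Real.rpow_natCast]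
  have h2 : 0 ≤ᵐ[volume.restrict (Set.Ioi c)] fun t : ℝ => t ^ (-3 : ℝ) := by
    filter_upwards [ae_restrict_mem measurableSet_Ioi] with t ht
    exact Real.rpow_nonneg (hc.trans ht).le _
  rw [h1, ← ofReal_integral_eq_lintegral_ofReal
    (integrableOn_Ioi_rpow_of_lt (by norm_num) hc) h2, integral_Ioi_rpow_of_lt (by norm_num) hc]
  congr 1
  rw [show (-3 : ℝ) + 1 = -2 by norm_num, Real.rpow_neg hc.le, Real.rpow_two]
  field_simp

/-- The Gaussian weight at scale `n` cuts the logarithmic integral `∫ dt / t` off at `n`. -/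
lemma lintegral_Ioi_exp_div_le {N : ℝ} (hN : 1 ≤ N) :
    ∫⁻ t in Set.Ioi (1 : ℝ), ENNReal.ofReal (Real.exp (-((1 / N) ^ 2 * t ^ 2 / 2)) / t)
      ≤ ENNReal.ofReal (Real.log N + 1) := by
  have hN0 : 0 < N := by linarith
  rw [← Set.Ioc_union_Ioi_eq_Ioi hN, lintegral_union measurableSet_Ioi
    (Set.Ioc_disjoint_Ioi le_rfl), ENNReal.ofReal_add (Real.log_nonneg hN) (by norm_num)]
  gcongr
  · have h1 : ∫⁻ t in Set.Ioc 1 N, ENNReal.ofReal (Real.exp (-((1 / N) ^ 2 * t ^ 2 / 2)) / t)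
        ≤ ∫⁻ t in Set.Ioc 1 N, ENNReal.ofReal (t⁻¹) := by
      refine setLIntegral_mono' measurableSet_Ioc fun t ht => ?_
      have ht0 : 0 < t := by linarith [ht.1]
      rw [← one_div]
      gcongr
      rw [Real.exp_le_one_iff, neg_nonpos]
      positivity
    refine h1.trans (le_of_eq ?_)
    have hint : IntegrableOn (fun t : ℝ => t⁻¹) (Set.Ioc 1 N) := by
      rw [← intervalIntegrable_iff_integrableOn_Ioc_of_le hN]
      exact intervalIntegral.intervalIntegrable_inv (fun t ht => by
        rw [Set.uIcc_of_le hN] at ht; linarith [ht.1]) continuousOn_id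
    rw [← ofReal_integral_eq_lintegral_ofReal hint, ← intervalIntegral.integral_of_le hN,
      integral_inv_of_pos (by norm_num) hN0, div_one]
    filter_upwards [ae_restrict_mem measurableSet_Ioc] with t ht
    exact inv_nonneg.2 (by linarith [ht.1])
  · have h1 : ∫⁻ t in Set.Ioi N, ENNReal.ofReal (Real.exp (-((1 / N) ^ 2 * t ^ 2 / 2)) / t)
        ≤ ∫⁻ t in Set.Ioi N, ENNReal.ofReal (2 * N ^ 2) * ENNReal.ofReal (1 / t ^ 3) := by
      refine setLIntegral_mono' measurableSet_Ioi fun t ht => ?_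
      have ht0 : 0 < t := by linarith [Set.mem_Ioi.1 ht]
      rw [← ENNReal.ofReal_mul (by positivity)]
      apply ENNReal.ofReal_le_ofReal
      have h2 := Real.add_one_le_exp ((1 / N) ^ 2 * t ^ 2 / 2)
      have h3 : Real.exp (-((1 / N) ^ 2 * t ^ 2 / 2)) ≤ 1 / ((1 / N) ^ 2 * t ^ 2 / 2) := by
        rw [Real.exp_neg, ← one_div]
        apply one_div_le_one_div_of_le (by positivity)
        linarith
      calc Real.exp (-((1 / N) ^ 2 * t ^ 2 / 2)) / t ≤ 1 / ((1 / N) ^ 2 * t ^ 2 / 2) / t := by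
            gcongr
        _ = _ := by field_simp
    refine h1.trans (le_of_eq ?_)
    rw [lintegral_const_mul' _ _ ENNReal.ofReal_ne_top, lintegral_Ioi_inv_cube hN0,
      ← ENNReal.ofReal_mul (by positivity)]
    congr 1
    field_simp

/-- Integration of the bounds for low and high frequencies, which are separated at `√(640 log n)`.
Beyond this point the factor `exp (-t² / 320)` is the product of `exp (-t² / 640) ≤ 1 / n` and a
factor that makes the integral converge. -/
lemma lintegral_exp_div_mul_le (hn : 2 ≤ n) {α β γ σ v : ℝ} (hα : 1 ≤ α) (hβ : 0 ≤ β)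
    (hγ : 0 ≤ γ) (hσ : 0 ≤ σ)
    (hv : v = γ * Real.log n + β * Real.log n ^ (3 / 2 : ℝ) + α * Real.log n ^ 2
      + σ * Real.log n) {h : ℝ → ℝ}
    (hlow : ∀ t, 0 ≤ t → h t ≤ 9 * (t ^ 2 * γ + t ^ 3 * β + t ^ 4 * α) / n)
    (hhigh : ∀ t, h t ≤ (4 * σ + 264 * α) / n + 4 * 10 ^ 8 / √n ^ 3
        + 2 * Real.exp (-(t ^ 2 / 320))) :
    ∫⁻ t in Set.Ioi (0 : ℝ), ENNReal.ofReal (Real.exp (-((1 / n : ℝ) ^ 2 * t ^ 2 / 2)) / t * h t)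
      ≤ ENNReal.ofReal (10 ^ 9 * ((1 + v) / n)) := by
  have hn2 : (2 : ℝ) ≤ n := by exact_mod_cast hn
  have hn' : (0 : ℝ) < n := by linarith
  set l := Real.log n with hl
  have hl1 : 1 / 2 ≤ l := by
    have h1 := Real.log_two_gt_d9
    have h2 : Real.log 2 ≤ l := Real.log_le_log (by norm_num) hn2
    linarith
  have hl0 : 0 ≤ l := by linarith
  set T := √(640 * l) with hT
  have hT2 : T ^ 2 = 640 * l := Real.sq_sqrt (by positivity)
  have hT1 : 1 ≤ T := by rw [hT, Real.one_le_sqrt]; linarith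
  have hT0 : 0 ≤ T := by linarith
  have hl32 : l ^ (3 / 2 : ℝ) = l * √l := by
    rw [show (3 / 2 : ℝ) = 1 + 1 / 2 by norm_num, Real.rpow_add (by linarith), Real.rpow_one,
      ← Real.sqrt_eq_rpow]
  have hT3 : T ^ 3 ≤ 16640 * l ^ (3 / 2 : ℝ) := by
    have h1 : T ≤ 26 * √l := by
      rw [hT, Real.sqrt_mul (by norm_num)]
      gcongr
      rw [Real.sqrt_le_iff]
      norm_num
    rw [hl32, pow_succ, hT2]
    nlinarith
  have hT4 : T ^ 4 = 409600 * l ^ 2 := by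
    rw [show T ^ 4 = (T ^ 2) ^ 2 by ring, hT2]; ring
  have hexpT : Real.exp (-(T ^ 2 / 640)) = 1 / n := by
    rw [hT2, show 640 * l / 640 = l by ring, Real.exp_neg, hl, Real.exp_log hn', one_div]
  set L := 9 * (T * γ + T ^ 2 * β + T ^ 3 * α) / n with hL
  set A := (4 * σ + 264 * α) / n + 4 * 10 ^ 8 / √n ^ 3 with hA
  have hA0 : 0 ≤ A := by positivity
  have hlow' : ∫⁻ t in Set.Ioc 0 T, ENNReal.ofReal
      (Real.exp (-((1 / n : ℝ) ^ 2 * t ^ 2 / 2)) / t * h t) ≤ ENNReal.ofReal (L * T) := by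
    have h1 : ∫⁻ t in Set.Ioc 0 T, ENNReal.ofReal
        (Real.exp (-((1 / n : ℝ) ^ 2 * t ^ 2 / 2)) / t * h t)
        ≤ ∫⁻ t in Set.Ioc 0 T, ENNReal.ofReal L := by
      refine setLIntegral_mono' measurableSet_Ioc fun t ht => ENNReal.ofReal_le_ofReal ?_
      obtain ⟨ht0, htT⟩ := ht
      have e1 : Real.exp (-((1 / n : ℝ) ^ 2 * t ^ 2 / 2)) ≤ 1 := by
        rw [Real.exp_le_one_iff, neg_nonpos]; positivity
      calc Real.exp (-((1 / n : ℝ) ^ 2 * t ^ 2 / 2)) / t * h t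
          ≤ Real.exp (-((1 / n : ℝ) ^ 2 * t ^ 2 / 2)) / t
            * (9 * (t ^ 2 * γ + t ^ 3 * β + t ^ 4 * α) / n) := by
            gcongr; exact hlow t ht0.le
        _ ≤ 1 / t * (9 * (t ^ 2 * γ + t ^ 3 * β + t ^ 4 * α) / n) := by gcongr
        _ = 9 * (t * γ + t ^ 2 * β + t ^ 3 * α) / n := by field_simp
        _ ≤ L := by rw [hL]; gcongr
    refine h1.trans (le_of_eq ?_)
    rw [setLIntegral_const, Real.volume_Ioc, sub_zero, ← ENNReal.ofReal_mul (by positivity)]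
  have hhigh' : ∫⁻ t in Set.Ioi T, ENNReal.ofReal
      (Real.exp (-((1 / n : ℝ) ^ 2 * t ^ 2 / 2)) / t * h t)
      ≤ ENNReal.ofReal (A * (l + 1) + 640 / n) := by
    have h1 : ∫⁻ t in Set.Ioi T, ENNReal.ofReal
        (Real.exp (-((1 / n : ℝ) ^ 2 * t ^ 2 / 2)) / t * h t)
        ≤ ∫⁻ t in Set.Ioi T, (ENNReal.ofReal A * ENNReal.ofReal
          (Real.exp (-((1 / n : ℝ) ^ 2 * t ^ 2 / 2)) / t)
          + ENNReal.ofReal (1280 / n) * ENNReal.ofReal (1 / t ^ 3)) := by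
      refine setLIntegral_mono' measurableSet_Ioi fun t ht => ?_
      have htT : T < t := ht
      have ht0 : 0 < t := by linarith
      rw [← ENNReal.ofReal_mul hA0, ← ENNReal.ofReal_mul (by positivity),
        ← ENNReal.ofReal_add (by positivity) (by positivity)]
      apply ENNReal.ofReal_le_ofReal
      set E := Real.exp (-((1 / n : ℝ) ^ 2 * t ^ 2 / 2)) with hE
      have e1 : E ≤ 1 := by
        rw [hE, Real.exp_le_one_iff, neg_nonpos]; positivity
      have e0 : 0 < E := Real.exp_pos _
      have e2 : Real.exp (-(t ^ 2 / 320)) ≤ 1 / n * (640 / t ^ 2) := by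
        have e3 : Real.exp (-(t ^ 2 / 320))
            = Real.exp (-(t ^ 2 / 640)) * Real.exp (-(t ^ 2 / 640)) := by
          rw [← Real.exp_add]; congr 1; ring
        have e4 : Real.exp (-(t ^ 2 / 640)) ≤ 1 / n := by
          rw [← hexpT]
          apply Real.exp_le_exp.2
          have : T ^ 2 ≤ t ^ 2 := by gcongr
          linarith
        have e5 : Real.exp (-(t ^ 2 / 640)) ≤ 640 / t ^ 2 := by
          have e6 := Real.add_one_le_exp (t ^ 2 / 640)
          rw [Real.exp_neg, inv_le_comm₀ (Real.exp_pos _) (by positivity), inv_div]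
          linarith
        rw [e3]
        gcongr
      calc E / t * h t ≤ E / t * (A + 2 * Real.exp (-(t ^ 2 / 320))) := by
            gcongr; exact hhigh t
        _ = A * (E / t) + E * (2 * Real.exp (-(t ^ 2 / 320)) / t) := by ring
        _ ≤ A * (E / t) + 1 * (2 * (1 / n * (640 / t ^ 2)) / t) := by gcongr
        _ = _ := by field_simp; norm_num
    refine h1.trans ?_
    have h2 : Set.Ioi T ⊆ Set.Ioi 1 := Set.Ioi_subset_Ioi hT1
    refine (lintegral_mono_set h2).trans ?_
    rw [lintegral_add_right _ (by fun_prop), lintegral_const_mul' _ _ ENNReal.ofReal_ne_top,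
      lintegral_const_mul' _ _ ENNReal.ofReal_ne_top, lintegral_Ioi_inv_cube one_pos,
      ENNReal.ofReal_add (p := A * (l + 1)) (q := 640 / n) (by positivity) (by positivity),
      ENNReal.ofReal_mul (p := A) hA0]
    gcongr
    · exact lintegral_Ioi_exp_div_le (by linarith)
    · rw [← ENNReal.ofReal_mul (by positivity)]
      apply ENNReal.ofReal_le_ofReal
      apply le_of_eq
      ring
  rw [← Set.Ioc_union_Ioi_eq_Ioi hT0, lintegral_union measurableSet_Ioi
    (Set.Ioc_disjoint_Ioi le_rfl)]
  refine (add_le_add hlow' hhigh').trans ?_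
  rw [← ENNReal.ofReal_add (by positivity) (by positivity)]
  apply ENNReal.ofReal_le_ofReal
  have hlow_fin : L * T ≤ 3686400 * (v / n) := by
    have e1 : L * T = 9 * (T ^ 2 * γ + T ^ 3 * β + T ^ 4 * α) / n := by rw [hL]; ring
    rw [e1, hT4, hT2, ← mul_div_assoc]
    refine div_le_div_of_nonneg_right ?_ hn'.le
    have e2 : T ^ 3 * β ≤ 16640 * l ^ (3 / 2 : ℝ) * β := by gcongr
    have e3 : 0 ≤ β * l ^ (3 / 2 : ℝ) := by positivity
    have e4 : 0 ≤ γ * l := by positivity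
    have e5 : 0 ≤ σ * l := by positivity
    rw [hv]
    linarith
  have hA_fin : A * (l + 1) ≤ 1584 * (v / n) + 8 * 10 ^ 8 / n := by
    have e1 : (4 * σ + 264 * α) / n * (l + 1) ≤ 1584 * (v / n) := by
      rw [div_mul_eq_mul_div, ← mul_div_assoc]
      refine div_le_div_of_nonneg_right ?_ hn'.le
      have e3 : 0 ≤ β * l ^ (3 / 2 : ℝ) := by positivity
      have e4 : 0 ≤ γ * l := by positivity
      have e5 : (4 * σ + 264 * α) * (l + 1) ≤ (4 * σ + 264 * α) * (3 * l) := by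
        gcongr; linarith
      have e6 : α * l ≤ 2 * (α * l ^ 2) := by
        have : 0 ≤ α * l := by positivity
        nlinarith
      have e7 : 0 ≤ σ * l := by positivity
      rw [hv]
      linarith
    have e2 : 4 * 10 ^ 8 / √n ^ 3 * (l + 1) ≤ 8 * 10 ^ 8 / n := by
      have hr0 : 0 < √(n : ℝ) := Real.sqrt_pos.2 hn'
      have hr2 : √(n : ℝ) ^ 2 = n := Real.sq_sqrt hn'.le
      have e3 : l + 1 ≤ 2 * √n := by
        have h1 := Real.log_le_sub_one_of_pos hr0
        have h2 : l = 2 * Real.log √n := by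
          rw [Real.log_sqrt hn'.le, hl]; ring
        linarith
      calc 4 * 10 ^ 8 / √n ^ 3 * (l + 1) ≤ 4 * 10 ^ 8 / √n ^ 3 * (2 * √n) := by gcongr
        _ = 8 * 10 ^ 8 / √n ^ 2 := by field_simp; norm_num
        _ = _ := by rw [hr2]
    rw [hA, add_mul]
    linarith
  have hv0 : 0 ≤ v / n := by
    rw [hv]; positivity
  have e1 : 10 ^ 9 * ((1 + v) / n) = 10 ^ 9 / n + 10 ^ 9 * (v / n) := by ring
  have e2 : (8 : ℝ) * 10 ^ 8 / n + 640 / n ≤ 10 ^ 9 / n := by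
    rw [← add_div]; gcongr; norm_num
  rw [e1]
  linarith

end RandomizedMartingale

/-! ### The conditional law given the sphere, and conclusion -/

namespace RandomizedMartingale

open scoped NNReal ENNReal

/-- Given `X`, a function of `(X, Y)` with `Y` independent of `X` is distributed as that function
with the first argument frozen. -/
lemma condDistrib_ae_eq_map_of_indepFun {Ω β γ : Type*} {mΩ : MeasurableSpace Ω}
    {mβ : MeasurableSpace β} {mγ : MeasurableSpace γ} {μ : Measure Ω} [IsProbabilityMeasure μ]
    {X : Ω → β} {Y : Ω → γ} (hX : Measurable X) (hY : Measurable Y) (hXY : IndepFun X Y μ)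
    {f : β × γ → ℝ} (hf : Measurable f) :
    ∀ᵐ x ∂(μ.map X), condDistrib (fun ω => f (X ω, Y ω)) X μ x = μ.map (fun ω => f (x, Y ω)) := by
  have := Measure.isProbabilityMeasure_map (μ := μ) hX.aemeasurable
  have := Measure.isProbabilityMeasure_map (μ := μ) hY.aemeasurable
  have hfm : ∀ x, Measurable fun y => f (x, y) := fun x => hf.comp measurable_prodMk_left
  let K : Kernel β ℝ := (Kernel.id ×ₖ Kernel.const β (μ.map Y)).map f
  have hK : ∀ x, K x = μ.map (fun ω => f (x, Y ω)) := by
    intro x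
    simp only [K]
    rw [Kernel.map_apply _ hf, Kernel.prod_apply, Kernel.id_apply, Kernel.const_apply,
      Measure.dirac_prod, Measure.map_map hf measurable_prodMk_left,
      Measure.map_map (hf.comp measurable_prodMk_left) hY]
    rfl
  have : IsMarkovKernel K := Kernel.IsMarkovKernel.map _ hf
  have hmap : μ.map (fun ω => (X ω, f (X ω, Y ω))) = μ.map X ⊗ₘ K := by
    ext s hs
    have h1 : Measurable fun p : β × γ => (p.1, f p) := measurable_fst.prodMk hf
    have h2 : μ.map (fun ω => (X ω, f (X ω, Y ω)))
        = ((μ.map X).prod (μ.map Y)).map (fun p => (p.1, f p)) := by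
      rw [← (indepFun_iff_map_prod_eq_prod_map_map hX.aemeasurable hY.aemeasurable).1 hXY,
        Measure.map_map h1 (hX.prodMk hY)]
      rfl
    rw [h2, Measure.map_apply h1 hs, Measure.prod_apply (h1 hs), Measure.compProd_apply hs]
    refine lintegral_congr fun x => ?_
    have hfx : Measurable fun ω => f (x, Y ω) := (hfm x).comp hY
    rw [hK, Measure.map_apply hfx (measurable_prodMk_left hs),
      Measure.map_apply hY (measurable_prodMk_left (h1 hs))]
    rfl
  filter_upwards [condDistrib_ae_eq_of_measure_eq_compProd X
    (hf.comp (hX.prodMk hY)).aemeasurable hmap] with x hx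
  rw [← hK, ← hx]
  rfl

/-- By right continuity of distribution functions, rational thresholds suffice. -/
lemma kolmogorovDist_eq_iSup_rat (P Q : Measure ℝ) [IsProbabilityMeasure P]
    [IsProbabilityMeasure Q] :
    kolmogorovDist P Q = ⨆ q : ℚ, |P.real (Set.Iic (q : ℝ)) - Q.real (Set.Iic (q : ℝ))| := by
  have hbdd : BddAbove (Set.range fun q : ℚ =>
      |P.real (Set.Iic (q : ℝ)) - Q.real (Set.Iic (q : ℝ))|) :=
    (bddAbove_abs_measureReal_sub P Q).mono (by rintro _ ⟨q, rfl⟩; exact ⟨(q : ℝ), rfl⟩)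
  refine le_antisymm (ciSup_le fun t => ?_) (ciSup_le fun q => abs_le_kolmogorovDist P Q q)
  obtain ⟨u, -, hut, hu⟩ := Real.exists_seq_rat_strictAnti_tendsto t
  have hu' : Filter.Tendsto (fun k => (u k : ℝ)) Filter.atTop (nhdsWithin t (Set.Ici t)) :=
    tendsto_nhdsWithin_iff.2 ⟨hu, Filter.Eventually.of_forall fun k => (hut k).le⟩
  have hlim : ∀ (R' : Measure ℝ) [IsProbabilityMeasure R'], Filter.Tendsto
      (fun k => R'.real (Set.Iic (u k : ℝ))) Filter.atTop (nhds (R'.real (Set.Iic t))) := by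
    intro R' _
    simp only [← cdf_eq_real]
    exact ((cdf R').right_continuous t).tendsto.comp hu'
  exact le_of_tendsto ((hlim P).sub (hlim Q)).abs
    (Filter.Eventually.of_forall fun k => le_ciSup hbdd (u k))

lemma measurable_kolmogorovDist {β : Type*} {mβ : MeasurableSpace β} {P Q : β → Measure ℝ}
    [∀ b, IsProbabilityMeasure (P b)] [∀ b, IsProbabilityMeasure (Q b)]
    (hP : ∀ q : ℝ, Measurable fun b => (P b).real (Set.Iic q))
    (hQ : ∀ q : ℝ, Measurable fun b => (Q b).real (Set.Iic q)) :
    Measurable fun b => kolmogorovDist (P b) (Q b) := by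
  simp only [kolmogorovDist_eq_iSup_rat]
  exact Measurable.iSup fun q => continuous_abs.measurable.comp ((hP q).sub (hQ q))

lemma measurable_map_real_Iic {β γ : Type*} {mβ : MeasurableSpace β} {mγ : MeasurableSpace γ}
    (ρ : Measure γ) [IsProbabilityMeasure ρ] {f : β × γ → ℝ} (hf : Measurable f) (q : ℝ) :
    Measurable fun b => (ρ.map fun y => f (b, y)).real (Set.Iic q) := by
  have h : ∀ b, (ρ.map fun y => f (b, y)).real (Set.Iic q)
      = (ρ (Prod.mk b ⁻¹' (f ⁻¹' Set.Iic q))).toReal := by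
    intro b
    have hfb : Measurable fun y => f (b, y) := hf.comp measurable_prodMk_left
    rw [measureReal_def, Measure.map_apply hfb measurableSet_Iic]
    rfl
  simp only [h]
  exact (measurable_measure_prodMk_left (hf measurableSet_Iic)).ennreal_toReal

lemma gaussianReal_zero_eq_map (v : ℝ≥0) :
    gaussianReal 0 v = (gaussianReal 0 1).map fun y => √(v : ℝ) * y := by
  rw [gaussianReal_map_const_mul, mul_zero, mul_one]
  congr 1
  ext
  exact (Real.sq_sqrt v.2).symm

variable {Ω : Type*} {mΩ : MeasurableSpace Ω} {n : ℕ} {μ : Measure Ω}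
  {ℱ : Filtration (Fin (n + 1)) mΩ} {d : Fin n → Ω → ℝ}

/-- The law of the linear combination `∑ a_j d_j` with deterministic coefficients. -/
def weightedLaw (μ : Measure Ω) (d : Fin n → Ω → ℝ) (a : Fin n → ℝ) : Measure ℝ :=
  μ.map fun ω => ∑ j, a j * d j ω

/-- The centered normal law with the variance `∑ a_j² E(d_j²)` of the linear combination. -/
def weightedGaussian (μ : Measure Ω) (d : Fin n → Ω → ℝ) (a : Fin n → ℝ) : Measure ℝ :=
  gaussianReal 0 (Real.toNNReal (∑ i, a i ^ 2 * ∫ ω, d i ω ^ 2 ∂μ))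

instance (a : Fin n → ℝ) : IsProbabilityMeasure (weightedGaussian μ d a) := by
  unfold weightedGaussian; infer_instance

lemma measurable_weighted_sum (hd : ∀ j, Measurable (d j)) (a : Fin n → ℝ) :
    Measurable fun ω => ∑ j, a j * d j ω :=
  Finset.measurable_fun_sum _ fun j _ => (hd j).const_mul _

lemma isProbabilityMeasure_weightedLaw [IsProbabilityMeasure μ] (hd : ∀ j, Measurable (d j))
    (a : Fin n → ℝ) : IsProbabilityMeasure (weightedLaw μ d a) :=
  Measure.isProbabilityMeasure_map (measurable_weighted_sum hd a).aemeasurable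

lemma charFun_weightedLaw (hd : ∀ j, Measurable (d j)) (a : Fin n → ℝ) (t : ℝ) :
    charFun (weightedLaw μ d a) t = vectorCharFun μ d fun i => t * a i := by
  rw [charFun_apply_real, weightedLaw, integral_map (measurable_weighted_sum hd a).aemeasurable
    (by fun_prop), vectorCharFun]
  refine integral_congr_ae (ae_of_all _ fun ω => ?_)
  simp only [← Complex.ofReal_mul, Finset.mul_sum, mul_assoc]

lemma charFun_weightedGaussian (a : Fin n → ℝ) (t : ℝ) :
    charFun (weightedGaussian μ d a) t = (gaussianCharFun μ d fun i => t * a i : ℝ) := by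
  have h0 : 0 ≤ ∑ i, a i ^ 2 * ∫ ω, d i ω ^ 2 ∂μ := Finset.sum_nonneg fun i _ =>
    mul_nonneg (sq_nonneg _) (integral_nonneg fun ω => sq_nonneg _)
  have e : ∑ i, (t * a i) ^ 2 * ∫ ω, d i ω ^ 2 ∂μ
      = (∑ i, a i ^ 2 * ∫ ω, d i ω ^ 2 ∂μ) * t ^ 2 := by
    rw [Finset.sum_mul]
    exact Finset.sum_congr rfl fun i _ => by ring
  rw [weightedGaussian, charFun_gaussianReal, gaussianCharFun, Complex.ofReal_exp, e,
    Real.coe_toNNReal _ h0]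
  congr 1
  simp only [Complex.ofReal_neg, Complex.ofReal_div, Complex.ofReal_mul, Complex.ofReal_pow,
    Complex.ofReal_zero, mul_zero, zero_mul, zero_sub, Complex.ofReal_ofNat]

lemma integrable_id_weightedLaw [IsProbabilityMeasure μ] (hd : ∀ j, Measurable (d j))
    (h4 : ∀ j, MemLp (d j) 4 μ) (a : Fin n → ℝ) : Integrable id (weightedLaw μ d a) := by
  rw [weightedLaw, integrable_map_measure (by fun_prop) (measurable_weighted_sum hd a).aemeasurable]
  have h (j : Fin n) : Integrable (fun ω => a j * d j ω) μ :=
    ((h4 j).integrable (by norm_num)).const_mul _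
  exact integrable_finsetSum Finset.univ fun j _ => h j

lemma integrable_id_weightedGaussian (a : Fin n → ℝ) : Integrable id (weightedGaussian μ d a) :=
  (memLp_id_gaussianReal 1).integrable le_rfl

/-- The Kolmogorov distance between the law of `∑ a_j d_j` and its Gaussian counterpart. -/
def weightedDist (μ : Measure Ω) (d : Fin n → Ω → ℝ) (a : Fin n → ℝ) : ℝ :=
  kolmogorovDist (weightedLaw μ d a) (weightedGaussian μ d a)

lemma weightedDist_nonneg (a : Fin n → ℝ) : 0 ≤ weightedDist μ d a :=
  kolmogorovDist_nonneg _ _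

lemma weightedDist_le_one [IsProbabilityMeasure μ] (hd : ∀ j, Measurable (d j)) (a : Fin n → ℝ) :
    weightedDist μ d a ≤ 1 :=
  have := isProbabilityMeasure_weightedLaw (μ := μ) hd
  kolmogorovDist_le_one _ _

lemma measurable_weightedDist [IsProbabilityMeasure μ] (hd : ∀ j, Measurable (d j)) :
    Measurable (weightedDist μ d) := by
  have := isProbabilityMeasure_weightedLaw (μ := μ) hd
  refine measurable_kolmogorovDist (fun q => ?_) fun q => ?_
  · have hf : Measurable fun p : (Fin n → ℝ) × Ω => ∑ j, p.1 j * d j p.2 :=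
      Finset.measurable_fun_sum _ fun j _ =>
        ((measurable_pi_apply j).comp measurable_fst).mul ((hd j).comp measurable_snd)
    exact measurable_map_real_Iic μ hf q
  · have hf : Measurable fun p : (Fin n → ℝ) × ℝ =>
        √((Real.toNNReal (∑ i, p.1 i ^ 2 * ∫ ω, d i ω ^ 2 ∂μ) : ℝ≥0) : ℝ) * p.2 := by
      fun_prop
    simp only [weightedGaussian, gaussianReal_zero_eq_map (Real.toNNReal _)]
    exact measurable_map_real_Iic (gaussianReal 0 1) hf q

/-- Almost surely the conditional distribution in `kappa` is the law of `S_n` with `θ` frozen. -/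
lemma kappa_ae_eq [IsProbabilityMeasure μ] {θ : Ω → UnitSphere n} (hd : ∀ j, Measurable (d j))
    (hθ : Measurable θ) (hind : IndepFun θ (fun ω j => d j ω) μ) :
    (fun ω => kappa μ d θ (θ ω))
      =ᵐ[μ] fun ω => weightedDist μ d (θ ω : EuclideanSpace ℝ (Fin n)) := by
  have hf : Measurable fun p : UnitSphere n × (Fin n → ℝ) =>
      ∑ j, (p.1 : EuclideanSpace ℝ (Fin n)) j * p.2 j := by
    fun_prop
  have h := ae_of_ae_map hθ.aemeasurable
    (condDistrib_ae_eq_map_of_indepFun hθ (measurable_pi_lambda _ hd) hind hf)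
  filter_upwards [h] with ω hω
  exact congrArg (fun P => kolmogorovDist P (gaussianGiven μ d (θ ω))) hω

lemma one_le_alpha (h4 : ∀ j, MemLp (d j) 4 μ) [IsProbabilityMeasure μ]
    (hsum : ∑ k, ∫ ω, d k ω ^ 2 ∂μ = n) (hn : 0 < n) : 1 ≤ alpha μ d := by
  have : Nonempty (Fin n) := ⟨⟨0, hn⟩⟩
  obtain ⟨k, -, hk⟩ := Finset.exists_le_of_sum_le (s := Finset.univ) (f := fun _ : Fin n => (1 : ℝ))
    (g := fun k => ∫ ω, d k ω ^ 2 ∂μ) Finset.univ_nonempty (by simp [hsum])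
  exact (one_le_pow₀ hk).trans (sq_integral_sq_le_alpha h4 k)

/-- The distance of the two characteristic functions at `t • x`. -/
def charFunGap (μ : Measure Ω) (d : Fin n → Ω → ℝ) (x : EuclideanSpace ℝ (Fin n)) (t : ℝ) : ℝ :=
  ‖vectorCharFun μ d (fun i => t * x i) - (gaussianCharFun μ d (fun i => t * x i) : ℂ)‖

lemma continuous_charFunGap [IsProbabilityMeasure μ] (hd : ∀ j, Measurable (d j)) :
    Continuous (Function.uncurry (charFunGap μ d)) := by
  have hc0 : Continuous fun (p : EuclideanSpace ℝ (Fin n) × ℝ) (i : Fin n) => p.2 * p.1 i := by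
    fun_prop
  have h1 := (continuous_vectorCharFun (μ := μ) hd).comp hc0
  have h2 := Complex.continuous_ofReal.comp
    ((continuous_gaussianCharFun (μ := μ) (d := d)).comp hc0)
  exact (h1.sub h2).norm

/-- Pointwise bound by smoothing at scale `1 / n`. On the exceptional set the normal law is too
concentrated for smoothing, and the trivial bound `1` is used. -/
lemma ofReal_weightedDist_le [IsProbabilityMeasure μ] (hd : ∀ j, Measurable (d j))
    (h4 : ∀ j, MemLp (d j) 4 μ) (hn : 0 < n) (x : EuclideanSpace ℝ (Fin n)) :
    ENNReal.ofReal (weightedDist μ d x)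
      ≤ {x : EuclideanSpace ℝ (Fin n) | ∑ i, (∫ ω, d i ω ^ 2 ∂μ) * x i ^ 2 ≤ 1 / 2}.indicator 1 x
        + (ENNReal.ofReal (6 / n)
        + 2 * ∫⁻ t in Set.Ioi (0 : ℝ), ENNReal.ofReal (Real.exp (-((1 / n : ℝ) ^ 2 * t ^ 2 / 2)) / t
          * charFunGap μ d x t)) := by
  have hn' : (0 : ℝ) < n := by exact_mod_cast hn
  have := isProbabilityMeasure_weightedLaw (μ := μ) hd x
  by_cases hx : ∑ i, (∫ ω, d i ω ^ 2 ∂μ) * x i ^ 2 ≤ 1 / 2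
  · rw [Set.indicator_of_mem (by exact hx), Pi.one_apply]
    refine le_trans ?_ le_self_add
    rw [ENNReal.ofReal_le_one]
    exact kolmogorovDist_le_one _ _
  · rw [Set.indicator_of_notMem (by exact hx), zero_add]
    have hv : 1 / 2 ≤ Real.toNNReal (∑ i, x i ^ 2 * ∫ ω, d i ω ^ 2 ∂μ) := by
      rw [← NNReal.coe_le_coe]
      refine le_trans ?_ (Real.le_coe_toNNReal _)
      simp only [mul_comm (_ ^ 2)]
      push_cast
      exact (not_le.1 hx).le
    have h := ofReal_kolmogorovDist_le (integrable_id_weightedLaw (μ := μ) hd h4 x)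
      (integrable_id_weightedGaussian (μ := μ) (d := d) x) (ε := 1 / n) (by positivity)
      zero_le_one (gaussianReal_Iic_add_le hv)
    simp only [charFun_weightedLaw hd, charFun_weightedGaussian] at h
    refine h.trans (le_of_eq ?_)
    simp only [charFunGap, NNReal.coe_div, NNReal.coe_one, NNReal.coe_natCast, mul_one,
      mul_one_div]

lemma lintegral_lintegral_charFunGap [IsProbabilityMeasure μ]
    {ν : Measure (EuclideanSpace ℝ (Fin n))} (hν : IsSphereUniform ν)
    (hd : ∀ j, Measurable (d j)) (ε : ℝ) :
    ∫⁻ x, (∫⁻ t in Set.Ioi (0 : ℝ), ENNReal.ofReal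
        (Real.exp (-(ε ^ 2 * t ^ 2 / 2)) / t * charFunGap μ d x t)) ∂ν
      = ∫⁻ t in Set.Ioi (0 : ℝ), ENNReal.ofReal
        (Real.exp (-(ε ^ 2 * t ^ 2 / 2)) / t * ∫ x, charFunGap μ d x t ∂ν) := by
  have := hν.isProbabilityMeasure
  have hcF := continuous_charFunGap (μ := μ) hd
  have hmeas : Measurable (Function.uncurry fun (x : EuclideanSpace ℝ (Fin n)) (t : ℝ) =>
      ENNReal.ofReal (Real.exp (-(ε ^ 2 * t ^ 2 / 2)) / t * charFunGap μ d x t)) := by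
    have h1 : Measurable fun p : EuclideanSpace ℝ (Fin n) × ℝ =>
        Real.exp (-(ε ^ 2 * p.2 ^ 2 / 2)) / p.2 := by fun_prop
    exact (h1.mul hcF.measurable).ennreal_ofReal
  refine (lintegral_lintegral_swap (μ := ν) (ν := volume.restrict (Set.Ioi (0 : ℝ)))
    hmeas.aemeasurable).trans (setLIntegral_congr_fun measurableSet_Ioi fun t ht => ?_)
  have ht0 : (0 : ℝ) < t := ht
  have hct : Continuous fun x => charFunGap μ d x t :=
    hcF.uncurry_right t
  have hint := (hν.integrable_of_continuous hct).const_mul (Real.exp (-(ε ^ 2 * t ^ 2 / 2)) / t)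
  have h0 (x) : 0 ≤ Real.exp (-(ε ^ 2 * t ^ 2 / 2)) / t * charFunGap μ d x t :=
    mul_nonneg (by positivity) (norm_nonneg _)
  have h1 := ofReal_integral_eq_lintegral_ofReal hint (ae_of_all _ h0)
  rw [integral_const_mul] at h1
  exact h1.symm

lemma alpha_le_mul_vBound (hn : 2 ≤ n) : alpha μ d ≤ 4 * vBound μ ℱ d := by
  have hα := alpha_nonneg (μ := μ) (d := d)
  have hβ := beta_nonneg (μ := μ) (ℱ := ℱ) (d := d)
  have hγ := gamma_nonneg (μ := μ) (ℱ := ℱ) (d := d)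
  have hσ := sigmaFourSq_nonneg (μ := μ) (d := d)
  have hl1 : 1 / 2 ≤ Real.log n := by
    have h1 := Real.log_two_gt_d9
    have h2 : Real.log 2 ≤ Real.log n := Real.log_le_log (by norm_num) (by exact_mod_cast hn)
    linarith
  have hl0 : 0 ≤ Real.log n := by linarith
  have e1 := mul_nonneg hγ hl0
  have e2 := mul_nonneg hβ (Real.rpow_nonneg hl0 (3 / 2))
  have e3 := mul_nonneg hσ hl0
  have e4 : 1 ≤ 4 * Real.log n ^ 2 := by nlinarith
  have e5 := mul_le_mul_of_nonneg_left e4 hα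
  unfold vBound
  linarith

/-- The bound for deterministic coefficients, averaged over the sphere. -/
lemma integral_weightedDist_le {ν : Measure (EuclideanSpace ℝ (Fin n))} [IsProbabilityMeasure μ]
    (hν : IsSphereUniform ν) (hd : IsMartingaleDifference μ ℱ d) (h4 : ∀ j, MemLp (d j) 4 μ)
    (hsum : ∑ k, ∫ ω, d k ω ^ 2 ∂μ = n) (hn : 2 ≤ n) :
    ∫ x, weightedDist μ d x ∂ν ≤ 3 * 10 ^ 9 * ((1 + vBound μ ℱ d) / n) := by
  have := hν.isProbabilityMeasure
  have hdm := hd.measurable_ambient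
  have hn0 : 0 < n := by omega
  have hn' : (0 : ℝ) < n := by exact_mod_cast hn0
  have hα := one_le_alpha h4 hsum hn0
  have hα0 : 0 ≤ alpha μ d := zero_le_one.trans hα
  have hαv := alpha_le_mul_vBound (μ := μ) (d := d) (ℱ := ℱ) hn
  have hv0 : 0 ≤ vBound μ ℱ d := by linarith
  have hBm : MeasurableSet {x : EuclideanSpace ℝ (Fin n) |
      ∑ i, (∫ ω, d i ω ^ 2 ∂μ) * x i ^ 2 ≤ 1 / 2} := measurableSet_le (by fun_prop) (by fun_prop)
  have hmain := lintegral_exp_div_mul_le hn hα (beta_nonneg (μ := μ) (ℱ := ℱ) (d := d))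
    (gamma_nonneg (μ := μ) (ℱ := ℱ) (d := d)) (sigmaFourSq_nonneg (μ := μ) (d := d))
    (v := vBound μ ℱ d) (h := fun t => ∫ x, charFunGap μ d x t ∂ν) (by rw [vBound])
    (fun t ht => integral_norm_vectorCharFun_sub_le hν hd h4 hn0 ht)
    (fun t => integral_norm_vectorCharFun_sub_le_add_exp hν hd h4 hsum hn t)
  have hm : Measurable fun x : EuclideanSpace ℝ (Fin n) => weightedDist μ d x :=
    (measurable_weightedDist hdm).comp (by fun_prop)
  have hint : Integrable (fun x : EuclideanSpace ℝ (Fin n) => weightedDist μ d x) ν := by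
    refine Integrable.of_bound hm.aestronglyMeasurable 1 (ae_of_all _ fun x => ?_)
    rw [Real.norm_eq_abs, abs_of_nonneg (weightedDist_nonneg _)]
    exact weightedDist_le_one hdm _
  have hle : ENNReal.ofReal (∫ x, weightedDist μ d x ∂ν)
      ≤ ENNReal.ofReal (8 * alpha μ d / n) + (ENNReal.ofReal (6 / n)
        + ENNReal.ofReal 2 * ENNReal.ofReal (10 ^ 9 * ((1 + vBound μ ℱ d) / n))) := by
    rw [ofReal_integral_eq_lintegral_ofReal hint (ae_of_all _ fun x => weightedDist_nonneg _),
      ENNReal.ofReal_ofNat]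
    refine (lintegral_mono fun x => ofReal_weightedDist_le hdm h4 hn0 x).trans ?_
    rw [lintegral_add_left (measurable_one.indicator hBm), lintegral_indicator_one hBm,
      lintegral_add_left measurable_const, lintegral_const, measure_univ, mul_one,
      lintegral_const_mul' _ _ ENNReal.ofNat_ne_top]
    refine add_le_add ?_ (add_le_add le_rfl (mul_le_mul_right
      ((lintegral_lintegral_charFunGap hν hdm _).le.trans hmain) _))
    rw [← ofReal_measureReal]
    exact ENNReal.ofReal_le_ofReal
      (hν.measure_weighted_sum_le hsum (fun i => sq_integral_sq_le_alpha h4 i) hn0)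
  rw [← ENNReal.ofReal_mul (by norm_num), ← ENNReal.ofReal_add (by positivity) (by positivity),
    ← ENNReal.ofReal_add (by positivity) (by positivity),
    ENNReal.ofReal_le_ofReal_iff (by positivity)] at hle
  refine hle.trans ?_
  have e : 8 * alpha μ d / n + (6 / n + 2 * (10 ^ 9 * ((1 + vBound μ ℱ d) / n)))
      = (8 * alpha μ d + 6 + 2 * 10 ^ 9 * (1 + vBound μ ℱ d)) / n := by ring
  rw [e, ← mul_div_assoc]
  refine div_le_div_of_nonneg_right ?_ hn'.le
  linarith

end RandomizedMartingale

end

theorem theorem1 :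
    ∃ C : ℝ, 0 < C ∧
      ∀ (n : ℕ), 2 ≤ n →
      ∀ (Ω : Type*) [mΩ : MeasurableSpace Ω] (μ : Measure Ω) [IsProbabilityMeasure μ]
        (ℱ : Filtration (Fin (n + 1)) mΩ) (d : Fin n → Ω → ℝ)
        (θ : Ω → RandomizedMartingale.UnitSphere n),
        RandomizedMartingale.IsMartingaleDifference μ ℱ d →
        (∀ j, MemLp (d j) 4 μ) →
        ∑ k, ∫ ω, d k ω ^ 2 ∂μ = n →
        Measurable θ →
        μ.map θ = RandomizedMartingale.uniformSphere n →
        IndepFun θ (fun ω j => d j ω) μ →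
        Integrable (fun ω => RandomizedMartingale.kappa μ d θ (θ ω)) μ ∧
        ∫ ω, RandomizedMartingale.kappa μ d θ (θ ω) ∂μ
          ≤ C * ((1 + RandomizedMartingale.vBound μ ℱ d) / n) := by
  refine ⟨3 * 10 ^ 9, by norm_num, ?_⟩
  intro n hn Ω mΩ μ _ ℱ d θ hd h4 hsum hθ hmap hind
  have hdm := hd.measurable_ambient
  have hae := RandomizedMartingale.kappa_ae_eq hdm hθ hind
  have hm : Measurable fun x : EuclideanSpace ℝ (Fin n) =>
      RandomizedMartingale.weightedDist μ d x :=
    (RandomizedMartingale.measurable_weightedDist hdm).comp (by fun_prop)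
  constructor
  · refine Integrable.congr ?_ hae.symm
    refine Integrable.of_bound (hm.comp (measurable_subtype_coe.comp hθ)).aestronglyMeasurable 1
      (ae_of_all _ fun ω => ?_)
    rw [Real.norm_eq_abs, abs_of_nonneg (RandomizedMartingale.weightedDist_nonneg _)]
    exact RandomizedMartingale.weightedDist_le_one hdm _
  · have h := RandomizedMartingale.integral_weightedDist_le
      (RandomizedMartingale.isSphereUniform_uniformSphere hn) hd h4 hsum hn
    rw [← hmap, Measure.map_map measurable_subtype_coe hθ,
      integral_map (measurable_subtype_coe.comp hθ).aemeasurable hm.aestronglyMeasurable] at h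
    rw [integral_congr_ae hae]
    exact h
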